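/- **Setting.** Let $\Lambda$ be a finite directed graph with vertex set $V$ and edge set $E$ (loops and multiple edges allowed), and let $G$ be a compact Hausdorff topological group (for example a compact Lie group) with Haar probability measure $dg$. Let $\hat G$ be the set of equivalence classes of irreducible continuous unitary representations of $G$. For each $\alpha\in\hat G$ fix a unitary matrix representation $D^\alpha$ of dimension $d_\alpha$. Each vertex $v$ carries a finite-dimensional Hilbert space $\mathcal H_v$ with a continuous unitary representation $U_v$ of $G$. Each edge $e$ carries $L^2(G)$ cut off to a finite set of irreps; this is the Hilbert space $\mathcal H_e$ with orthonormal basis $|\alpha ij\rangle_e$, where $\alpha$ lies in the cutoff set of $e$ and $1\le i,j\le d_\alpha$, and with the group actions $$L_e(g)|\alpha ij\rangle=\sum_k\overline{D^\alpha_{ki}(g)}\,|\alpha kj\rangle,\qquad R_e(g^{-1})|\alpha ij\rangle=\sum_kD^\alpha_{kj}(g)\,|\alpha ik\rangle .$$ Let $\mathcal H=\bigotimes_v\mathcal H_v\otimes\bigotimes_e\mathcal H_e$. For a vertex $v$ put $$A_v(g)=U_v(g)\prod_{e\text{ starting at }v}L_e(g)\prod_{e\text{ ending at }v}R_e(g^{-1}),\qquad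 \Pi_v=\int dg\,A_v(g),\qquad \Pi_{GI}=\prod_v\Pi_v .$$ A state (density operator) $\rho$ on $\mathcal H$ is gauge-invariant if $\Pi_{GI}\,\rho\,\Pi_{GI}=\rho$. Let $r\subseteq V\sqcup E$ be any subset and $\bar r$ its complement, so that $\mathcal H=\mathcal H_r\otimes\mathcal H_{\bar r}$. Put $\mathcal A_r=\mathcal B(\mathcal H_r)\otimes 1$ and $$\tilde{\mathcal A}_r=\{O\,\Pi_{GI}:O\in\mathcal A_r,\ [O,\Pi_{GI}]=0\}.$$ A vertex is strictly in $r$ if it and all its edges lie in $r$, and similarly for $\bar r$. The cut $V_c=\{v_1,\dots,v_n\}$ consists of the vertices that are strictly in neither. Let $\hat{\mathcal H}_r\subseteq\mathcal H_r$ be the range of the product of the projectors $\int dg\,A_v(g)$ (acting on $\mathcal H_r$) over the vertices $v$ strictly in $r$. The group $G^n$ acts on $\hat{\mathcal H}_r$ by the product over the cut vertices of the factors in $\mathcal H_r$ of $A_{v_1}(g_1),\dots,A_{v_n}(g_n)$. For an irrep $\alpha=(\alpha_1,\dots,\alpha_n)\in\hat G^n$ of $G^n$ let $d_\alpha=\prod_id_{\alpha_i}$,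 let $\hat P^\alpha_r$ be the orthogonal projection of $\mathcal H_r$ onto the $\alpha$-isotypic subspace of $\hat{\mathcal H}_r$, and put $$\tilde P^\alpha=(\hat P^\alpha_r\otimes1)\,\Pi_{GI},\qquad \Delta\tilde A=\bigoplus_\alpha\tilde P^\alpha\log d_\alpha .$$ Let $\rho$ be a gauge-invariant state. Write $S(\rho,\mathcal A_r)=-\mathrm{Tr}\,\rho_r\log\rho_r$ with $\rho_r=\mathrm{Tr}_{\bar r}\,\rho$. **Theorem.** 1. There is a unique tracial linear functional $\widetilde{\mathrm{Tr}}_r$ on $\tilde{\mathcal A}_r$ that equals $1$ on every minimal projection of $\tilde{\mathcal A}_r$. There is a unique $\tilde\rho_r\in\tilde{\mathcal A}_r$ with $\widetilde{\mathrm{Tr}}_r(\tilde\rho_r\,O)=\mathrm{Tr}(\rho\,O)$ for all $O\in\tilde{\mathcal A}_r$; it is positive semidefinite and $\widetilde{\mathrm{Tr}}_r\,\tilde\rho_r=1$. Put $S(\rho,\tilde{\mathcal A}_r)=-\widetilde{\mathrm{Tr}}_r\,\tilde\rho_r\log\tilde\rho_r$. 2. The $\tilde P^\alpha$ are mutually orthogonal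 projections in the center of $\tilde{\mathcal A}_r$. Only finitely many are nonzero, and their sum is $\Pi_{GI}$. The operator $\Delta\tilde A$ lies in the center of $\tilde{\mathcal A}_r$, and $$S(\rho,\mathcal A_r)=S(\rho,\tilde{\mathcal A}_r)+\widetilde{\mathrm{Tr}}_r\big(\tilde\rho_r\,\Delta\tilde A\big).$$ 3. Consider a tensor network with arbitrary tensors at finitely many nodes, contracted along links of common bond dimension $D$ by projection onto $D^{-1/2}\sum_\mu|\mu\mu\rangle$, with one bulk leg for each vertex and each edge of $\Lambda$, and with dangling boundary legs of arbitrary dimensions. Feed $\rho$ into the bulk legs and suppose that the resulting boundary state is nonzero. For a set $R$ of boundary legs, let $S(R)$ be the von Neumann entropy on $R$ of the normalized boundary state. Let $a$ be a set of nodes such that a boundary leg is attached to a node of $a$ exactly when it is in $R$, and suppose that $a$ minimizes the number of links with exactly one end in $a$ among all such sets. Let $|\gamma_R|$ be this minimal number, and suppose that $r$ is the set of vertices and edges of $\Lambda$ whose bulk legs are attached to nodes of $a$. Then the area operator $$\tilde A=|\gamma_R|\log D\;\Pi_{GI}+\bigoplus_\alpha\tilde P^\alpha\log d_\alpha=|\gamma_R|\log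 D\;\Pi_{GI}+\bigoplus_\alpha\tilde P^\alpha\sum_{i=1}^n\log d_{\alpha_i}$$ lies in the center of $\tilde{\mathcal A}_r$, and $$|\gamma_R|\log D+S(\rho,\mathcal A_r)=\widetilde{\mathrm{Tr}}_r(\tilde\rho_r\tilde A)+S(\rho,\tilde{\mathcal A}_r).$$ Consequently, whenever the random-tensor-network formula $S(R)=|\gamma_R|\log D+S(\rho,\mathcal A_r)$ holds for this network, exactly or up to an error at most $\varepsilon$, the formula $$S(R)=\widetilde{\mathrm{Tr}}_r(\tilde\rho_r\tilde A)+S(\rho,\tilde{\mathcal A}_r)$$ holds exactly, respectively up to an error at most $\varepsilon$. -/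

import Mathlib

set_option linter.unusedSectionVars false

open MeasureTheory Matrix
open scoped Kronecker ComplexOrder

noncomputable section

namespace GaugedRTN

/-! ### Finite tensor products in orthonormal bases

A finite family of finite-dimensional Hilbert spaces with orthonormal bases indexed by `X s` has a
tensor product with orthonormal basis indexed by `∀ s, X s`; operators are matrices in that basis. -/

section TensorProducts

variable {ι : Type*} {X : ι → Type*}

/-- Basis labels of the tensor product over the tensor factors in `r`. -/
abbrev Conf (X : ι → Type*) (r : Finset ι) := ∀ s : r, X s

/-- The tensor product `⨂ₛ A s` of operators on the factors. -/
def tensorOp [Fintype ι] (A : ∀ s, Matrix (X s) (X s) ℂ) : Matrix (∀ s, X s) (∀ s, X s) ℂ :=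
  fun x y => ∏ s, A s (x s) (y s)

/-- Restriction of a basis label to the factors in `r`. -/
def restrict (r : Finset ι) (x : ∀ s, X s) : Conf X r := fun s => x s

/-- The basis label which is `a` on `r` and `b` on the complement. -/
def glue [Fintype ι] [DecidableEq ι] {r : Finset ι} (a : Conf X r) (b : Conf X rᶜ) : ∀ s, X s :=
  fun s => if h : s ∈ r then a ⟨s, h⟩ else b ⟨s, Finset.mem_compl.mpr h⟩

/-- The operator `O ⊗ 1` on the full space, for an operator `O` on the factors in `r`. -/
def extendOp [Fintype ι] [DecidableEq ι] [∀ s, DecidableEq (X s)] {r : Finset ι}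
    (O : Matrix (Conf X r) (Conf X r) ℂ) : Matrix (∀ s, X s) (∀ s, X s) ℂ :=
  fun x y => if restrict rᶜ x = restrict rᶜ y then O (restrict r x) (restrict r y) else 0

/-- The partial trace over the complement of `r`. -/
def partialTrace [Fintype ι] [DecidableEq ι] [∀ s, Fintype (X s)] (r : Finset ι)
    (ρ : Matrix (∀ s, X s) (∀ s, X s) ℂ) : Matrix (Conf X r) (Conf X r) ℂ :=
  fun a a' => ∑ b : Conf X rᶜ, ρ (glue a b) (glue a' b)

/-- The orthogonal projection onto a subspace, as a matrix. -/
def projMatrix {n : Type*} [Fintype n] [DecidableEq n] (W : Submodule ℂ (EuclideanSpace ℂ n)) :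
    Matrix n n ℂ :=
  (Matrix.toEuclideanCLM (n := n) (𝕜 := ℂ)).symm W.starProjection

/-- The von Neumann entropy `- Tr ρ log ρ` of a density matrix. -/
def vnEntropy {n : Type*} [Fintype n] [DecidableEq n] (ρ : Matrix n n ℂ) : ℝ :=
  (Matrix.trace (cfc Real.negMulLog ρ)).re

lemma tensorOp_mul [Fintype ι] [DecidableEq ι] [∀ s, Fintype (X s)]
    (A B : ∀ s, Matrix (X s) (X s) ℂ) :
    tensorOp A * tensorOp B = tensorOp fun s => A s * B s := by
  ext x y
  simp only [tensorOp, Matrix.mul_apply, Finset.prod_univ_sum, Fintype.piFinset_univ,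
    Finset.prod_mul_distrib]

lemma tensorOp_conjTranspose [Fintype ι] (A : ∀ s, Matrix (X s) (X s) ℂ) :
    (tensorOp A)ᴴ = tensorOp fun s => (A s)ᴴ := by
  ext x y
  simp [tensorOp, Matrix.conjTranspose_apply]

lemma extendOp_zero [Fintype ι] [DecidableEq ι] [∀ s, DecidableEq (X s)] {r : Finset ι} :
    extendOp (0 : Matrix (Conf X r) (Conf X r) ℂ) = 0 := by
  ext x y
  simp [extendOp]

lemma extendOp_add [Fintype ι] [DecidableEq ι] [∀ s, DecidableEq (X s)] {r : Finset ι}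
    (O O' : Matrix (Conf X r) (Conf X r) ℂ) :
    extendOp (O + O') = extendOp O + extendOp O' := by
  ext x y
  simp only [extendOp, Matrix.add_apply]
  split_ifs <;> simp

lemma extendOp_smul [Fintype ι] [DecidableEq ι] [∀ s, DecidableEq (X s)] {r : Finset ι} (c : ℂ)
    (O : Matrix (Conf X r) (Conf X r) ℂ) : extendOp (c • O) = c • extendOp O := by
  ext x y
  simp only [extendOp, Matrix.smul_apply]
  split_ifs <;> simp

lemma extendOp_mul [Fintype ι] [DecidableEq ι] [∀ s, Fintype (X s)] [∀ s, DecidableEq (X s)]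
    {r : Finset ι} (O O' : Matrix (Conf X r) (Conf X r) ℂ) :
    extendOp (O * O') = extendOp O * extendOp O' := by
  ext x y
  simp only [extendOp, Matrix.mul_apply]
  by_cases h : restrict rᶜ x = restrict rᶜ y
  · simp only [h, if_true]
    have key : ∀ a : Conf X r, restrict r (glue a (restrict rᶜ y)) = a ∧
        restrict rᶜ (glue a (restrict rᶜ y)) = restrict rᶜ y := by
      intro a
      constructor
      · ext s
        simp [restrict, glue]
      · ext s
        have hs : (s : ι) ∉ r := Finset.mem_compl.mp s.2
        simp [restrict, glue, hs]
    symm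
    rw [← Finset.sum_subset (Finset.subset_univ
      (Finset.univ.image fun a : Conf X r => glue a (restrict rᶜ y)))]
    · rw [Finset.sum_image]
      · refine Finset.sum_congr rfl fun a _ => ?_
        simp [(key a).1, (key a).2]
      · intro a _ b _ hab
        rw [← (key a).1, ← (key b).1]
        exact congrArg (restrict r) hab
    · intro z _ hz
      by_cases hzy : restrict rᶜ y = restrict rᶜ z
      · exfalso
        apply hz
        refine Finset.mem_image.mpr ⟨restrict r z, Finset.mem_univ _, ?_⟩
        ext s
        by_cases hs : s ∈ r
        · simp [glue, restrict, hs]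
        · have := congrFun hzy ⟨s, Finset.mem_compl.mpr hs⟩
          simpa [glue, restrict, hs] using this
      · simp [hzy]
  · simp only [h, if_false]
    symm
    refine Finset.sum_eq_zero fun z _ => ?_
    by_cases h1 : restrict rᶜ x = restrict rᶜ z
    · have h2 : restrict rᶜ z ≠ restrict rᶜ y := fun h2 => h (h1.trans h2)
      simp [h2]
    · simp [h1]

lemma extendOp_conjTranspose [Fintype ι] [DecidableEq ι] [∀ s, DecidableEq (X s)] {r : Finset ι}
    (O : Matrix (Conf X r) (Conf X r) ℂ) : (extendOp O)ᴴ = extendOp Oᴴ := by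
  ext x y
  simp only [extendOp, Matrix.conjTranspose_apply, eq_comm (a := restrict rᶜ y)]
  split_ifs <;> simp

end TensorProducts

/-! ### Normalized trace, reduced state and entropy for an algebra of matrices

The algebras are closed under sums, products, scalars and adjoints, and their unit (if any) need
not be the identity matrix. -/

section Algebras

variable {n : Type*} [Fintype n] [DecidableEq n] (A : NonUnitalStarSubalgebra ℂ (Matrix n n ℂ))

/-- A minimal projection of `A`: a nonzero projection in `A` whose only subprojections in `A` are
zero and itself. -/
def IsMinimalProjection (p : A) : Prop :=
  p ≠ 0 ∧ IsStarProjection p ∧ ∀ q : A, IsStarProjection q → p * q = q → q = 0 ∨ q = p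

/-- A linear functional on `A` is the normalized trace if it is tracial and equals `1` on every
minimal projection. -/
def IsNormalizedTrace (τ : A →ₗ[ℂ] ℂ) : Prop :=
  (∀ a b : A, τ (a * b) = τ (b * a)) ∧ ∀ p : A, IsMinimalProjection A p → τ p = 1

variable {A}

/-- `σ ∈ A` is the reduced state of `ρ` on `A` with respect to the trace `τ`. -/
def IsReducedState (τ : A →ₗ[ℂ] ℂ) (ρ : Matrix n n ℂ) (σ : A) : Prop :=
  ∀ a : A, τ (σ * a) = Matrix.trace (ρ * (a : Matrix n n ℂ))

lemma cfcn_mem (σ : A) : cfcₙ Real.negMulLog (σ : Matrix n n ℂ) ∈ A := by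
  have hcl : IsClosed (A : Set (Matrix n n ℂ)) :=
    Submodule.closed_of_finiteDimensional A.toNonUnitalSubalgebra.toSubmodule
  exact cfcₙ_mem (𝕜' := ℂ) (hs := hcl) Real.negMulLog σ.2

/-- The entropy `- τ (σ log σ)` of a density operator `σ` of the algebra `A` with trace `τ`. -/
def algEntropy (τ : A →ₗ[ℂ] ℂ) (σ : A) : ℝ :=
  (τ ⟨cfcₙ Real.negMulLog (σ : Matrix n n ℂ), cfcn_mem σ⟩).re

end Algebras

/-! ### Unitary representations and irreps of a compact group -/

/-- A finite-dimensional continuous unitary (matrix) representation. -/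
structure UnitaryRep (G : Type*) [Group G] [TopologicalSpace G] where
  dim : ℕ
  hom : G →* Matrix.unitaryGroup (Fin dim) ℂ
  continuous_hom : Continuous hom

namespace UnitaryRep

variable {G : Type*} [Group G] [TopologicalSpace G]

/-- The matrix `D(g)`. -/
def mat (π : UnitaryRep G) (g : G) : Matrix (Fin π.dim) (Fin π.dim) ℂ := (π.hom g).1

lemma mat_one (π : UnitaryRep G) : π.mat 1 = 1 := by simp [mat]

lemma mat_mul (π : UnitaryRep G) (g h : G) : π.mat (g * h) = π.mat g * π.mat h := by simp [mat]

lemma mat_inv (π : UnitaryRep G) (g : G) : π.mat g⁻¹ = (π.mat g)ᴴ := by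
  simp [mat, Matrix.star_eq_conjTranspose]

lemma continuous_mat (π : UnitaryRep G) (i j : Fin π.dim) : Continuous fun g => π.mat g i j :=
  ((continuous_subtype_val.comp π.continuous_hom).matrix_elem i j)

/-- The underlying linear representation on `ℂ^dim`. -/
def rep (π : UnitaryRep G) : Representation ℂ G (Fin π.dim → ℂ) where
  toFun g := Matrix.toLin' (π.mat g)
  map_one' := by simp [mat_one, Module.End.one_eq_id]
  map_mul' g h := by simp [mat_mul, Module.End.mul_eq_comp]

end UnitaryRep

/-- Irreducible unitary representations. -/
abbrev IrrepModel (G : Type*) [Group G] [TopologicalSpace G] :=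
  {π : UnitaryRep G // π.rep.IsIrreducible}

/-- Equivalence of irreducible representations. -/
instance irrepSetoid (G : Type*) [Group G] [TopologicalSpace G] : Setoid (IrrepModel G) where
  r π σ := Nonempty (π.1.rep.Equiv σ.1.rep)
  iseqv :=
    { refl := fun _ => ⟨Representation.Equiv.refl _⟩
      symm := fun ⟨φ⟩ => ⟨φ.symm⟩
      trans := fun ⟨φ⟩ ⟨ψ⟩ => ⟨φ.trans ψ⟩ }

/-- The set of irreps of `G`: equivalence classes of irreducible unitary representations. -/
def Irrep (G : Type*) [Group G] [TopologicalSpace G] := Quotient (irrepSetoid G)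

namespace Irrep

variable {G : Type*} [Group G] [TopologicalSpace G]

/-- A fixed choice, for each irrep `α`, of a unitary matrix representation `D^α`. -/
def out (α : Irrep G) : UnitaryRep G := (Quotient.out (s := irrepSetoid G) α).1

/-- The dimension `d_α`. -/
def dim (α : Irrep G) : ℕ := α.out.dim

/-- The unitary matrix `D^α(g)`. -/
def D (α : Irrep G) (g : G) : Matrix (Fin α.dim) (Fin α.dim) ℂ := α.out.mat g

lemma D_one (α : Irrep G) : α.D 1 = 1 := α.out.mat_one

lemma D_mul (α : Irrep G) (g h : G) : α.D (g * h) = α.D g * α.D h := α.out.mat_mul g h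

lemma D_inv (α : Irrep G) (g : G) : α.D g⁻¹ = (α.D g)ᴴ := α.out.mat_inv g

lemma continuous_D (α : Irrep G) (i j : Fin α.dim) : Continuous fun g => α.D g i j :=
  α.out.continuous_mat i j

/-- The wave function on `G` of the basis state `|α i j⟩` of `L²(G)`. -/
def waveFunction (α : Irrep G) (i j : Fin α.dim) (h : G) : ℂ := √(α.dim : ℝ) * α.D h i j

/-- Left multiplication `|h⟩ ↦ |g h⟩` acts on `|α i j⟩` by the conjugate matrix on `i`. -/
lemma waveFunction_left (α : Irrep G) (i j : Fin α.dim) (g h : G) :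
    α.waveFunction i j (g⁻¹ * h) = ∑ k, star (α.D g k i) * α.waveFunction k j h := by
  simp only [waveFunction, D_mul, D_inv, Matrix.mul_apply, Matrix.conjTranspose_apply,
    Finset.mul_sum]
  exact Finset.sum_congr rfl fun k _ => by ring

/-- Right multiplication `|h⟩ ↦ |h g⁻¹⟩` acts on `|α i j⟩` by `D^α(g)` on `j`. -/
lemma waveFunction_right (α : Irrep G) (i j : Fin α.dim) (g h : G) :
    α.waveFunction i j (h * g) = ∑ k, α.D g k j * α.waveFunction i k h := by
  simp only [waveFunction, D_mul, Matrix.mul_apply, Finset.mul_sum]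
  exact Finset.sum_congr rfl fun k _ => by ring

end Irrep

/-! ### Averaging over the group -/

section Averaging

variable {G : Type*} [Group G] [TopologicalSpace G] [IsTopologicalGroup G] [CompactSpace G]
  [MeasurableSpace G] [BorelSpace G]

variable (G) in
/-- The Haar measure with total mass one. -/
def haarProb : Measure G := Measure.haarMeasure (⊤ : TopologicalSpace.PositiveCompacts G)

instance : IsProbabilityMeasure (haarProb G) :=
  ⟨by simpa [haarProb] using
    Measure.haarMeasure_self (K₀ := (⊤ : TopologicalSpace.PositiveCompacts G))⟩

instance : (haarProb G).IsHaarMeasure := by unfold haarProb; infer_instance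

instance : (haarProb G).Regular := by unfold haarProb; infer_instance

instance : (haarProb G).IsMulRightInvariant where
  map_mul_right_eq_self g := by
    have : IsProbabilityMeasure (Measure.map (· * g) (haarProb G)) :=
      Measure.isProbabilityMeasure_map (measurable_mul_const g).aemeasurable
    have : (Measure.map (· * g) (haarProb G)).Regular :=
      Measure.Regular.map (Homeomorph.mulRight g)
    exact Measure.isHaarMeasure_eq_of_isProbabilityMeasure _ _

instance : (haarProb G).IsInvInvariant where
  inv_eq_self := by
    have : IsProbabilityMeasure (haarProb G).inv :=
      Measure.isProbabilityMeasure_map measurable_inv.aemeasurable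
    have : (haarProb G).inv.Regular := Measure.Regular.map (Homeomorph.inv G)
    have : (haarProb G).inv.IsHaarMeasure := by
      refine ⟨⟩
    exact Measure.isHaarMeasure_eq_of_isProbabilityMeasure _ _

/-- The average `∫ dg B(g)`, entrywise. -/
def haarAvg {n : Type*} (B : G → Matrix n n ℂ) : Matrix n n ℂ :=
  Matrix.of fun x y => ∫ g, B g x y ∂(haarProb G)

lemma commute_haarAvg {n : Type*} [Fintype n] {B : G → Matrix n n ℂ}
    (hB : ∀ x y, Continuous fun g => B g x y) {C : Matrix n n ℂ} (h : ∀ g, Commute C (B g)) :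
    Commute C (haarAvg B) := by
  have hi : ∀ x y, Integrable (fun g => B g x y) (haarProb G) := fun x y =>
    (hB x y).integrable_of_hasCompactSupport (HasCompactSupport.of_compactSpace _)
  ext x y
  simp only [Matrix.mul_apply, haarAvg, Matrix.of_apply, ← integral_const_mul,
    ← integral_mul_const]
  rw [← integral_finsetSum _ fun k _ => (hi k y).const_mul _,
    ← integral_finsetSum _ fun k _ => (hi x k).mul_const _]
  refine integral_congr_ae (Filter.Eventually.of_forall fun g => ?_)
  simpa only [Matrix.mul_apply] using congrFun (congrFun (h g).eq x) y

lemma haarAvg_conjTranspose {n : Type*} {B : G → Matrix n n ℂ} (h : ∀ g, (B g)ᴴ = B g⁻¹) :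
    (haarAvg B)ᴴ = haarAvg B := by
  ext x y
  simp only [haarAvg, Matrix.conjTranspose_apply, Matrix.of_apply]
  rw [← integral_inv_eq_self (fun g => B g x y)]
  simp_rw [← h, Matrix.conjTranspose_apply]
  exact integral_conj.symm

lemma haarAvg_mul_self {n : Type*} [Fintype n] {B : G → Matrix n n ℂ}
    (hB : ∀ x y, Continuous fun g => B g x y) (hmul : ∀ g h, B (g * h) = B g * B h) :
    haarAvg B * haarAvg B = haarAvg B := by
  have hi : ∀ x y, Integrable (fun g => B g x y) (haarProb G) := fun x y =>
    (hB x y).integrable_of_hasCompactSupport (HasCompactSupport.of_compactSpace _)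
  have hinv : ∀ h, B h * haarAvg B = haarAvg B := by
    intro h
    ext x y
    simp only [Matrix.mul_apply, haarAvg, Matrix.of_apply, ← integral_const_mul]
    rw [← integral_finsetSum _ fun k _ => (hi k y).const_mul _,
      ← integral_mul_left_eq_self (fun g => B g x y) h]
    simp only [hmul, Matrix.mul_apply]
  ext x y
  have h1 : ∀ h, ∑ k, B h x k * haarAvg B k y = haarAvg B x y := fun h => by
    rw [← Matrix.mul_apply, hinv h]
  calc (haarAvg B * haarAvg B) x y
      = ∑ k, (∫ h, B h x k ∂(haarProb G)) * haarAvg B k y := by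
        simp [Matrix.mul_apply, haarAvg]
    _ = ∫ h, ∑ k, B h x k * haarAvg B k y ∂(haarProb G) := by
        rw [integral_finsetSum _ fun k _ => (hi x k).mul_const _]
        simp only [integral_mul_const]
    _ = haarAvg B x y := by simp [h1]

end Averaging

/-! ### Gauge theory on a directed graph -/

/-- A gauge theory on a directed graph with vertices `V` and edges `E` (loops and multiple edges
allowed).  Each vertex carries an arbitrary finite-dimensional unitary representation of `G`; the
space on the edge `e` is `L²(G)`, cut off to the finite set `irrepOn e` of irreps. -/
structure GaugeModel (G : Type*) [Group G] [TopologicalSpace G] (V E : Type*) where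
  src : E → V
  tgt : E → V
  matter : V → UnitaryRep G
  numIrreps : E → ℕ
  irrepOn : ∀ e, Fin (numIrreps e) ↪ Irrep G

namespace GaugeModel

variable {G : Type*} [Group G] [TopologicalSpace G] {V E : Type*} (M : GaugeModel G V E)

/-- The representation basis `|α i j⟩` of the edge space, with `α` in the cutoff. -/
abbrev EdgeLoc (e : E) : Type :=
  Σ a : Fin (M.numIrreps e), Fin (M.irrepOn e a).dim × Fin (M.irrepOn e a).dim

/-- Basis labels of the local Hilbert spaces at the vertices and edges. -/
def Loc : V ⊕ E → Type
  | .inl v => Fin (M.matter v).dim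
  | .inr e => M.EdgeLoc e

instance : ∀ s, Fintype (M.Loc s)
  | .inl v => inferInstanceAs (Fintype (Fin (M.matter v).dim))
  | .inr e => inferInstanceAs (Fintype (M.EdgeLoc e))

instance : ∀ s, DecidableEq (M.Loc s)
  | .inl v => inferInstanceAs (DecidableEq (Fin (M.matter v).dim))
  | .inr e => inferInstanceAs (DecidableEq (M.EdgeLoc e))

/-- Basis labels of the pre-gauged Hilbert space `H = (⨂ᵥ Hᵥ) ⊗ (⨂ₑ Hₑ)`. -/
abbrev Config := ∀ s, M.Loc s

/-- Left multiplication `Lₑ(g)`: `|α i j⟩ ↦ ∑ₖ conj (D^α(g) k i) |α k j⟩`. -/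
def leftOp (e : E) (g : G) : Matrix (M.EdgeLoc e) (M.EdgeLoc e) ℂ :=
  Matrix.blockDiagonal' fun a => ((M.irrepOn e a).D g).map star ⊗ₖ
    (1 : Matrix (Fin (M.irrepOn e a).dim) (Fin (M.irrepOn e a).dim) ℂ)

/-- Right multiplication `Rₑ(g⁻¹)`: `|α i j⟩ ↦ ∑ₖ D^α(g) k j |α i k⟩`. -/
def rightOp (e : E) (g : G) : Matrix (M.EdgeLoc e) (M.EdgeLoc e) ℂ :=
  Matrix.blockDiagonal' fun a =>
    (1 : Matrix (Fin (M.irrepOn e a).dim) (Fin (M.irrepOn e a).dim) ℂ) ⊗ₖ (M.irrepOn e a).D g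

/-- The product `Lₑ(g) Rₑ(h⁻¹)`. -/
def edgeOp (e : E) (g h : G) : Matrix (M.EdgeLoc e) (M.EdgeLoc e) ℂ :=
  M.leftOp e g * M.rightOp e h

/-- The action on a vertex or an edge of the gauge transformation with parameter `g w` at each
vertex `w`. -/
def siteOp (g : V → G) : ∀ s, Matrix (M.Loc s) (M.Loc s) ℂ
  | .inl v => (M.matter v).mat (g v)
  | .inr e => M.edgeOp e (g (M.src e)) (g (M.tgt e))

lemma leftOp_mul (e : E) (g h : G) : M.leftOp e (g * h) = M.leftOp e g * M.leftOp e h := by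
  simp only [leftOp]
  rw [← Matrix.blockDiagonal'_mul]
  congr 1
  ext1 a
  rw [← Matrix.mul_kronecker_mul, Irrep.D_mul, mul_one]
  congr 1
  ext i j
  simp [Matrix.mul_apply]

lemma rightOp_mul (e : E) (g h : G) : M.rightOp e (g * h) = M.rightOp e g * M.rightOp e h := by
  simp only [rightOp]
  rw [← Matrix.blockDiagonal'_mul]
  congr 1
  ext1 a
  rw [← Matrix.mul_kronecker_mul, Irrep.D_mul, mul_one]

lemma leftOp_rightOp (e : E) (g h : G) :
    M.leftOp e g * M.rightOp e h = M.rightOp e h * M.leftOp e g := by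
  simp only [leftOp, rightOp]
  rw [← Matrix.blockDiagonal'_mul, ← Matrix.blockDiagonal'_mul]
  congr 1
  ext1 a
  rw [← Matrix.mul_kronecker_mul, ← Matrix.mul_kronecker_mul]
  simp

lemma leftOp_inv (e : E) (g : G) : (M.leftOp e g)ᴴ = M.leftOp e g⁻¹ := by
  simp only [leftOp]
  rw [Matrix.blockDiagonal'_conjTranspose]
  congr 1
  ext1 a
  rw [Matrix.conjTranspose_kronecker, Matrix.conjTranspose_one, Irrep.D_inv]
  congr 1

lemma rightOp_inv (e : E) (g : G) : (M.rightOp e g)ᴴ = M.rightOp e g⁻¹ := by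
  simp only [rightOp]
  rw [Matrix.blockDiagonal'_conjTranspose]
  congr 1
  ext1 a
  rw [Matrix.conjTranspose_kronecker, Matrix.conjTranspose_one, Irrep.D_inv]

lemma siteOp_one (s : V ⊕ E) : M.siteOp 1 s = 1 := by
  rcases s with v | e
  · exact (M.matter v).mat_one
  · change M.edgeOp e 1 1 = (1 : Matrix (M.EdgeLoc e) (M.EdgeLoc e) ℂ)
    simp only [edgeOp, leftOp, rightOp, Irrep.D_one]
    rw [← Matrix.blockDiagonal'_mul, ← Matrix.blockDiagonal'_one]
    congr 1
    ext1 a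
    simp

lemma siteOp_mul (g h : V → G) (s : V ⊕ E) :
    M.siteOp (g * h) s = M.siteOp g s * M.siteOp h s := by
  rcases s with v | e
  · exact (M.matter v).mat_mul _ _
  · change M.edgeOp e _ _ = M.edgeOp e _ _ * M.edgeOp e _ _
    simp only [edgeOp, Pi.mul_apply, leftOp_mul, rightOp_mul, Matrix.mul_assoc]
    congr 1
    rw [← Matrix.mul_assoc, leftOp_rightOp, Matrix.mul_assoc]

lemma siteOp_inv (g : V → G) (s : V ⊕ E) : (M.siteOp g s)ᴴ = M.siteOp g⁻¹ s := by
  rcases s with v | e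
  · exact ((M.matter v).mat_inv _).symm
  · change (M.edgeOp e _ _)ᴴ = M.edgeOp e _ _
    simp only [edgeOp, Matrix.conjTranspose_mul, leftOp_inv, rightOp_inv, Pi.inv_apply,
      leftOp_rightOp]

lemma continuous_edgeOp {Y : Type*} [TopologicalSpace Y] {f h : Y → G} (hf : Continuous f)
    (hh : Continuous h) (e : E) : Continuous fun t => M.edgeOp e (f t) (h t) := by
  refine Continuous.matrix_mul ?_ ?_
  · refine Continuous.matrix_blockDiagonal' (continuous_pi fun a =>
      continuous_matrix fun i j => ?_)
    simp only [Matrix.kroneckerMap_apply, Matrix.map_apply]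
    exact (continuous_star.comp
      (((M.irrepOn e a).continuous_D _ _).comp hf)).mul continuous_const
  · refine Continuous.matrix_blockDiagonal' (continuous_pi fun a =>
      continuous_matrix fun i j => ?_)
    simp only [Matrix.kroneckerMap_apply]
    exact continuous_const.mul (((M.irrepOn e a).continuous_D _ _).comp hh)

lemma continuous_siteOp {Y : Type*} [TopologicalSpace Y] {f : Y → V → G} (hf : Continuous f)
    (s : V ⊕ E) (x y : M.Loc s) : Continuous fun t => M.siteOp (f t) s x y := by
  have hf' := continuous_pi_iff.mp hf
  rcases s with v | e
  · exact ((M.matter v).continuous_mat x y).comp (hf' v)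
  · exact (M.continuous_edgeOp (hf' (M.src e)) (hf' (M.tgt e)) e).matrix_elem x y

variable [Fintype V] [DecidableEq V] [Fintype E] [DecidableEq E]

/-- The unitary `∏ᵥ Aᵥ(g v)` on `H`. -/
def gauge (g : V → G) : Matrix M.Config M.Config ℂ := tensorOp (M.siteOp g)

/-- The factor of `∏ᵥ Aᵥ(g v)` which acts on the sites of `r`. -/
def gaugeOn (r : Finset (V ⊕ E)) (g : V → G) : Matrix (Conf M.Loc r) (Conf M.Loc r) ℂ :=
  tensorOp fun s : r => M.siteOp g s

/-- The gauge transformation `Aᵥ(g)` at the vertex `v`: it acts by `Uᵥ(g)` on `v`, by `Lₑ(g)` on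
edges starting at `v`, by `Rₑ(g⁻¹)` on edges ending at `v`, and trivially on all other factors. -/
def gaugeAt (v : V) (g : G) : Matrix M.Config M.Config ℂ := M.gauge (Pi.mulSingle v g)

/-- The factor of the gauge transformation at `v` which acts on the sites of `r`. -/
def gaugeAtOn (r : Finset (V ⊕ E)) (v : V) (g : G) : Matrix (Conf M.Loc r) (Conf M.Loc r) ℂ :=
  M.gaugeOn r (Pi.mulSingle v g)

lemma gaugeOn_mul (r : Finset (V ⊕ E)) (g h : V → G) :
    M.gaugeOn r (g * h) = M.gaugeOn r g * M.gaugeOn r h := by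
  simp only [gaugeOn, tensorOp_mul, siteOp_mul]

lemma gauge_mul (g h : V → G) : M.gauge (g * h) = M.gauge g * M.gauge h := by
  simp only [gauge, tensorOp_mul]
  congr 1
  ext1 s
  exact M.siteOp_mul g h s

lemma commute_gaugeAt {v w : V} (hvw : v ≠ w) (g h : G) :
    Commute (M.gaugeAt v g) (M.gaugeAt w h) := by
  have := Pi.mulSingle_commute (f := fun _ : V => G) hvw g h
  simp only [Commute, SemiconjBy, gaugeAt, ← gauge_mul, this.eq]

lemma commute_gaugeAtOn (r : Finset (V ⊕ E)) {v w : V} (hvw : v ≠ w) (g h : G) :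
    Commute (M.gaugeAtOn r v g) (M.gaugeAtOn r w h) := by
  have := Pi.mulSingle_commute (f := fun _ : V => G) hvw g h
  simp only [Commute, SemiconjBy, gaugeAtOn, ← gaugeOn_mul, this.eq]

lemma continuous_gaugeAt (v : V) (x y : M.Config) : Continuous fun g => M.gaugeAt v g x y :=
  continuous_finsetProd _ fun s _ => M.continuous_siteOp (continuous_mulSingle v) s _ _

lemma continuous_gaugeAtOn (r : Finset (V ⊕ E)) (v : V) (x y : Conf M.Loc r) :
    Continuous fun g => M.gaugeAtOn r v g x y :=
  continuous_finsetProd _ fun s _ => M.continuous_siteOp (continuous_mulSingle v) s _ _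

lemma gaugeAt_inv (v : V) (g : G) : (M.gaugeAt v g)ᴴ = M.gaugeAt v g⁻¹ := by
  simp only [gaugeAt, gauge, tensorOp_conjTranspose, siteOp_inv, Pi.mulSingle_inv]

/-- The vertices strictly in `r`: the vertex and all its edges are in `r`. -/
def interior (r : Finset (V ⊕ E)) : Finset V :=
  Finset.univ.filter fun v => .inl v ∈ r ∧ ∀ e, M.src e = v ∨ M.tgt e = v → .inr e ∈ r

/-- The vertices on the cut: neither strictly in `r` nor strictly in the complement. -/
def cut (r : Finset (V ⊕ E)) : Finset V := (M.interior r ∪ M.interior rᶜ)ᶜ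

variable [IsTopologicalGroup G] [CompactSpace G] [MeasurableSpace G] [BorelSpace G]

/-- The projector `Πᵥ = ∫ dg Aᵥ(g)`. -/
def projAt (v : V) : Matrix M.Config M.Config ℂ := haarAvg (M.gaugeAt v)

lemma commute_projAt {v w : V} (hvw : v ≠ w) : Commute (M.projAt v) (M.projAt w) :=
  commute_haarAvg (M.continuous_gaugeAt w) fun h =>
    (commute_haarAvg (M.continuous_gaugeAt v) fun g => M.commute_gaugeAt hvw.symm h g).symm

/-- The gauge-invariant projector `Π_GI = ∏ᵥ Πᵥ` (the factors commute). -/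
def projGI : Matrix M.Config M.Config ℂ :=
  Finset.univ.noncommProd M.projAt fun _ _ _ _ h => M.commute_projAt h

lemma projAt_conjTranspose (v : V) : (M.projAt v)ᴴ = M.projAt v :=
  haarAvg_conjTranspose (M.gaugeAt_inv v)

lemma projAt_mul_self (v : V) : M.projAt v * M.projAt v = M.projAt v :=
  haarAvg_mul_self (M.continuous_gaugeAt v) fun g h => by
    simp only [gaugeAt, Pi.mulSingle_mul, gauge_mul]

lemma projGI_mul_self : M.projGI * M.projGI = M.projGI := by
  have key : ∀ (s : Finset V) (hs : (s : Set V).Pairwise fun a b =>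
      Commute (M.projAt a) (M.projAt b)),
      s.noncommProd M.projAt hs * s.noncommProd M.projAt hs = s.noncommProd M.projAt hs := by
    intro s
    induction s using Finset.induction_on with
    | empty => intro hs; simp
    | insert a s ha ih =>
      intro hs
      have h1 := Finset.noncommProd_insert_of_notMem s a M.projAt hs ha
      have h2 := Finset.noncommProd_insert_of_notMem' s a M.projAt hs ha
      have h3 := h1.symm.trans h2
      rw [h1, Matrix.mul_assoc, ← Matrix.mul_assoc _ (M.projAt a), ← h3,
        Matrix.mul_assoc (M.projAt a), ih, ← Matrix.mul_assoc, projAt_mul_self]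
  exact key _ _

lemma projGI_conjTranspose : M.projGIᴴ = M.projGI := by
  have key : ∀ (s : Finset V) (hs : (s : Set V).Pairwise fun a b =>
      Commute (M.projAt a) (M.projAt b)),
      (s.noncommProd M.projAt hs)ᴴ = s.noncommProd M.projAt hs := by
    intro s
    induction s using Finset.induction_on with
    | empty => intro hs; simp
    | insert a s ha ih =>
      intro hs
      have h1 := Finset.noncommProd_insert_of_notMem s a M.projAt hs ha
      have h2 := Finset.noncommProd_insert_of_notMem' s a M.projAt hs ha
      rw [h1, Matrix.conjTranspose_mul, ih, projAt_conjTranspose]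
      exact h2.symm.trans h1
  exact key _ _

/-! ### Subregion algebras and superselection sectors -/

/-- The algebra `{O ⊗ 1 · Π_GI : O ∈ B(H_r), [O ⊗ 1, Π_GI] = 0}` of gauge-invariant operators on
the subregion `r`; its unit is `Π_GI`. -/
def gaugeInvariantAlgebra (r : Finset (V ⊕ E)) :
    NonUnitalStarSubalgebra ℂ (Matrix M.Config M.Config ℂ) where
  carrier := {a | ∃ O : Matrix (Conf M.Loc r) (Conf M.Loc r) ℂ,
    Commute (extendOp O) M.projGI ∧ a = extendOp O * M.projGI}
  zero_mem' := ⟨0, by simp [extendOp_zero]⟩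
  add_mem' := by
    rintro _ _ ⟨O, hO, rfl⟩ ⟨O', hO', rfl⟩
    exact ⟨O + O', by rw [extendOp_add]; exact hO.add_left hO', by rw [extendOp_add, add_mul]⟩
  smul_mem' := by
    rintro c _ ⟨O, hO, rfl⟩
    exact ⟨c • O, by rw [extendOp_smul]; exact hO.smul_left c,
      by rw [extendOp_smul, smul_mul_assoc]⟩
  mul_mem' := by
    rintro _ _ ⟨O, hO, rfl⟩ ⟨O', hO', rfl⟩
    refine ⟨O * O', by rw [extendOp_mul]; exact hO.mul_left hO', ?_⟩
    rw [extendOp_mul, Matrix.mul_assoc, ← Matrix.mul_assoc M.projGI, ← hO'.eq,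
      Matrix.mul_assoc (extendOp O'), projGI_mul_self, Matrix.mul_assoc]
  star_mem' := by
    rintro _ ⟨O, hO, rfl⟩
    have h := congrArg Matrix.conjTranspose hO.eq
    rw [Matrix.conjTranspose_mul, Matrix.conjTranspose_mul, projGI_conjTranspose,
      extendOp_conjTranspose] at h
    refine ⟨Oᴴ, h.symm, ?_⟩
    rw [Matrix.star_eq_conjTranspose, Matrix.conjTranspose_mul, projGI_conjTranspose,
      extendOp_conjTranspose, h]

/-- The projector onto states of `H_r` invariant under the gauge transformations strictly in `r`. -/
def partialProj (r : Finset (V ⊕ E)) : Matrix (Conf M.Loc r) (Conf M.Loc r) ℂ :=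
  (M.interior r).noncommProd (fun v => haarAvg (M.gaugeAtOn r v)) fun _ _ _ _ h =>
    commute_haarAvg (M.continuous_gaugeAtOn r _) fun k =>
      (commute_haarAvg (M.continuous_gaugeAtOn r _) fun g =>
        M.commute_gaugeAtOn r h.symm k g).symm

/-- The partially gauged Hilbert space `Ĥ_r ⊆ H_r`. -/
def partialSpace (r : Finset (V ⊕ E)) : Submodule ℂ (EuclideanSpace ℂ (Conf M.Loc r)) :=
  LinearMap.range (Matrix.toEuclideanLin (M.partialProj r))

/-- The irreps of `Gⁿ`, `n = |V_c|`: tuples of irreps of `G`, one for each vertex on the cut. -/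
abbrev CutIrrep (r : Finset (V ⊕ E)) := M.cut r → Irrep G

/-- The dimension `d_α = ∏ᵢ d_{αᵢ}` of the irrep `α` of `Gⁿ`. -/
def cutDim (r : Finset (V ⊕ E)) (α : M.CutIrrep r) : ℕ := ∏ v, (α v).dim

/-- The matrix of `g ∈ Gⁿ` in the irrep `α = α₁ ⊠ ⋯ ⊠ αₙ`. -/
def cutRep (r : Finset (V ⊕ E)) (α : M.CutIrrep r) (g : M.cut r → G) :
    Matrix (∀ v, Fin (α v).dim) (∀ v, Fin (α v).dim) ℂ :=
  tensorOp fun v => (α v).D (g v)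

/-- The action `A_r(g)` of `g ∈ Gⁿ` on `H_r`. -/
def cutGauge (r : Finset (V ⊕ E)) (g : M.cut r → G) : Matrix (Conf M.Loc r) (Conf M.Loc r) ℂ :=
  M.gaugeOn r fun v => if h : v ∈ M.cut r then g ⟨v, h⟩ else 1

/-- The `α`-isotypic subspace of `Ĥ_r` under the action of `Gⁿ`: the span of the images of all
intertwiners from the irrep `α` into `Ĥ_r`. -/
def sectorSpace (r : Finset (V ⊕ E)) (α : M.CutIrrep r) :
    Submodule ℂ (EuclideanSpace ℂ (Conf M.Loc r)) :=
  ⨆ T ∈ {T : EuclideanSpace ℂ (∀ v, Fin (α v).dim) →ₗ[ℂ] EuclideanSpace ℂ (Conf M.Loc r) |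
      LinearMap.range T ≤ M.partialSpace r ∧ ∀ g : M.cut r → G,
        T ∘ₗ Matrix.toEuclideanLin (M.cutRep r α g) =
          Matrix.toEuclideanLin (M.cutGauge r g) ∘ₗ T}, LinearMap.range T

/-- The projection `P̃^α = (P̂^α_r ⊗ 1) Π_GI` onto the superselection sector `α`, where `P̂^α_r` is
the orthogonal projection onto the `α`-isotypic subspace of `Ĥ_r`. -/
def sectorProj (r : Finset (V ⊕ E)) (α : M.CutIrrep r) : Matrix M.Config M.Config ℂ :=
  extendOp (projMatrix (M.sectorSpace r α)) * M.projGI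

/-- The extra area operator `⊕_α P̃^α log d_α`. -/
def extraArea (r : Finset (V ⊕ E)) : Matrix M.Config M.Config ℂ :=
  ∑ᶠ α : M.CutIrrep r, (Real.log (M.cutDim r α) : ℂ) • M.sectorProj r α

end GaugeModel

/-! ### Random tensor networks -/

/-- A tensor network with tensors at the nodes `N`, contracted links `L` (all of bond dimension
`bond`), bulk legs `S` (the leg `s` has basis labels `X s`) and dangling boundary legs `B`, together
with the components of the tensors.  No property of the tensors is assumed. -/
structure TensorNetwork {S : Type*} (X : S → Type*) (N L B : Type*) where
  bond : ℕ
  fst : L → N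
  snd : L → N
  bulkAt : S → N
  bdryAt : B → N
  bdryDim : B → ℕ
  tensor : ∀ n : N, ({l : L // fst l = n} → Fin bond) → ({l : L // snd l = n} → Fin bond) →
    (∀ s : {s : S // bulkAt s = n}, X s) → (∀ b : {b : B // bdryAt b = n}, Fin (bdryDim b)) → ℂ

namespace TensorNetwork

variable {S : Type*} {X : S → Type*} {N L B : Type*} [Fintype S] [DecidableEq S]
  [∀ s, Fintype (X s)] [∀ s, DecidableEq (X s)] [Fintype N] [DecidableEq N]
  [Fintype L] [DecidableEq L] [Fintype B] [DecidableEq B] (T : TensorNetwork X N L B)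

/-- Basis labels of the boundary Hilbert space. -/
abbrev Bdry := ∀ b, Fin (T.bdryDim b)

/-- The contracted network: the product of all tensors projected, on every link, onto the maximally
entangled state `bond^{-1/2} ∑_μ |μ⟩|μ⟩`. -/
def contraction : Matrix T.Bdry (∀ s, X s) ℂ := fun b x =>
  ∑ μ : L → Fin T.bond, (∏ _l : L, ((√(T.bond : ℝ) : ℝ) : ℂ)⁻¹) *
    ∏ n, T.tensor n (fun l => μ l) (fun l => μ l) (fun s => x s) (fun c => b c)

/-- The unnormalized boundary state for the bulk input `ρ`.  A pure input `|Φ⟩` is contracted as the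
bra `⟨Φ|`, so that `ρ` enters through its transpose. -/
def bdryOp (ρ : Matrix (∀ s, X s) (∀ s, X s) ℂ) : Matrix T.Bdry T.Bdry ℂ :=
  T.contraction * ρᵀ * T.contractionᴴ

/-- The entropy `S(R)` of the normalized boundary state on the boundary subregion `R`. -/
def bdryEntropy (ρ : Matrix (∀ s, X s) (∀ s, X s) ℂ) (R : Finset B) : ℝ :=
  vnEntropy (partialTrace R ((T.bdryOp ρ).trace⁻¹ • T.bdryOp ρ))

/-- A set `a` of nodes whose bounding surface is homologous to `R`. -/
def IsHomologous (R : Finset B) (a : Finset N) : Prop := ∀ b, T.bdryAt b ∈ a ↔ b ∈ R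

/-- The number of links cut by the surface bounding `a`. -/
def area (a : Finset N) : ℕ :=
  (Finset.univ.filter fun l => ¬(T.fst l ∈ a ↔ T.snd l ∈ a)).card

/-- `a` is bounded by `R` and a minimal surface `γ_R` homologous to `R`; then `|γ_R| = area a`. -/
def IsEntanglementWedge (R : Finset B) (a : Finset N) : Prop :=
  T.IsHomologous R a ∧ ∀ a', T.IsHomologous R a' → T.area a ≤ T.area a'

/-- The bulk legs of the nodes in `a`. -/
def bulkRegion (a : Finset N) : Finset S := Finset.univ.filter fun s => T.bulkAt s ∈ a

end TensorNetwork

end GaugedRTN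

end

open GaugedRTN

noncomputable section

namespace GaugedRTN

/-! ### Functional calculus of Hermitian matrices -/

section FunctionalCalculus

variable {n m : Type*} [Fintype n] [DecidableEq n] [Fintype m] [DecidableEq m]

/-! Write Π for `projGI`, K for the partial trace of Π over the complement of r, and z for the
support projection of K. The gauge-invariant algebra is only given as a set of compressions (O ⊗
1)Π. The main point is to identify it with a corner of an explicit algebra C, the `commutant` on H_r
of the gauge transformations.

A gauge transformation is a product of a factor on r and a factor on the complement, and the partial
trace is cyclic for operators on the complement. Hence the partial trace of any Y with ΠY = Y = YΠ
lies in C (`partialTrace_mem_commutant`). If O ⊗ 1 commutes with Π, this applies to (O ⊗ 1)Π and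
gives OK ∈ C, so Oz = (OK)K⁻¹ ∈ C, with the inverse taken on the support. By a positivity argument
(O ⊗ 1)Π and Oz determine each other, and K is central in C. So O ↦ (O ⊗ 1)Π is a star isomorphism
from Cz onto the gauge-invariant algebra. `SectorData` isolates what this argument needs.

The structure of C comes from Schur's lemma for Gⁿ. If T intertwines α with the partially gauged
space, then TᴴT = c and TTᴴ ∈ C, so a minimal projection of C in the sector α has the form TTᴴ/c and
rank d_α (`trace_eq_cutDim`). The sectors exhaust the partially gauged space
(`sum_isoProj_mul_partialProj`). This is the finite-dimensional part of the Peter–Weyl theorem,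
proved here by averaging against matrix coefficients.

Therefore the normalized trace is the matrix trace with density z ∑ P_α/d_α, and the reduced state
is represented by ∑ d_α P_α ρ_r. With η(t) = -t log t, the identity η(dt) = dη(t) + η(d)t turns the
factors d_α into the expectation of log d_α (`entropy_eq`). Uniqueness of the trace follows from
spectral decomposition and from splitting projections into minimal ones
(`IsNormalizedTrace.unique`); uniqueness of the state follows from faithfulness of the trace. The
area term is a multiple of the unit Π, so it adds a constant to both sides, and the network formula
follows by substitution. -/

lemma exists_polynomial_cfc {x : Matrix n n ℂ} {y : Matrix m m ℂ} (hx : x.IsHermitian)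
    (hy : y.IsHermitian) (f : ℝ → ℝ) :
    ∃ p : Polynomial ℝ, cfc f x = Polynomial.aeval x p ∧ cfc f y = Polynomial.aeval y p := by
  classical
  have hfx : (spectrum ℝ x).Finite := Matrix.finite_real_spectrum
  have hfy : (spectrum ℝ y).Finite := Matrix.finite_real_spectrum
  -- Interpolating on the union of both spectra gives a single polynomial for `x` and `y`, so that
  -- intertwining relations pass to `cfc`.
  let s : Finset ℝ := hfx.toFinset ∪ hfy.toFinset
  let p : Polynomial ℝ := Lagrange.interpolate s id f
  have hp : ∀ t ∈ s, p.eval t = f t := fun t ht =>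
    Lagrange.eval_interpolate_at_node (v := id) f (Set.injOn_id _) ht
  refine ⟨p, ?_, ?_⟩
  · rw [← cfc_polynomial p x hx.isSelfAdjoint]
    refine cfc_congr fun t ht => (hp t ?_).symm
    exact Finset.mem_union_left _ (hfx.mem_toFinset.mpr ht)
  · rw [← cfc_polynomial p y hy.isSelfAdjoint]
    refine cfc_congr fun t ht => (hp t ?_).symm
    exact Finset.mem_union_right _ (hfy.mem_toFinset.mpr ht)

lemma aeval_mul_of_intertwine {x : Matrix n n ℂ} {y : Matrix m m ℂ} {J : Matrix n m ℂ}
    (h : x * J = J * y) (p : Polynomial ℝ) :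
    Polynomial.aeval x p * J = J * Polynomial.aeval y p := by
  induction p using Polynomial.induction_on' with
  | add p q hp hq => simp only [map_add, Matrix.add_mul, Matrix.mul_add, hp, hq]
  | monomial k c =>
    have hk : x ^ k * J = J * y ^ k := by
      induction k with
      | zero => simp
      | succ k ih => rw [pow_succ, pow_succ', Matrix.mul_assoc, h, ← Matrix.mul_assoc, ih,
          Matrix.mul_assoc, ← pow_succ, ← pow_succ']
    simp only [Polynomial.aeval_monomial, Algebra.algebraMap_eq_smul_one, smul_mul_assoc, one_mul,
      Matrix.smul_mul, Matrix.mul_smul, hk]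

/-- Both functional calculi are evaluations of one polynomial. With `J` a projection, this compares
functions of two operators which agree only on the range of `J`. -/
lemma cfc_mul_of_intertwine {x : Matrix n n ℂ} {y : Matrix m m ℂ} (hx : x.IsHermitian)
    (hy : y.IsHermitian) {J : Matrix n m ℂ} (h : x * J = J * y) (f : ℝ → ℝ) :
    cfc f x * J = J * cfc f y := by
  obtain ⟨p, h1, h2⟩ := exists_polynomial_cfc hx hy f
  rw [h1, h2, aeval_mul_of_intertwine h]

lemma commute_cfc {x y : Matrix n n ℂ} (hx : x.IsHermitian) (h : Commute x y) (f : ℝ → ℝ) :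
    Commute (cfc f x) y :=
  cfc_mul_of_intertwine hx hx h f

lemma cfc_mem_starSubalgebra {C : StarSubalgebra ℂ (Matrix n n ℂ)} {x : Matrix n n ℂ}
    (hx : x.IsHermitian) (hxC : x ∈ C) (f : ℝ → ℝ) : cfc f x ∈ C := by
  obtain ⟨p, h1, -⟩ := exists_polynomial_cfc hx hx f
  rw [h1]
  clear h1
  induction p using Polynomial.induction_on' with
  | add p q hp hq => rw [map_add]; exact add_mem hp hq
  | monomial k c =>
    rw [Polynomial.aeval_monomial, Algebra.algebraMap_eq_smul_one, smul_mul_assoc, one_mul,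
      ← Complex.coe_smul]
    exact C.smul_mem (pow_mem hxC k) _

lemma continuousOn_spectrum (x : Matrix n n ℂ) (f : ℝ → ℝ) :
    ContinuousOn f (spectrum ℝ x) :=
  Matrix.finite_real_spectrum.continuousOn f

/-- The inverse of a Hermitian matrix on its support. -/
def suppInv (x : Matrix n n ℂ) : Matrix n n ℂ := cfc (fun t : ℝ => t⁻¹) x

/-- The projection onto the support of a Hermitian matrix. -/
def supp (x : Matrix n n ℂ) : Matrix n n ℂ := cfc (fun t : ℝ => t * t⁻¹) x

/-- Since `0⁻¹ = 0`, the function `t * t⁻¹` is the indicator of `t ≠ 0`. -/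
lemma mul_suppInv {x : Matrix n n ℂ} (hx : x.IsHermitian) : x * suppInv x = supp x := by
  rw [supp, cfc_mul (fun t : ℝ => t) (fun t => t⁻¹) x (continuousOn_spectrum x _)
    (continuousOn_spectrum x _), cfc_id' ℝ x hx.isSelfAdjoint, suppInv]

lemma mul_supp {x : Matrix n n ℂ} (hx : x.IsHermitian) : x * supp x = x := by
  conv_lhs => enter [1]; rw [← cfc_id' ℝ x hx.isSelfAdjoint]
  rw [supp, ← cfc_mul (fun t : ℝ => t) (fun t => t * t⁻¹) x (continuousOn_spectrum x _)
    (continuousOn_spectrum x _)]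
  conv_rhs => rw [← cfc_id' ℝ x hx.isSelfAdjoint]
  refine cfc_congr fun t _ => ?_
  by_cases ht : t = 0 <;> simp [ht]

lemma isStarProjection_supp (x : Matrix n n ℂ) :
    IsStarProjection (supp x) := by
  refine ⟨?_, cfc_predicate _ x⟩
  rw [IsIdempotentElem, supp, ← cfc_mul _ _ x (continuousOn_spectrum x _)
    (continuousOn_spectrum x _)]
  refine cfc_congr fun t _ => ?_
  by_cases ht : t = 0 <;> simp [ht]

lemma cfcn_eq_cfc_negMulLog (x : Matrix n n ℂ) :
    cfcₙ Real.negMulLog x = cfc Real.negMulLog x :=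
  cfcₙ_eq_cfc (hf := Real.continuous_negMulLog.continuousOn) (hf0 := by simp)

/-- The scalar identity η(dt) = dη(t) + η(d)t, applied on the spectrum. With d = d_α it is the
origin of the term log d_α in the area operator. -/
lemma negMulLog_smul {x : Matrix n n ℂ} (hx : x.IsHermitian) (d : ℝ) :
    cfc Real.negMulLog (d • x) = d • cfc Real.negMulLog x + Real.negMulLog d • x := by
  rw [← cfc_comp_smul d Real.negMulLog x (Real.continuous_negMulLog.continuousOn)
    hx.isSelfAdjoint]
  conv_rhs => enter [2, 2]; rw [← cfc_id' ℝ x hx.isSelfAdjoint]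
  rw [← cfc_smul d _ x (continuousOn_spectrum x _),
    ← cfc_smul (Real.negMulLog d) _ x (continuousOn_spectrum x _),
    ← cfc_add x _ _ (continuousOn_spectrum x _) (continuousOn_spectrum x _)]
  refine cfc_congr fun t _ => ?_
  simp only [smul_eq_mul, Real.negMulLog_mul]
  ring

end FunctionalCalculus

/-! ### Partial traces -/

section PartialTrace

variable {ι : Type*} {X : ι → Type*} [Fintype ι] [DecidableEq ι]

lemma restrict_glue {r : Finset ι} (a : Conf X r) (b : Conf X rᶜ) :
    restrict r (glue a b) = a := by
  ext s
  simp [restrict, glue]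

lemma restrict_compl_glue {r : Finset ι} (a : Conf X r) (b : Conf X rᶜ) :
    restrict rᶜ (glue a b) = b := by
  ext s
  have hs : (s : ι) ∉ r := Finset.mem_compl.mp s.2
  simp [restrict, glue, hs]

lemma glue_restrict (r : Finset ι) (x : ∀ s, X s) :
    glue (restrict r x) (restrict rᶜ x) = x := by
  ext s
  by_cases hs : s ∈ r <;> simp [restrict, glue, hs]

/-- Splitting a basis label into its parts on `r` and on the complement. -/
def splitEquiv (r : Finset ι) : (∀ s, X s) ≃ Conf X r × Conf X rᶜ where
  toFun x := (restrict r x, restrict rᶜ x)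
  invFun p := glue p.1 p.2
  left_inv x := glue_restrict r x
  right_inv p := by simp [restrict_glue, restrict_compl_glue]

variable [∀ s, Fintype (X s)] [∀ s, DecidableEq (X s)]

lemma sum_config (r : Finset ι) {N : Type*} [AddCommMonoid N] (f : (∀ s, X s) → N) :
    ∑ x, f x = ∑ a : Conf X r, ∑ b : Conf X rᶜ, f (glue a b) := by
  rw [← Fintype.sum_prod_type' (f := fun (a : Conf X r) (b : Conf X rᶜ) => f (glue a b)),
    ← (splitEquiv r).symm.sum_comp]
  rfl

/-- The operator `1 ⊗ B`, for an operator `B` on the factors outside `r`. -/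
def coextendOp {r : Finset ι} (B : Matrix (Conf X rᶜ) (Conf X rᶜ) ℂ) :
    Matrix (∀ s, X s) (∀ s, X s) ℂ :=
  fun x y => if restrict r x = restrict r y then B (restrict rᶜ x) (restrict rᶜ y) else 0

variable {r : Finset ι}

lemma extendOp_mul_apply (O : Matrix (Conf X r) (Conf X r) ℂ) (Y : Matrix (∀ s, X s) (∀ s, X s) ℂ)
    (a : Conf X r) (b : Conf X rᶜ) (y : ∀ s, X s) :
    (extendOp O * Y) (glue a b) y = ∑ a', O a a' * Y (glue a' b) y := by
  simp [Matrix.mul_apply, sum_config r, extendOp, restrict_glue, restrict_compl_glue]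

lemma mul_extendOp_apply (O : Matrix (Conf X r) (Conf X r) ℂ) (Y : Matrix (∀ s, X s) (∀ s, X s) ℂ)
    (a : Conf X r) (b : Conf X rᶜ) (y : ∀ s, X s) :
    (Y * extendOp O) y (glue a b) = ∑ a', Y y (glue a' b) * O a' a := by
  simp [Matrix.mul_apply, sum_config r, extendOp, restrict_glue, restrict_compl_glue]

lemma coextendOp_mul_apply (O : Matrix (Conf X rᶜ) (Conf X rᶜ) ℂ)
    (Y : Matrix (∀ s, X s) (∀ s, X s) ℂ) (a : Conf X r) (b : Conf X rᶜ) (y : ∀ s, X s) :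
    (coextendOp O * Y) (glue a b) y = ∑ b', O b b' * Y (glue a b') y := by
  simp only [Matrix.mul_apply, sum_config r, coextendOp, restrict_glue, restrict_compl_glue]
  rw [Finset.sum_comm]
  simp

lemma mul_coextendOp_apply (O : Matrix (Conf X rᶜ) (Conf X rᶜ) ℂ)
    (Y : Matrix (∀ s, X s) (∀ s, X s) ℂ) (a : Conf X r) (b : Conf X rᶜ) (y : ∀ s, X s) :
    (Y * coextendOp O) y (glue a b) = ∑ b', Y y (glue a b') * O b' b := by
  simp only [Matrix.mul_apply, sum_config r, coextendOp, restrict_glue, restrict_compl_glue]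
  rw [Finset.sum_comm]
  simp

lemma ext_glue {Y Z : Matrix (∀ s, X s) (∀ s, X s) ℂ}
    (h : ∀ (a : Conf X r) b y, Y (glue a b) y = Z (glue a b) y) : Y = Z := by
  ext x y
  rw [← glue_restrict r x]
  exact h _ _ _

lemma extendOp_one : extendOp (1 : Matrix (Conf X r) (Conf X r) ℂ) = 1 := by
  refine ext_glue (r := r) fun a b y => ?_
  rw [← mul_one (extendOp 1), extendOp_mul_apply]
  simp only [Matrix.one_apply (n := Conf X r), ite_mul, one_mul, zero_mul, Finset.sum_ite_eq,
    Finset.mem_univ, if_true]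

lemma coextendOp_one : coextendOp (1 : Matrix (Conf X rᶜ) (Conf X rᶜ) ℂ) = 1 := by
  refine ext_glue (r := r) fun a b y => ?_
  rw [← mul_one (coextendOp 1), coextendOp_mul_apply]
  simp only [Matrix.one_apply (n := Conf X rᶜ), ite_mul, one_mul, zero_mul, Finset.sum_ite_eq,
    Finset.mem_univ, if_true]

lemma coextendOp_mul (O O' : Matrix (Conf X rᶜ) (Conf X rᶜ) ℂ) :
    coextendOp (O * O') = coextendOp O * coextendOp O' := by
  refine ext_glue (r := r) fun a b y => ?_
  rw [← mul_one (coextendOp (O * O')), ← mul_one (coextendOp O'), coextendOp_mul_apply,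
    coextendOp_mul_apply]
  simp only [coextendOp_mul_apply, Matrix.mul_apply (M := O), Finset.sum_mul, Finset.mul_sum,
    mul_assoc]
  exact Finset.sum_comm

lemma tensorOp_eq_extendOp_mul_coextendOp (A : ∀ s, Matrix (X s) (X s) ℂ) :
    tensorOp A = extendOp (tensorOp fun s : r => A s) *
      coextendOp (tensorOp fun s : (rᶜ : Finset ι) => A s) := by
  refine ext_glue (r := r) fun a b y => ?_
  rw [extendOp_mul_apply]
  simp only [coextendOp, restrict_glue, restrict_compl_glue, mul_ite, mul_zero,
    Finset.sum_ite_eq', Finset.mem_univ, if_true]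
  simp only [tensorOp]
  rw [← Finset.prod_mul_prod_compl r, ← Finset.prod_coe_sort r, ← Finset.prod_coe_sort rᶜ]
  refine congrArg₂ _ (Finset.prod_congr rfl fun s _ => ?_) (Finset.prod_congr rfl fun s _ => ?_)
  · simp [glue, restrict]
  · have hs : (s : ι) ∉ r := Finset.mem_compl.mp s.2
    simp [glue, restrict, hs]

lemma commute_extendOp_coextendOp (O : Matrix (Conf X r) (Conf X r) ℂ)
    (B : Matrix (Conf X rᶜ) (Conf X rᶜ) ℂ) : Commute (extendOp O) (coextendOp B) := by
  refine ext_glue (r := r) fun a b y => ?_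
  rw [extendOp_mul_apply, coextendOp_mul_apply]
  simp [coextendOp, extendOp, restrict_glue, restrict_compl_glue, mul_comm]

/-- `O ↦ O ⊗ 1` as a homomorphism of star algebras. -/
def extendHom (X : ι → Type*) [∀ s, Fintype (X s)] [∀ s, DecidableEq (X s)] (r : Finset ι) :
    Matrix (Conf X r) (Conf X r) ℂ →⋆ₐ[ℂ] Matrix (∀ s, X s) (∀ s, X s) ℂ where
  toFun := extendOp
  map_one' := extendOp_one
  map_mul' := extendOp_mul
  map_zero' := extendOp_zero
  map_add' := extendOp_add
  commutes' c := by
    rw [Algebra.algebraMap_eq_smul_one, extendOp_smul, extendOp_one,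
      Algebra.algebraMap_eq_smul_one]
  map_star' O := (extendOp_conjTranspose O).symm

lemma extendHom_apply (O : Matrix (Conf X r) (Conf X r) ℂ) : extendHom X r O = extendOp O := rfl

lemma extendOp_aeval (x : Matrix (Conf X r) (Conf X r) ℂ) (p : Polynomial ℝ) :
    extendOp (Polynomial.aeval x p) = Polynomial.aeval (extendOp x) p :=
  (Polynomial.aeval_algHom_apply ((extendHom X r).toAlgHom.restrictScalars ℝ) x p).symm

lemma extendOp_isHermitian {x : Matrix (Conf X r) (Conf X r) ℂ} (hx : x.IsHermitian) :
    (extendOp x).IsHermitian := by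
  rw [Matrix.IsHermitian, extendOp_conjTranspose, hx.eq]

lemma extendOp_cfc {x : Matrix (Conf X r) (Conf X r) ℂ} (hx : x.IsHermitian) (f : ℝ → ℝ) :
    extendOp (cfc f x) = cfc f (extendOp x) := by
  obtain ⟨p, h1, h2⟩ := exists_polynomial_cfc hx (extendOp_isHermitian hx) f
  rw [h1, h2, extendOp_aeval]

open scoped MatrixOrder in
lemma extendOp_posSemidef {x : Matrix (Conf X r) (Conf X r) ℂ} (hx : x.PosSemidef) :
    (extendOp x).PosSemidef := by
  obtain ⟨B, rfl⟩ := CStarAlgebra.nonneg_iff_eq_star_mul_self.mp hx.nonneg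
  rw [extendOp_mul, Matrix.star_eq_conjTranspose, ← extendOp_conjTranspose]
  exact Matrix.posSemidef_conjTranspose_mul_self _

lemma partialTrace_extendOp_mul (O : Matrix (Conf X r) (Conf X r) ℂ)
    (Y : Matrix (∀ s, X s) (∀ s, X s) ℂ) :
    partialTrace r (extendOp O * Y) = O * partialTrace r Y := by
  ext a a'
  simp only [partialTrace, extendOp_mul_apply, Matrix.mul_apply (M := O), Finset.mul_sum]
  exact Finset.sum_comm

lemma partialTrace_mul_extendOp (O : Matrix (Conf X r) (Conf X r) ℂ)
    (Y : Matrix (∀ s, X s) (∀ s, X s) ℂ) :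
    partialTrace r (Y * extendOp O) = partialTrace r Y * O := by
  ext a a'
  simp only [partialTrace, mul_extendOp_apply, Matrix.mul_apply (N := O), Finset.sum_mul]
  exact Finset.sum_comm

/-- Cyclicity of the trace on the factors that are traced out. -/
lemma partialTrace_coextendOp_mul_comm (O : Matrix (Conf X rᶜ) (Conf X rᶜ) ℂ)
    (Y : Matrix (∀ s, X s) (∀ s, X s) ℂ) :
    partialTrace r (coextendOp O * Y) = partialTrace r (Y * coextendOp O) := by
  ext a a'
  simp only [partialTrace, coextendOp_mul_apply, mul_coextendOp_apply]
  rw [Finset.sum_comm]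
  simp only [mul_comm]

lemma trace_partialTrace (Y : Matrix (∀ s, X s) (∀ s, X s) ℂ) :
    (partialTrace r Y).trace = Y.trace := by
  simp only [Matrix.trace, Matrix.diag, sum_config r, partialTrace]

lemma trace_mul_extendOp (Y : Matrix (∀ s, X s) (∀ s, X s) ℂ)
    (O : Matrix (Conf X r) (Conf X r) ℂ) :
    (Y * extendOp O).trace = (partialTrace r Y * O).trace := by
  rw [← partialTrace_mul_extendOp, trace_partialTrace]

lemma partialTrace_conjTranspose (Y : Matrix (∀ s, X s) (∀ s, X s) ℂ) :
    (partialTrace r Y)ᴴ = partialTrace r Yᴴ := by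
  ext a a'
  simp [partialTrace, Matrix.conjTranspose_apply]

lemma partialTrace_posSemidef {Y : Matrix (∀ s, X s) (∀ s, X s) ℂ} (hY : Y.PosSemidef) :
    (partialTrace r Y).PosSemidef := by
  have : partialTrace r Y = ∑ b : Conf X rᶜ, Y.submatrix (fun a => glue a b)
      (fun a => glue a b) := by
    ext a a'
    simp [partialTrace, Matrix.sum_apply]
  rw [this]
  exact Matrix.posSemidef_sum _ fun b _ => hY.submatrix _

/-- The squared Hilbert–Schmidt norm of (O ⊗ 1)Y is Tr(O · Tr_{r̄} Y · Oᴴ), because Y is a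
projection, and this vanishes. -/
lemma extendOp_mul_eq_zero {O : Matrix (Conf X r) (Conf X r) ℂ}
    {Y : Matrix (∀ s, X s) (∀ s, X s) ℂ} (hY : IsStarProjection Y)
    (h : O * partialTrace r Y = 0) : extendOp O * Y = 0 := by
  have h1 : (extendOp O * Y * (extendOp O * Y)ᴴ).trace = 0 := by
    rw [Matrix.conjTranspose_mul, ← Matrix.star_eq_conjTranspose Y, hY.isSelfAdjoint.star_eq,
      Matrix.mul_assoc, ← Matrix.mul_assoc Y, hY.isIdempotentElem.eq, ← Matrix.mul_assoc,
      extendOp_conjTranspose, trace_mul_extendOp, partialTrace_extendOp_mul, h]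
    simp
  exact Matrix.trace_mul_conjTranspose_self_eq_zero_iff.mp h1

/-- Write A = A_r A_{r̄}. Then A_r Y = A_{r̄}⁻¹(AY) = A_{r̄}⁻¹(YA), and cyclicity over the
complement moves A_{r̄}⁻¹ to the right, where it leaves Y A_r. -/
lemma partialTrace_commute_of_commute_tensorOp {A A' : ∀ s, Matrix (X s) (X s) ℂ}
    (hA : ∀ s, A s * A' s = 1) {Y : Matrix (∀ s, X s) (∀ s, X s) ℂ}
    (h : Commute (tensorOp A) Y) :
    Commute (tensorOp fun s : r => A s) (partialTrace r Y) := by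
  have hB : (tensorOp fun s : (rᶜ : Finset ι) => A s) *
      (tensorOp fun s : (rᶜ : Finset ι) => A' s) = 1 := by
    rw [tensorOp_mul]
    ext x y
    simp only [tensorOp, hA, Matrix.one_apply, Finset.prod_ite_zero, Finset.prod_const_one,
      Finset.mem_univ, true_implies, funext_iff]
  have hB' := congrArg coextendOp (mul_eq_one_comm.mp hB)
  rw [coextendOp_mul, coextendOp_one] at hB'
  have hcomm : extendOp (tensorOp fun s : r => A s) *
      coextendOp (tensorOp fun s : (rᶜ : Finset ι) => A s) =
      coextendOp (tensorOp fun s : (rᶜ : Finset ι) => A s) *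
        extendOp (tensorOp fun s : r => A s) :=
    commute_extendOp_coextendOp _ _
  rw [Commute, SemiconjBy, ← partialTrace_extendOp_mul, ← partialTrace_mul_extendOp]
  have h1 : extendOp (tensorOp fun s : r => A s) * Y =
      coextendOp (tensorOp fun s : (rᶜ : Finset ι) => A' s) * (tensorOp A * Y) := by
    rw [tensorOp_eq_extendOp_mul_coextendOp (r := r), hcomm, ← Matrix.mul_assoc,
      ← Matrix.mul_assoc, hB', Matrix.one_mul]
  have h2 : Y * tensorOp A * coextendOp (tensorOp fun s : (rᶜ : Finset ι) => A' s) =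
      Y * extendOp (tensorOp fun s : r => A s) := by
    rw [tensorOp_eq_extendOp_mul_coextendOp (r := r), Matrix.mul_assoc, Matrix.mul_assoc,
      ← coextendOp_mul, hB, coextendOp_one, Matrix.mul_one]
  rw [h1, h.eq, partialTrace_coextendOp_mul_comm, h2]

end PartialTrace

end GaugedRTN

end

noncomputable section

namespace GaugedRTN

/-! ### Uniqueness of the normalized trace -/

section TraceUniqueness

variable {n : Type*} [Fintype n] [DecidableEq n] {A : NonUnitalStarSubalgebra ℂ (Matrix n n ℂ)}

/-- The condition at `0` is needed because `A` need not contain the identity matrix. Continuity is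
automatic on a finite spectrum. -/
lemma cfc_mem_of_apply_zero {x : Matrix n n ℂ} (hxA : x ∈ A) {f : ℝ → ℝ} (hf : f 0 = 0) :
    cfc f x ∈ A := by
  have hcl : IsClosed (A : Set (Matrix n n ℂ)) :=
    Submodule.closed_of_finiteDimensional A.toNonUnitalSubalgebra.toSubmodule
  have hq : (quasispectrum ℝ x).Finite := by
    rw [quasispectrum_eq_spectrum_union_zero]
    exact Matrix.finite_real_spectrum.union (Set.finite_singleton 0)
  rw [← cfcₙ_eq_cfc (hf := hq.continuousOn f) (hf0 := hf)]
  exact cfcₙ_mem (𝕜' := ℂ) (hs := hcl) f hxA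

lemma cfc_indicator_isStarProjection (x : Matrix n n ℂ) (t : ℝ) :
    IsStarProjection (cfc (fun u : ℝ => if u = t then (1 : ℝ) else 0) x) := by
  refine ⟨?_, cfc_predicate _ x⟩
  rw [IsIdempotentElem, ← cfc_mul _ _ x (continuousOn_spectrum x _) (continuousOn_spectrum x _)]
  refine cfc_congr fun u _ => ?_
  by_cases hu : u = t <;> simp [hu]

lemma eq_sum_smul_spectral {x : Matrix n n ℂ} (hx : x.IsHermitian) :
    x = ∑ t ∈ (Matrix.finite_real_spectrum (A := x)).toFinset,
      t • cfc (fun u : ℝ => if u = t then (1 : ℝ) else 0) x := by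
  simp_rw [← cfc_smul _ _ x (continuousOn_spectrum x _)]
  rw [← cfc_sum _ _ _ fun i _ => continuousOn_spectrum x _]
  conv_lhs => rw [← cfc_id' ℝ x hx.isSelfAdjoint]
  refine cfc_congr fun u hu => ?_
  have hu' : u ∈ (Matrix.finite_real_spectrum (A := x)).toFinset := by simpa using hu
  simp [Finset.sum_apply, hu]

/-- Every element is a combination of two self-adjoint ones, and these are combinations of spectral
projections lying in `A`. -/
lemma linearMap_ext_of_projections {τ τ' : A →ₗ[ℂ] ℂ}
    (h : ∀ p : A, IsStarProjection p → τ p = τ' p) : τ = τ' := by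
  have hsa : ∀ a : A, IsSelfAdjoint a → τ a = τ' a := by
    intro a ha
    have hx : (a : Matrix n n ℂ).IsHermitian := congrArg Subtype.val ha
    have hmem : ∀ t ∈ (Matrix.finite_real_spectrum (A := (a : Matrix n n ℂ))).toFinset,
        ∃ p : A, IsStarProjection p ∧ (t : ℂ) • (p : Matrix n n ℂ) =
          t • cfc (fun u : ℝ => if u = t then (1 : ℝ) else 0) (a : Matrix n n ℂ) := by
      intro t _
      -- The spectral projection at the eigenvalue 0 may lie outside `A`, but its coefficient
      -- vanishes.
      by_cases ht : t = 0
      · exact ⟨0, IsStarProjection.zero _, by simp [ht]⟩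
      · have hp := cfc_indicator_isStarProjection (a : Matrix n n ℂ) t
        refine ⟨⟨_, cfc_mem_of_apply_zero a.2 (f := fun u => if u = t then (1 : ℝ) else 0)
          (by simp [Ne.symm ht])⟩, ⟨Subtype.ext hp.1, Subtype.ext hp.2⟩, by simp⟩
    choose! p hp hpa using hmem
    have hsum : a = ∑ t ∈ (Matrix.finite_real_spectrum (A := (a : Matrix n n ℂ))).toFinset,
        (t : ℂ) • p t := by
      apply Subtype.ext
      rw [AddSubmonoidClass.coe_finsetSum]
      conv_lhs => rw [eq_sum_smul_spectral hx]
      exact Finset.sum_congr rfl fun t ht => (hpa t ht).symm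
    rw [hsum, map_sum, map_sum]
    exact Finset.sum_congr rfl fun t ht => by rw [map_smul, map_smul, h _ (hp t ht)]
  ext a
  have hdec := realPart_add_I_smul_imaginaryPart a
  rw [← hdec, map_add, map_add, map_smul, map_smul, hsa _ (realPart a).2,
    hsa _ (imaginaryPart a).2]

/-- A nonzero projection that is not minimal is a sum q + (p - q) of two projections of `A` of
smaller rank; induct on the rank. -/
lemma eq_on_projections_of_eq_on_minimal {τ τ' : A →ₗ[ℂ] ℂ}
    (h : ∀ p : A, IsMinimalProjection A p → τ p = τ' p) (p : A) (hp : IsStarProjection p) :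
    τ p = τ' p := by
  -- A proper subprojection has strictly smaller range.
  have hlt : ∀ p q : A, IsStarProjection p → IsStarProjection q → p * q = q → q ≠ p →
      (q : Matrix n n ℂ).rank < (p : Matrix n n ℂ).rank := by
    intro p q hp hq hpq hne
    have hqp : q * p = q := by
      have := congrArg star hpq
      rwa [star_mul, hp.2.star_eq, hq.2.star_eq] at this
    refine Submodule.finrank_lt_finrank_of_lt (lt_of_le_of_ne ?_ fun he => hne ?_)
    · rintro _ ⟨x, rfl⟩
      refine ⟨(q : Matrix n n ℂ).mulVec x, ?_⟩
      simp only [Matrix.mulVecLin_apply, Matrix.mulVec_mulVec]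
      rw [← NonUnitalStarSubalgebra.coe_mul, hpq]
    · apply Subtype.ext
      rw [← hqp]
      refine Matrix.ext_of_mulVec_single fun i => ?_
      obtain ⟨y, hy⟩ := he.ge ⟨Pi.single i 1, rfl⟩
      simp only [Matrix.mulVecLin_apply] at hy
      rw [NonUnitalStarSubalgebra.coe_mul, ← Matrix.mulVec_mulVec, ← hy, Matrix.mulVec_mulVec,
        ← NonUnitalStarSubalgebra.coe_mul, hq.1.eq]
  induction hk : (p : Matrix n n ℂ).rank using Nat.strong_induction_on generalizing p with
  | _ k ih =>
    by_cases h0 : p = 0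
    · simp [h0]
    by_cases hmin : IsMinimalProjection A p
    · exact h p hmin
    simp only [IsMinimalProjection, not_and, not_forall, not_or] at hmin
    obtain ⟨q, hq, hpq, hq0, hqp⟩ := hmin h0 hp
    have hqp' : q * p = q := by
      have := congrArg star hpq
      rwa [star_mul, hp.2.star_eq, hq.2.star_eq] at this
    have hpq' : IsStarProjection (p - q) := by
      refine ⟨?_, hp.2.sub hq.2⟩
      rw [IsIdempotentElem, sub_mul, mul_sub, mul_sub, hp.1.eq, hq.1.eq, hpq, hqp', sub_self,
        sub_zero]
    have h1 := ih _ (hk ▸ hlt p q hp hq hpq hqp) q hq rfl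
    have h2 := ih _ (hk ▸ hlt p (p - q) hp hpq' (by rw [mul_sub, hp.1.eq, hpq])
      (by simpa using hq0)) (p - q) hpq' rfl
    rw [← sub_add_cancel p q, map_add, map_add, h1, h2]

lemma IsNormalizedTrace.unique {τ τ' : A →ₗ[ℂ] ℂ} (h : IsNormalizedTrace A τ)
    (h' : IsNormalizedTrace A τ') : τ' = τ :=
  linearMap_ext_of_projections (eq_on_projections_of_eq_on_minimal fun p hp => by
    rw [h.2 p hp, h'.2 p hp])

end TraceUniqueness

end GaugedRTN

end

noncomputable section

namespace GaugedRTN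

/-! ### Reduction to an algebra with a decomposition into sectors -/

variable {ι : Type*} {X : ι → Type*} [Fintype ι] [DecidableEq ι] [∀ s, Fintype (X s)]
  [∀ s, DecidableEq (X s)]

/-- A projection `proj` on a tensor product, a unital star algebra `C` of operators on the factors
in `r` commuting with `proj`, and a decomposition by central projections `P α`, such that the
minimal projections of `C` under `P α` have rank `d α`. -/
structure SectorData (proj : Matrix (∀ s, X s) (∀ s, X s) ℂ) (r : Finset ι) (I : Type*) where
  isProj : IsStarProjection proj
  C : StarSubalgebra ℂ (Matrix (Conf X r) (Conf X r) ℂ)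
  commute_proj : ∀ O ∈ C, Commute (extendOp O) proj
  partialTrace_mem : ∀ Y, proj * Y = Y → Y * proj = Y → partialTrace r Y ∈ C
  sectors : Finset I
  P : I → Matrix (Conf X r) (Conf X r) ℂ
  P_mem : ∀ α, P α ∈ C
  P_isProj : ∀ α, IsStarProjection (P α)
  P_comm : ∀ α, ∀ O ∈ C, Commute (P α) O
  P_orth : ∀ α β, α ≠ β → P α * P β = 0
  P_sum : (∑ α ∈ sectors, P α) * partialTrace r proj = partialTrace r proj
  d : I → ℕ
  d_pos : ∀ α, 0 < d α
  trace_minimal : ∀ α, ∀ q ∈ C, IsStarProjection q → q ≠ 0 →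
    (∀ q' ∈ C, IsStarProjection q' → q * q' = q' → q' = 0 ∨ q' = q) → P α * q = q →
    q.trace = d α

namespace SectorData

variable {proj : Matrix (∀ s, X s) (∀ s, X s) ℂ} {r : Finset ι} {I : Type*}
  (S : SectorData proj r I)

include S in
lemma partialTrace_proj_isHermitian : (partialTrace r proj).IsHermitian := by
  rw [Matrix.IsHermitian, partialTrace_conjTranspose]
  exact congrArg _ S.isProj.2

/-- The projection onto the part of the tensor factors in `r` which occurs in the range of
`proj`. -/
def z (_ : SectorData proj r I) : Matrix (Conf X r) (Conf X r) ℂ := supp (partialTrace r proj)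

lemma partialTrace_proj_mem : partialTrace r proj ∈ S.C :=
  S.partialTrace_mem _ S.isProj.1 S.isProj.1

lemma z_mem : S.z ∈ S.C :=
  cfc_mem_starSubalgebra S.partialTrace_proj_isHermitian S.partialTrace_proj_mem _

lemma z_isProj : IsStarProjection S.z := isStarProjection_supp _

lemma commute_partialTrace_proj {O : Matrix (Conf X r) (Conf X r) ℂ}
    (hO : Commute (extendOp O) proj) : Commute (partialTrace r proj) O := by
  rw [Commute, SemiconjBy, ← partialTrace_mul_extendOp, ← hO.eq, partialTrace_extendOp_mul]

lemma commute_z {O : Matrix (Conf X r) (Conf X r) ℂ} (hO : O ∈ S.C) : Commute S.z O :=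
  commute_cfc S.partialTrace_proj_isHermitian (commute_partialTrace_proj (S.commute_proj O hO)) _

/-- The operator 1 - z annihilates the partial trace K of `proj`, hence by `extendOp_mul_eq_zero` it
annihilates `proj`. -/
lemma extendOp_z_mul_proj : extendOp S.z * proj = proj := by
  have h : extendOp (1 - S.z) * proj = 0 := by
    refine extendOp_mul_eq_zero S.isProj ?_
    rw [sub_mul, one_mul, (S.commute_z S.partialTrace_proj_mem).eq, z,
      mul_supp S.partialTrace_proj_isHermitian, sub_self]
  have h2 : extendOp (1 - S.z) = 1 - extendOp S.z := by
    rw [← extendHom_apply, map_sub, map_one, extendHom_apply]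
  rw [h2, sub_mul, one_mul, sub_eq_zero] at h
  exact h.symm

/-- Taking the partial trace gives OK = 0, and z = K K⁻¹ on the support. Together with
`extendOp_z_mul_proj` this makes O ↦ (O ⊗ 1)proj injective exactly modulo the part outside z. -/
lemma mul_z_eq_zero {O : Matrix (Conf X r) (Conf X r) ℂ} (h : extendOp O * proj = 0) :
    O * S.z = 0 := by
  have h1 : O * partialTrace r proj = 0 := by
    rw [← partialTrace_extendOp_mul, h]
    ext
    simp [partialTrace]
  rw [z, ← mul_suppInv S.partialTrace_proj_isHermitian, ← Matrix.mul_assoc, h1, Matrix.zero_mul]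

lemma sum_P_mul_z : (∑ α ∈ S.sectors, S.P α) * S.z = S.z := by
  rw [z, ← mul_suppInv S.partialTrace_proj_isHermitian, ← Matrix.mul_assoc, S.P_sum]

lemma eq_of_extendOp_eq {O O' : Matrix (Conf X r) (Conf X r) ℂ} (hO : O * S.z = O)
    (hO' : O' * S.z = O') (h : extendOp O * proj = extendOp O' * proj) : O = O' := by
  have := S.mul_z_eq_zero (O := O - O') (by
    rw [← extendHom_apply, map_sub, sub_mul, extendHom_apply, extendHom_apply, h, sub_self])
  rwa [sub_mul, hO, hO', sub_eq_zero] at this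

/-- The representative is Oz. It equals the partial trace of (O ⊗ 1)proj times K⁻¹, and both factors
lie in `C`. An operator that merely commutes with `proj` is thus replaced by one in `C`. -/
lemma exists_mem_of_commute {O : Matrix (Conf X r) (Conf X r) ℂ}
    (hO : Commute (extendOp O) proj) :
    ∃ O' ∈ S.C, O' * S.z = O' ∧ extendOp O' * proj = extendOp O * proj := by
  refine ⟨O * S.z, ?_, ?_, ?_⟩
  · rw [z, ← mul_suppInv S.partialTrace_proj_isHermitian, ← Matrix.mul_assoc]
    refine mul_mem ?_ (cfc_mem_starSubalgebra S.partialTrace_proj_isHermitian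
      S.partialTrace_proj_mem _)
    rw [← partialTrace_extendOp_mul]
    refine S.partialTrace_mem _ ?_ ?_
    · rw [hO.eq, ← Matrix.mul_assoc, S.isProj.1.eq]
    · rw [Matrix.mul_assoc, S.isProj.1.eq]
  · rw [Matrix.mul_assoc, S.z_isProj.1.eq]
  · rw [extendOp_mul, Matrix.mul_assoc, S.extendOp_z_mul_proj]

lemma P_mul_P (α β : I) [DecidableEq I] : S.P α * S.P β = if α = β then S.P β else 0 := by
  split_ifs with h
  · rw [h, (S.P_isProj β).1.eq]
  · exact S.P_orth α β h

/-- The central operator `∑ α, c α • P α`. -/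
def central (c : I → ℂ) : Matrix (Conf X r) (Conf X r) ℂ := ∑ α ∈ S.sectors, c α • S.P α

lemma central_mem (c : I → ℂ) : S.central c ∈ S.C :=
  sum_mem fun α _ => S.C.smul_mem (S.P_mem α) _

lemma commute_central (c : I → ℂ) {O : Matrix (Conf X r) (Conf X r) ℂ} (hO : O ∈ S.C) :
    Commute (S.central c) O :=
  Commute.sum_left _ _ _ fun α _ => (S.P_comm α O hO).smul_left _

lemma central_mul_central (c c' : I → ℂ) :
    S.central c * S.central c' = S.central fun α => c α * c' α := by
  classical
  simp only [central, Finset.sum_mul, Finset.mul_sum, smul_mul_smul_comm, P_mul_P, smul_ite,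
    smul_zero]
  refine Finset.sum_congr rfl fun α hα => ?_
  simp [hα]

lemma P_mul_central {α : I} (hα : α ∈ S.sectors) (c : I → ℂ) :
    S.P α * S.central c = c α • S.P α := by
  classical
  simp only [central, Finset.mul_sum, Matrix.mul_smul, P_mul_P, smul_ite, smul_zero]
  simp [hα]

/-- The density of the normalized trace with respect to the matrix trace. -/
def weight : Matrix (Conf X r) (Conf X r) ℂ := S.central (fun α => (S.d α : ℂ)⁻¹) * S.z

lemma commute_weight {O : Matrix (Conf X r) (Conf X r) ℂ} (hO : O ∈ S.C) :
    Commute S.weight O :=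
  (S.commute_central _ hO).mul_left (S.commute_z hO)

/-- The factors d_α in the reduced state cancel the factors 1/d_α in the trace, so expectation
values reduce to ordinary traces against ρ_r. -/
lemma central_d_mul_weight : S.central (fun α => (S.d α : ℂ)) * S.weight = S.z := by
  rw [weight, ← Matrix.mul_assoc, central_mul_central]
  have : ∀ α, (S.d α : ℂ) * (S.d α : ℂ)⁻¹ = 1 := fun α =>
    mul_inv_cancel₀ (Nat.cast_ne_zero.mpr (S.d_pos α).ne')
  simp only [this, central, one_smul, S.sum_P_mul_z]

variable {A : NonUnitalStarSubalgebra ℂ (Matrix (∀ s, X s) (∀ s, X s) ℂ)}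

/-- The map `O ↦ (O ⊗ 1) proj` onto the reduced algebra. -/
def compress (hA : ∀ a, a ∈ A ↔ ∃ O : Matrix (Conf X r) (Conf X r) ℂ,
    Commute (extendOp O) proj ∧ a = extendOp O * proj) : S.C →ₗ[ℂ] A where
  toFun O := ⟨extendOp O.1 * proj, (hA _).2 ⟨O.1, S.commute_proj _ O.2, rfl⟩⟩
  map_add' O O' := Subtype.ext (by simp [extendOp_add, add_mul])
  map_smul' c O := Subtype.ext (by simp [extendOp_smul])

variable (hA : ∀ a, a ∈ A ↔ ∃ O : Matrix (Conf X r) (Conf X r) ℂ,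
  Commute (extendOp O) proj ∧ a = extendOp O * proj)

lemma coe_compress (O : S.C) :
    (S.compress hA O : Matrix (∀ s, X s) (∀ s, X s) ℂ) = extendOp O.1 * proj := rfl

lemma compress_mul (O O' : S.C) :
    S.compress hA (O * O') = S.compress hA O * S.compress hA O' := by
  apply Subtype.ext
  change extendOp (O.1 * O'.1) * proj = extendOp O.1 * proj * (extendOp O'.1 * proj)
  rw [extendOp_mul, Matrix.mul_assoc, Matrix.mul_assoc, ← Matrix.mul_assoc proj,
    ← (S.commute_proj _ O'.2).eq, Matrix.mul_assoc (extendOp O'.1), S.isProj.1.eq]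

lemma compress_star (O : S.C) : S.compress hA (star O) = star (S.compress hA O) := by
  apply Subtype.ext
  change extendOp (O.1ᴴ) * proj = (extendOp O.1 * proj)ᴴ
  rw [Matrix.conjTranspose_mul, show projᴴ = proj from S.isProj.2, extendOp_conjTranspose]
  exact (S.commute_proj _ (star O).2).eq

lemma exists_compress_eq (a : A) : ∃ O : S.C, O.1 * S.z = O.1 ∧ S.compress hA O = a := by
  obtain ⟨O, hO, ha⟩ := (hA _).1 a.2
  obtain ⟨O', h1, h2, h3⟩ := S.exists_mem_of_commute hO
  exact ⟨⟨O', h1⟩, h2, Subtype.ext (by rw [ha, ← h3, coe_compress])⟩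

end SectorData

end GaugedRTN

end

/-! ### The normalized trace and the reduced state on the sector algebra -/

noncomputable section

namespace GaugedRTN

variable {ι : Type*} {X : ι → Type*} [Fintype ι] [DecidableEq ι] [∀ s, Fintype (X s)]
  [∀ s, DecidableEq (X s)]

namespace SectorData

variable {proj : Matrix (∀ s, X s) (∀ s, X s) ℂ} {r : Finset ι} {I : Type*}
  (S : SectorData proj r I) {A : NonUnitalStarSubalgebra ℂ (Matrix (∀ s, X s) (∀ s, X s) ℂ)}
  (hA : ∀ a, a ∈ A ↔ ∃ O : Matrix (Conf X r) (Conf X r) ℂ,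
    Commute (extendOp O) proj ∧ a = extendOp O * proj)

include hA in
-- The functional on `C` descends along `compress`: the kernel of `compress` is annihilated by z,
-- and `weight` contains the factor z. Any linear section of `compress` then defines it.
lemma exists_trace : ∃ τ : A →ₗ[ℂ] ℂ, ∀ O : S.C, τ (S.compress hA O) = (O.1 * S.weight).trace := by
  have hsurj : LinearMap.range (S.compress hA) = ⊤ :=
    LinearMap.range_eq_top.mpr fun a => (S.exists_compress_eq hA a).imp fun _ h => h.2
  obtain ⟨g, hg⟩ := (S.compress hA).exists_rightInverse_of_surjective hsurj
  let τ₀ : S.C →ₗ[ℂ] ℂ :=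
    { toFun := fun O => (O.1 * S.weight).trace
      map_add' := fun O O' => by
        change ((O.1 + O'.1) * S.weight).trace = _
        rw [add_mul, Matrix.trace_add]
      map_smul' := fun c O => by
        change ((c • O.1) * S.weight).trace = _
        rw [Matrix.smul_mul, Matrix.trace_smul]; rfl }
  refine ⟨τ₀ ∘ₗ g, fun O => ?_⟩
  have h1 : S.compress hA (g (S.compress hA O) - O) = 0 := by
    rw [map_sub, sub_eq_zero]
    exact LinearMap.congr_fun hg (S.compress hA O)
  have h2 : (g (S.compress hA O) - O : S.C).1 * S.z = 0 :=
    S.mul_z_eq_zero (congrArg Subtype.val h1)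
  have h3 : ((g (S.compress hA O)).1 - O.1) * S.weight = 0 := by
    rw [weight, (S.commute_central _ S.z_mem).eq, ← Matrix.mul_assoc]
    exact (congrArg (· * _) h2).trans (Matrix.zero_mul _)
  rw [sub_mul, sub_eq_zero] at h3
  exact congrArg Matrix.trace h3

lemma trace_tracial {τ : A →ₗ[ℂ] ℂ}
    (hτ : ∀ O : S.C, τ (S.compress hA O) = (O.1 * S.weight).trace) (a b : A) :
    τ (a * b) = τ (b * a) := by
  obtain ⟨O, -, rfl⟩ := S.exists_compress_eq hA a
  obtain ⟨O', -, rfl⟩ := S.exists_compress_eq hA b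
  rw [← compress_mul, ← compress_mul, hτ, hτ]
  change (O.1 * O'.1 * S.weight).trace = (O'.1 * O.1 * S.weight).trace
  rw [Matrix.mul_assoc, Matrix.trace_mul_comm, Matrix.mul_assoc, (S.commute_weight O.2).eq,
    Matrix.mul_assoc]

/-- On the corner Cz the star homomorphism `compress` is injective, so the defining relations of a
projection can be pulled back. -/
lemma isStarProjection_of_compress {O : S.C} (hOz : O.1 * S.z = O.1)
    (hp : IsStarProjection (S.compress hA O)) : IsStarProjection O.1 := by
  constructor
  · refine S.eq_of_extendOp_eq (by rw [Matrix.mul_assoc, hOz]) hOz ?_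
    have := congrArg Subtype.val hp.1.eq
    rwa [← compress_mul] at this
  · refine S.eq_of_extendOp_eq ?_ hOz ?_
    · have := congrArg star hOz
      rw [star_mul, S.z_isProj.2.star_eq] at this
      exact (S.commute_z (star O).2).eq.symm.trans this
    · have := congrArg Subtype.val hp.2.star_eq
      rwa [← compress_star] at this

lemma compress_isStarProjection {O : S.C} (hO : IsStarProjection O.1) :
    IsStarProjection (S.compress hA O) := by
  have h1 : O * O = O := Subtype.ext hO.1.eq
  have h2 : star O = O := Subtype.ext hO.2.star_eq
  exact ⟨by rw [IsIdempotentElem, ← compress_mul, h1], by rw [IsSelfAdjoint, ← compress_star, h2]⟩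

/-- The representative q of p in Cz is minimal in `C`. A minimal projection lies in a single sector,
where its rank d_α cancels the weight 1/d_α. -/
lemma trace_eq_one_of_isMinimalProjection {τ : A →ₗ[ℂ] ℂ}
    (hτ : ∀ O : S.C, τ (S.compress hA O) = (O.1 * S.weight).trace) {p : A}
    (hp : IsMinimalProjection A p) : τ p = 1 := by
  obtain ⟨q, hqz, rfl⟩ := S.exists_compress_eq hA p
  obtain ⟨hp0, hpp, hpmin⟩ := hp
  have hq := S.isStarProjection_of_compress hA hqz hpp
  have hzq : S.z * q.1 = q.1 := by rw [(S.commute_z q.2).eq, hqz]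
  have hq0 : q.1 ≠ 0 := fun h => hp0 (by
    rw [show q = 0 from Subtype.ext h, map_zero])
  -- Any subprojection of q in `C` lies under z because q does, so minimality in `A` can be
  -- transferred to `C`.
  have hsub : ∀ q' : S.C, IsStarProjection q'.1 → q.1 * q'.1 = q'.1 → q'.1 = 0 ∨ q'.1 = q.1 := by
    intro q' hq' hqq'
    have hq'z : q'.1 * S.z = q'.1 := by
      rw [← (S.commute_z q'.2).eq, ← hqq', ← Matrix.mul_assoc, hzq]
    refine (hpmin _ (S.compress_isStarProjection hA hq') ?_).imp (fun h => ?_) fun h => ?_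
    · rw [← compress_mul]
      exact congrArg _ (Subtype.ext hqq')
    · rw [← hq'z]
      exact S.mul_z_eq_zero (congrArg Subtype.val h)
    · exact S.eq_of_extendOp_eq hq'z hqz (congrArg Subtype.val h)
  obtain ⟨α, hα, hne⟩ : ∃ α ∈ S.sectors, S.P α * q.1 ≠ 0 := by
    by_contra! h
    refine hq0 ?_
    rw [← hzq, ← S.sum_P_mul_z, Matrix.mul_assoc, hzq, Finset.sum_mul, Finset.sum_eq_zero h]
  -- Since P_α is central, P_α q is a subprojection of q; it is nonzero, hence all of q.
  have hPq : S.P α * q.1 = q.1 := by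
    refine (hsub (⟨S.P α, S.P_mem α⟩ * q) ?_ ?_).resolve_left hne
    · exact ⟨(S.P_isProj α).1.mul_of_commute (S.P_comm α q.1 q.2) hq.1, by
        rw [IsSelfAdjoint]
        change star (S.P α * q.1) = S.P α * q.1
        rw [star_mul, (S.P_isProj α).2.star_eq, hq.2.star_eq, (S.P_comm α q.1 q.2).eq]⟩
    · change q.1 * (S.P α * q.1) = S.P α * q.1
      rw [← Matrix.mul_assoc, ← (S.P_comm α q.1 q.2).eq, Matrix.mul_assoc, hq.1.eq]
  have htr := S.trace_minimal α q.1 q.2 hq hq0 (fun q' h' => hsub ⟨q', h'⟩) hPq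
  have hqP : q.1 * S.P α = q.1 := by rw [← (S.P_comm α q.1 q.2).eq, hPq]
  rw [hτ, weight, ← Matrix.mul_assoc]
  nth_rw 1 [← hqP]
  rw [Matrix.mul_assoc q.1, S.P_mul_central hα, Matrix.mul_smul, hqP, Matrix.smul_mul, hqz,
    Matrix.trace_smul, htr, smul_eq_mul,
    inv_mul_cancel₀ (Nat.cast_ne_zero.mpr (S.d_pos α).ne')]

lemma isNormalizedTrace {τ : A →ₗ[ℂ] ℂ}
    (hτ : ∀ O : S.C, τ (S.compress hA O) = (O.1 * S.weight).trace) : IsNormalizedTrace A τ :=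
  ⟨S.trace_tracial hA hτ, fun _ hp => S.trace_eq_one_of_isMinimalProjection hA hτ hp⟩

/-- Faithfulness: the value is a sum over sectors of 1/d_α > 0 times the squared Hilbert–Schmidt
norm of P_α O, so each term vanishes, and the P_α sum to the identity on the range of z. -/
lemma eq_zero_of_trace_mul_star {τ : A →ₗ[ℂ] ℂ}
    (hτ : ∀ O : S.C, τ (S.compress hA O) = (O.1 * S.weight).trace) {a : A}
    (ha : τ (a * star a) = 0) : a = 0 := by
  obtain ⟨O, hOz, rfl⟩ := S.exists_compress_eq hA a
  rw [← compress_star, ← compress_mul, hτ] at ha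
  have hzO : S.z * O.1 = O.1 := by rw [(S.commute_z O.2).eq, hOz]
  have hterm : ∀ α, (S.P α * (O.1 * O.1ᴴ)).trace =
      ((S.P α * O.1) * (S.P α * O.1)ᴴ).trace := by
    intro α
    have : (S.P α * O.1) * (S.P α * O.1)ᴴ = S.P α * (O.1 * O.1ᴴ) * S.P α := by
      rw [Matrix.conjTranspose_mul, show (S.P α)ᴴ = S.P α from (S.P_isProj α).2]
      simp only [Matrix.mul_assoc]
    rw [this, Matrix.trace_mul_comm (S.P α * (O.1 * O.1ᴴ)),
      ← Matrix.mul_assoc (S.P α) (S.P α),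
      (S.P_isProj α).1.eq]
  have h1 : (O.1 * O.1ᴴ * S.weight).trace =
      ∑ α ∈ S.sectors, (S.d α : ℂ)⁻¹ * ((S.P α * O.1) * (S.P α * O.1)ᴴ).trace := by
    have : O.1 * O.1ᴴ * S.weight = S.central (fun α => (S.d α : ℂ)⁻¹) * (O.1 * O.1ᴴ) := by
      refine (S.commute_weight (O * star O).2).eq.symm.trans ?_
      change S.weight * (O.1 * O.1ᴴ) = _
      rw [weight, Matrix.mul_assoc, ← Matrix.mul_assoc S.z, hzO]
    rw [this, central, Finset.sum_mul, Matrix.trace_sum]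
    refine Finset.sum_congr rfl fun α _ => ?_
    rw [Matrix.smul_mul, Matrix.trace_smul, hterm, smul_eq_mul]
  have hnn : ∀ α ∈ S.sectors, 0 ≤ (S.d α : ℂ)⁻¹ * ((S.P α * O.1) * (S.P α * O.1)ᴴ).trace :=
    fun α _ => mul_nonneg (by positivity)
      (Matrix.posSemidef_self_mul_conjTranspose _).trace_nonneg
  have h2 := (Finset.sum_eq_zero_iff_of_nonneg hnn).mp (h1.symm.trans ha)
  have h3 : ∀ α ∈ S.sectors, S.P α * O.1 = 0 := fun α hα =>
    Matrix.trace_mul_conjTranspose_self_eq_zero_iff.mp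
      ((mul_eq_zero.mp (h2 α hα)).resolve_left
        (inv_ne_zero (Nat.cast_ne_zero.mpr (S.d_pos α).ne')))
  have h4 : O = 0 := Subtype.ext (by
    rw [← hzO, ← S.sum_P_mul_z, Matrix.mul_assoc, hzO, Finset.sum_mul, Finset.sum_eq_zero h3]
    rfl)
  rw [h4, map_zero]

lemma isReducedState_unique {τ : A →ₗ[ℂ] ℂ}
    (hτ : ∀ O : S.C, τ (S.compress hA O) = (O.1 * S.weight).trace)
    {ρ : Matrix (∀ s, X s) (∀ s, X s) ℂ} {σ σ' : A} (h : IsReducedState τ ρ σ)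
    (h' : IsReducedState τ ρ σ') : σ' = σ := by
  rw [← sub_eq_zero]
  refine S.eq_zero_of_trace_mul_star hA hτ ?_
  rw [sub_mul, map_sub, h, h', sub_self]

/-! ### The reduced state -/

variable {ρ : Matrix (∀ s, X s) (∀ s, X s) ℂ}

lemma reduced_mem (h1 : proj * ρ = ρ) (h2 : ρ * proj = ρ) : partialTrace r ρ ∈ S.C :=
  S.partialTrace_mem _ h1 h2

lemma z_mul_reduced (h1 : proj * ρ = ρ) : S.z * partialTrace r ρ = partialTrace r ρ := by
  rw [← partialTrace_extendOp_mul]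
  conv_lhs => rw [← h1, ← Matrix.mul_assoc, S.extendOp_z_mul_proj, h1]

/-- The operator on the factors in `r` which represents the reduced state. -/
def density (S : SectorData proj r I) (ρ : Matrix (∀ s, X s) (∀ s, X s) ℂ) :
    Matrix (Conf X r) (Conf X r) ℂ :=
  S.central (fun α => (S.d α : ℂ)) * partialTrace r ρ

lemma density_mem (h1 : proj * ρ = ρ) (h2 : ρ * proj = ρ) : S.density ρ ∈ S.C :=
  mul_mem (S.central_mem _) (S.reduced_mem h1 h2)

/-- Each P_α commutes with ρ_r, which lies in `C`, so the density is the sum of the positive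
operators d_α P_α ρ_r P_α. -/
lemma density_posSemidef (hρ : ρ.PosSemidef) (h1 : proj * ρ = ρ) (h2 : ρ * proj = ρ) :
    (S.density ρ).PosSemidef := by
  rw [density, central, Finset.sum_mul]
  refine Matrix.posSemidef_sum _ fun α _ => ?_
  have : S.P α * partialTrace r ρ = S.P α * partialTrace r ρ * (S.P α)ᴴ := by
    rw [show (S.P α)ᴴ = S.P α from (S.P_isProj α).2, Matrix.mul_assoc,
      ← (S.P_comm α _ (S.reduced_mem h1 h2)).eq, ← Matrix.mul_assoc, (S.P_isProj α).1.eq]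
  rw [Matrix.smul_mul, this]
  exact ((partialTrace_posSemidef hρ).mul_mul_conjTranspose_same _).smul (by positivity)

/-- The reduced state. -/
def state (h1 : proj * ρ = ρ) (h2 : ρ * proj = ρ) : A :=
  S.compress hA ⟨S.density ρ, S.density_mem h1 h2⟩

lemma state_posSemidef (hρ : ρ.PosSemidef) (h1 : proj * ρ = ρ) (h2 : ρ * proj = ρ) :
    (S.state hA h1 h2 : Matrix (∀ s, X s) (∀ s, X s) ℂ).PosSemidef := by
  have : (S.state hA h1 h2 : Matrix (∀ s, X s) (∀ s, X s) ℂ) =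
      proj * extendOp (S.density ρ) * projᴴ := by
    rw [show projᴴ = proj from S.isProj.2, ← (S.commute_proj _ (S.density_mem h1 h2)).eq,
      Matrix.mul_assoc, S.isProj.1.eq]
    rfl
  rw [this]
  exact (extendOp_posSemidef (S.density_posSemidef hρ h1 h2)).mul_mul_conjTranspose_same _

lemma trace_mul_compress (h1 : proj * ρ = ρ) (O : S.C) :
    (ρ * (S.compress hA O : Matrix (∀ s, X s) (∀ s, X s) ℂ)).trace =
      (partialTrace r ρ * O.1).trace := by
  rw [coe_compress, ← Matrix.mul_assoc, Matrix.trace_mul_comm, ← Matrix.mul_assoc, h1,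
    trace_mul_extendOp]

lemma isReducedState_state {τ : A →ₗ[ℂ] ℂ}
    (hτ : ∀ O : S.C, τ (S.compress hA O) = (O.1 * S.weight).trace)
    (h1 : proj * ρ = ρ) (h2 : ρ * proj = ρ) : IsReducedState τ ρ (S.state hA h1 h2) := by
  intro a
  obtain ⟨O, -, rfl⟩ := S.exists_compress_eq hA a
  rw [trace_mul_compress S hA h1, state, ← compress_mul, hτ]
  change (S.density ρ * O.1 * S.weight).trace = _
  have hD := S.commute_central (fun α => (S.d α : ℂ)) (mul_mem (S.reduced_mem h1 h2) O.2)
  rw [density, Matrix.mul_assoc (S.central _), hD.eq, Matrix.mul_assoc, S.central_d_mul_weight,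
    Matrix.trace_mul_comm, ← Matrix.mul_assoc, S.z_mul_reduced h1]

lemma trace_state {τ : A →ₗ[ℂ] ℂ}
    (hτ : ∀ O : S.C, τ (S.compress hA O) = (O.1 * S.weight).trace)
    (h1 : proj * ρ = ρ) (h2 : ρ * proj = ρ) (htr : ρ.trace = 1) :
    τ (S.state hA h1 h2) = 1 := by
  -- The normalization is the expectation value of the unit of the algebra.
  have := S.isReducedState_state hA hτ h1 h2 (S.compress hA 1)
  rw [trace_mul_compress S hA h1, state, ← compress_mul, mul_one] at this
  rw [state, this]
  change (partialTrace r ρ * 1).trace = 1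
  rw [mul_one, trace_partialTrace, htr]

end SectorData

end GaugedRTN

end

/-! ### The entropy relation in terms of sectors -/

noncomputable section

namespace GaugedRTN

lemma trace_mul_eq_re {n : Type*} [Fintype n] {x y : Matrix n n ℂ} (hx : x.IsHermitian)
    (hy : y.IsHermitian) : (((x * y).trace.re : ℝ) : ℂ) = (x * y).trace := by
  refine Complex.conj_eq_iff_re.mp ?_
  have := Matrix.trace_conjTranspose (x * y)
  rw [Matrix.conjTranspose_mul, hx.eq, hy.eq, Matrix.trace_mul_comm] at this
  exact this.symm

variable {ι : Type*} {X : ι → Type*} [Fintype ι] [DecidableEq ι] [∀ s, Fintype (X s)]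
  [∀ s, DecidableEq (X s)]

namespace SectorData

variable {proj : Matrix (∀ s, X s) (∀ s, X s) ℂ} {r : Finset ι} {I : Type*}
  (S : SectorData proj r I) {A : NonUnitalStarSubalgebra ℂ (Matrix (∀ s, X s) (∀ s, X s) ℂ)}
  (hA : ∀ a, a ∈ A ↔ ∃ O : Matrix (Conf X r) (Conf X r) ℂ,
    Commute (extendOp O) proj ∧ a = extendOp O * proj)
  {ρ : Matrix (∀ s, X s) (∀ s, X s) ℂ}

/-- The projection `proj` intertwines the state with density ⊗ 1, so η of one equals η of the other
on the range of `proj`. Off that range the left side vanishes because it lies in `A`. -/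
lemma coe_cfc_state (hρ : ρ.PosSemidef) (h1 : proj * ρ = ρ) (h2 : ρ * proj = ρ) :
    (⟨cfcₙ Real.negMulLog (S.state hA h1 h2 : Matrix (∀ s, X s) (∀ s, X s) ℂ), cfcn_mem _⟩ : A) =
      S.compress hA ⟨cfc Real.negMulLog (S.density ρ),
        cfc_mem_starSubalgebra (S.density_posSemidef hρ h1 h2).1 (S.density_mem h1 h2) _⟩ := by
  apply Subtype.ext
  have hcomm := (S.commute_proj _ (S.density_mem h1 h2)).eq
  have hs := (S.density_posSemidef hρ h1 h2).1
  have hint : (S.state hA h1 h2 : Matrix (∀ s, X s) (∀ s, X s) ℂ) * proj =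
      proj * extendOp (S.density ρ) := by
    change extendOp (S.density ρ) * proj * proj = _
    rw [Matrix.mul_assoc, S.isProj.1.eq, hcomm]
  have h3 := cfc_mul_of_intertwine (S.state_posSemidef hA hρ h1 h2).1 (extendOp_isHermitian hs) hint
    Real.negMulLog
  obtain ⟨O, hO, ha⟩ := (hA _).1 (cfcn_mem (S.state hA h1 h2))
  change cfcₙ Real.negMulLog _ = extendOp (cfc Real.negMulLog (S.density ρ)) * proj
  have h4 : cfcₙ Real.negMulLog (S.state hA h1 h2 : Matrix (∀ s, X s) (∀ s, X s) ℂ) * proj =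
      cfcₙ Real.negMulLog (S.state hA h1 h2 : Matrix (∀ s, X s) (∀ s, X s) ℂ) := by
    rw [ha, Matrix.mul_assoc, S.isProj.1.eq]
  rw [← h4, cfcn_eq_cfc_negMulLog, h3, ← extendOp_cfc hs]
  exact (S.commute_proj _ (cfc_mem_starSubalgebra hs (S.density_mem h1 h2) _)).eq.symm

/-- On the range of P_α the density acts as d_α ρ_r. Intertwining by P_α carries this to η, and
`negMulLog_smul` expands the result. -/
lemma cfc_density_mul_P (hρ : ρ.PosSemidef) (h1 : proj * ρ = ρ) (h2 : ρ * proj = ρ) {α : I}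
    (hα : α ∈ S.sectors) :
    cfc Real.negMulLog (S.density ρ) * S.P α =
      ((S.d α : ℝ) • cfc Real.negMulLog (partialTrace r ρ) +
        Real.negMulLog (S.d α) • partialTrace r ρ) * S.P α := by
  have hR : (partialTrace r ρ).IsHermitian := (partialTrace_posSemidef hρ).1
  have hs := (S.density_posSemidef hρ h1 h2).1
  rw [← negMulLog_smul hR]
  have hdR : ((S.d α : ℝ) • partialTrace r ρ).IsHermitian := by
    rw [Matrix.IsHermitian, Matrix.conjTranspose_smul, hR.eq, star_trivial]
  have hPs : S.P α * S.density ρ = ((S.d α : ℝ) • partialTrace r ρ) * S.P α := by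
    rw [density, ← Matrix.mul_assoc, S.P_mul_central hα, Matrix.smul_mul, Matrix.smul_mul,
      (S.P_comm α _ (S.reduced_mem h1 h2)).eq]
    ext
    simp
  rw [cfc_mul_of_intertwine hdR hs hPs.symm Real.negMulLog]
  exact (S.P_comm α _ (cfc_mem_starSubalgebra hs (S.density_mem h1 h2) _)).eq.symm

lemma trace_cfc_density (hρ : ρ.PosSemidef) (h1 : proj * ρ = ρ) (h2 : ρ * proj = ρ) :
    (cfc Real.negMulLog (S.density ρ) * S.weight).trace =
      (cfc Real.negMulLog (partialTrace r ρ)).trace -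
        (partialTrace r ρ * S.central fun α => (Real.log (S.d α) : ℂ)).trace := by
  have hR : (partialTrace r ρ).IsHermitian := (partialTrace_posSemidef hρ).1
  have hRmem := S.reduced_mem h1 h2
  have hRz : partialTrace r ρ * S.z = partialTrace r ρ := by
    rw [← (S.commute_z hRmem).eq, S.z_mul_reduced h1]
  -- Since η(0) = 0, η(ρ_r) vanishes where ρ_r does, in particular on the range of 1 - z.
  have hη : cfc Real.negMulLog (partialTrace r ρ) * S.z =
      cfc Real.negMulLog (partialTrace r ρ) := by
    have h0 : partialTrace r ρ * (1 - S.z) = (1 - S.z) * (0 : Matrix (Conf X r) (Conf X r) ℂ) := by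
      rw [mul_sub, mul_one, hRz, sub_self, Matrix.mul_zero]
    have := cfc_mul_of_intertwine hR Matrix.isHermitian_zero h0 Real.negMulLog
    rw [cfc_apply_zero, Real.negMulLog_zero, map_zero, Matrix.mul_zero, mul_sub, mul_one,
      sub_eq_zero] at this
    exact this.symm
  -- In the sector α, dividing d_α η(ρ_r) - d_α log d_α ρ_r by d_α leaves η(ρ_r) - log d_α ρ_r.
  have hsum : cfc Real.negMulLog (S.density ρ) * S.central (fun α => (S.d α : ℂ)⁻¹) =
      cfc Real.negMulLog (partialTrace r ρ) * (∑ α ∈ S.sectors, S.P α) -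
        partialTrace r ρ * S.central fun α => (Real.log (S.d α) : ℂ) := by
    simp only [central, Finset.mul_sum, ← Finset.sum_sub_distrib]
    refine Finset.sum_congr rfl fun α hα => ?_
    have hd : (S.d α : ℂ) ≠ 0 := Nat.cast_ne_zero.mpr (S.d_pos α).ne'
    rw [Matrix.mul_smul, S.cfc_density_mul_P hρ h1 h2 hα, add_mul, Matrix.smul_mul,
      Matrix.smul_mul, ← Complex.coe_smul, ← Complex.coe_smul, smul_add, smul_smul, smul_smul,
      Matrix.mul_smul, Complex.ofReal_natCast, inv_mul_cancel₀ hd, one_smul, sub_eq_add_neg,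
      ← neg_smul]
    congr 2
    rw [Real.negMulLog]
    push_cast
    field_simp
  rw [weight, ← Matrix.mul_assoc, hsum, sub_mul, Matrix.mul_assoc, S.sum_P_mul_z, hη,
    Matrix.mul_assoc, (S.commute_central _ S.z_mem).eq, ← Matrix.mul_assoc, hRz, Matrix.trace_sub]

/-- Both entropies are defined as real parts, so the complex identity also needs the traces to be
real; `trace_mul_eq_re` provides this. -/
lemma entropy_eq {τ : A →ₗ[ℂ] ℂ}
    (hτ : ∀ O : S.C, τ (S.compress hA O) = (O.1 * S.weight).trace)
    (hρ : ρ.PosSemidef) (h1 : proj * ρ = ρ) (h2 : ρ * proj = ρ) :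
    (vnEntropy (partialTrace r ρ) : ℂ) = (algEntropy τ (S.state hA h1 h2) : ℂ) +
      τ (S.state hA h1 h2 * S.compress hA
        ⟨S.central fun α => (Real.log (S.d α) : ℂ), S.central_mem _⟩) := by
  have hR : (partialTrace r ρ).IsHermitian := (partialTrace_posSemidef hρ).1
  have hL : (S.central fun α => (Real.log (S.d α) : ℂ)).IsHermitian := by
    rw [Matrix.IsHermitian, central, Matrix.conjTranspose_sum]
    refine Finset.sum_congr rfl fun α _ => ?_
    rw [Matrix.conjTranspose_smul, show (S.P α)ᴴ = S.P α from (S.P_isProj α).2]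
    congr 1
    exact Complex.conj_ofReal _
  have hη : (cfc Real.negMulLog (partialTrace r ρ)).IsHermitian :=
    (cfc_predicate (p := IsSelfAdjoint) Real.negMulLog (partialTrace r ρ) : _)
  have e1 := trace_mul_eq_re hR hL
  have e2 := trace_mul_eq_re hη Matrix.isHermitian_one
  rw [mul_one] at e2
  rw [S.isReducedState_state hA hτ h1 h2, trace_mul_compress S hA h1, algEntropy,
    S.coe_cfc_state hA hρ h1 h2, hτ, S.trace_cfc_density hρ h1 h2, vnEntropy, Complex.sub_re,
    Complex.ofReal_sub, e1, e2, sub_add_cancel]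

lemma compress_mem_center {O : S.C} (hO : ∀ O' ∈ S.C, Commute O.1 O') :
    S.compress hA O ∈ Set.center A := by
  rw [Semigroup.mem_center_iff]
  intro b
  obtain ⟨O', -, rfl⟩ := S.exists_compress_eq hA b
  rw [← compress_mul, ← compress_mul]
  exact congrArg _ (Subtype.ext (hO O'.1 O'.2).eq.symm)

end SectorData

end GaugedRTN

end

noncomputable section

namespace GaugedRTN

/-! ### Schur's lemma -/

section Schur

variable {G : Type*} [Group G] [TopologicalSpace G]

lemma Irrep.out_isIrreducible (α : Irrep G) : α.out.rep.IsIrreducible :=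
  (Quotient.out (s := irrepSetoid G) α).2

/-- A zero-dimensional representation has only one subrepresentation, while irreducibility requires
two distinct ones. -/
lemma Irrep.dim_pos (α : Irrep G) : 0 < α.dim := by
  by_contra h
  have h0 : α.dim = 0 := by omega
  have := α.out_isIrreducible
  obtain ⟨W, W', hne⟩ := (inferInstance : Nontrivial (Subrepresentation α.out.rep))
  have hsub : Subsingleton (Fin α.out.dim → ℂ) := by
    have : IsEmpty (Fin α.out.dim) := by
      rw [show α.out.dim = 0 from h0]; infer_instance
    infer_instance
  exact hne (Subrepresentation.toSubmodule_injective (Subsingleton.elim _ _))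

/-- A matrix which intertwines two matrix representations, as an intertwining map. -/
def UnitaryRep.intertwiningMap {π σ : UnitaryRep G} (S : Matrix (Fin σ.dim) (Fin π.dim) ℂ)
    (h : ∀ g, σ.mat g * S = S * π.mat g) : Representation.IntertwiningMap π.rep σ.rep where
  toLinearMap := Matrix.toLin' S
  isIntertwining' g := by
    change Matrix.toLin' S ∘ₗ Matrix.toLin' (π.mat g) = Matrix.toLin' (σ.mat g) ∘ₗ Matrix.toLin' S
    rw [← Matrix.toLin'_mul, ← Matrix.toLin'_mul, h]

lemma Irrep.eq_zero_of_intertwines {α β : Irrep G} (hαβ : α ≠ β)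
    (S : Matrix (Fin β.dim) (Fin α.dim) ℂ) (h : ∀ g, β.D g * S = S * α.D g) : S = 0 := by
  have := α.out_isIrreducible
  have := β.out_isIrreducible
  have : IsEmpty (Representation.Equiv α.out.rep β.out.rep) := by
    refine ⟨fun e => hαβ ?_⟩
    rw [← Quotient.out_eq (s := irrepSetoid G) α, ← Quotient.out_eq (s := irrepSetoid G) β]
    exact Quotient.sound ⟨e⟩
  have h0 := Subsingleton.elim (UnitaryRep.intertwiningMap (π := α.out) (σ := β.out) S h) 0
  have h1 : Matrix.toLin' S = 0 :=
    congrArg Representation.IntertwiningMap.toLinearMap h0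
  exact (LinearEquiv.map_eq_zero_iff _).mp h1

lemma Irrep.eq_smul_one_of_commutes {α : Irrep G}
    (S : Matrix (Fin α.dim) (Fin α.dim) ℂ) (h : ∀ g, α.D g * S = S * α.D g) :
    ∃ c : ℂ, S = c • 1 := by
  have := α.out_isIrreducible
  obtain ⟨c, hc⟩ :=
    (Representation.IsIrreducible.algebraMap_intertwiningMap_bijective_of_isAlgClosed
      (ρ := α.out.rep)).2 (UnitaryRep.intertwiningMap (π := α.out) (σ := α.out) S h)
  refine ⟨c, Matrix.toLin'.injective ?_⟩
  have h1 : (algebraMap ℂ (Representation.IntertwiningMap α.out.rep α.out.rep) c).toLinearMap =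
    Matrix.toLin' S := congrArg Representation.IntertwiningMap.toLinearMap hc
  rw [← h1, map_smul, Matrix.toLin'_one]
  rfl

/-- The outer tensor product of irreps. -/
def outerRep {κ : Type*} [Fintype κ] (α : κ → Irrep G) (g : κ → G) :
    Matrix (∀ v, Fin (α v).dim) (∀ v, Fin (α v).dim) ℂ :=
  tensorOp fun v => (α v).D (g v)

variable {κ : Type*} [Fintype κ] [DecidableEq κ]

lemma sum_eq_sum_update {Y : κ → Type*} [∀ v, Fintype (Y v)] [∀ v, DecidableEq (Y v)] (x : ∀ v, Y v)
    (v : κ) (f : (∀ v, Y v) → ℂ) (hf : ∀ y, f y ≠ 0 → ∀ w, w ≠ v → y w = x w) :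
    ∑ y, f y = ∑ k, f (Function.update x v k) := by
  symm
  refine Finset.sum_of_injOn (fun k => Function.update x v k)
    ((Function.update_injective x v).injOn) (by simp) ?_ (by simp)
  intro y _ hy
  by_contra hne
  refine hy ⟨y v, by simp, ?_⟩
  ext w
  by_cases hw : w = v
  · subst hw; simp
  · simp [hw, hf y hne w hw]

lemma outerRep_mulSingle_apply (α : κ → Irrep G) (v : κ) (h : G) (x y : ∀ v, Fin (α v).dim) :
    outerRep α (Pi.mulSingle v h) x y =
      if ∀ w, w ≠ v → x w = y w then (α v).D h (x v) (y v) else 0 := by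
  rw [outerRep, tensorOp, ← Finset.mul_prod_erase _ _ (Finset.mem_univ v), Pi.mulSingle_eq_same]
  have : ∏ w ∈ Finset.univ.erase v, (α w).D ((Pi.mulSingle v h : κ → G) w) (x w) (y w) =
      if ∀ w, w ≠ v → x w = y w then 1 else 0 := by
    rw [Finset.prod_congr rfl (g := fun w => if x w = y w then (1 : ℂ) else 0)]
    · rw [Finset.prod_ite_zero]
      simp
    · intro w hw
      rw [Pi.mulSingle_eq_of_ne (Finset.ne_of_mem_erase hw), Irrep.D_one, Matrix.one_apply]
  rw [this]
  simp

lemma outerRep_mulSingle_mul_apply (α : κ → Irrep G) (v : κ) (h : G) {m : Type*}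
    (S : Matrix (∀ v, Fin (α v).dim) m ℂ) (x : ∀ v, Fin (α v).dim) (y : m) :
    (outerRep α (Pi.mulSingle v h) * S) x y =
      ∑ k, (α v).D h (x v) k * S (Function.update x v k) y := by
  rw [Matrix.mul_apply, sum_eq_sum_update x v]
  · refine Finset.sum_congr rfl fun k _ => ?_
    rw [outerRep_mulSingle_apply, if_pos fun w hw => by simp [hw], Function.update_self]
  · intro y hy w hw
    rw [outerRep_mulSingle_apply] at hy
    by_contra hne
    exact hy (by rw [if_neg fun h => hne (h w hw).symm, zero_mul])

lemma mul_outerRep_mulSingle_apply (α : κ → Irrep G) (v : κ) (h : G) {m : Type*}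
    (S : Matrix m (∀ v, Fin (α v).dim) ℂ) (x : ∀ v, Fin (α v).dim) (y : m) :
    (S * outerRep α (Pi.mulSingle v h)) y x =
      ∑ k, S y (Function.update x v k) * (α v).D h k (x v) := by
  rw [Matrix.mul_apply, sum_eq_sum_update x v]
  · refine Finset.sum_congr rfl fun k _ => ?_
    rw [outerRep_mulSingle_apply, if_pos fun w hw => by simp [hw], Function.update_self]
  · intro y hy w hw
    rw [outerRep_mulSingle_apply] at hy
    by_contra hne
    exact hy (by rw [if_neg fun h => hne (h w hw), mul_zero])

/-- Freezing all tensor indices except the one at v and acting only with the v-th copy of G reduces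
Schur's lemma for the outer product to Schur's lemma for one factor. -/
lemma slice_intertwines {α β : κ → Irrep G}
    {S : Matrix (∀ v, Fin (β v).dim) (∀ v, Fin (α v).dim) ℂ}
    (h : ∀ g, outerRep β g * S = S * outerRep α g) (v : κ) (x : ∀ v, Fin (β v).dim)
    (y : ∀ v, Fin (α v).dim) (g : G) :
    (β v).D g * (Matrix.of fun k l => S (Function.update x v k) (Function.update y v l)) =
      (Matrix.of fun k l => S (Function.update x v k) (Function.update y v l)) * (α v).D g := by
  ext k l
  have := congrFun (congrFun (h (Pi.mulSingle v g)) (Function.update x v k))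
    (Function.update y v l)
  rw [outerRep_mulSingle_mul_apply, mul_outerRep_mulSingle_apply] at this
  simpa [Matrix.mul_apply] using this

lemma outerRep_eq_zero_of_intertwines {α β : κ → Irrep G} (hαβ : α ≠ β)
    {S : Matrix (∀ v, Fin (β v).dim) (∀ v, Fin (α v).dim) ℂ}
    (h : ∀ g, outerRep β g * S = S * outerRep α g) : S = 0 := by
  obtain ⟨v, hv⟩ := Function.ne_iff.mp hαβ
  ext x y
  have := Irrep.eq_zero_of_intertwines hv _ (slice_intertwines h v x y)
  simpa using congrFun (congrFun this (x v)) (y v)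

lemma outerRep_eq_smul_one_of_commutes {α : κ → Irrep G}
    {S : Matrix (∀ v, Fin (α v).dim) (∀ v, Fin (α v).dim) ℂ}
    (h : ∀ g, outerRep α g * S = S * outerRep α g) : ∃ c : ℂ, S = c • 1 := by
  have hoff : ∀ x y, x ≠ y → S x y = 0 := by
    intro x y hxy
    obtain ⟨v, hv⟩ := Function.ne_iff.mp hxy
    obtain ⟨c, hc⟩ := Irrep.eq_smul_one_of_commutes _ (slice_intertwines h v x y)
    simpa [Matrix.one_apply, hv] using congrFun (congrFun hc (x v)) (y v)
  have hupd : ∀ x v k, S (Function.update x v k) (Function.update x v k) = S x x := by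
    intro x v k
    obtain ⟨c, hc⟩ := Irrep.eq_smul_one_of_commutes _ (slice_intertwines h v x x)
    have h1 := congrFun (congrFun hc (x v)) (x v)
    have h2 := congrFun (congrFun hc k) k
    simp only [Matrix.of_apply, Function.update_eq_self, Matrix.smul_apply,
      Matrix.one_apply_eq] at h1 h2
    rw [h1, h2]
  let x₀ : ∀ v, Fin (α v).dim := fun v => ⟨0, (α v).dim_pos⟩
  have hdiag : ∀ x, S x x = S x₀ x₀ := by
    intro x
    -- Change x₀ into x one coordinate at a time; each change preserves the diagonal entry.
    have : ∀ s : Finset κ, S (s.piecewise x x₀) (s.piecewise x x₀) = S x₀ x₀ := by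
      intro s
      induction s using Finset.induction_on with
      | empty => simp
      | insert v s _ ih => rw [Finset.piecewise_insert, hupd, ih]
    simpa using this Finset.univ
  refine ⟨S x₀ x₀, ?_⟩
  ext x y
  by_cases hxy : x = y
  · subst hxy; simp [hdiag]
  · simp [hoff x y hxy, hxy]

lemma outerRep_mul (α : κ → Irrep G) (g h : κ → G) :
    outerRep α (g * h) = outerRep α g * outerRep α h := by
  simp only [outerRep, tensorOp_mul, Pi.mul_apply, Irrep.D_mul]

lemma outerRep_conjTranspose (α : κ → Irrep G) (g : κ → G) :
    (outerRep α g)ᴴ = outerRep α g⁻¹ := by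
  simp only [outerRep, tensorOp_conjTranspose, Pi.inv_apply, Irrep.D_inv]

end Schur

end GaugedRTN

end

noncomputable section

namespace GaugedRTN

/-! ### Completeness of the matrix coefficients -/

section Averages

variable {G : Type*} [Group G] [TopologicalSpace G] [IsTopologicalGroup G] [CompactSpace G]
  [MeasurableSpace G] [BorelSpace G] {n m : Type*} [Fintype n] [Fintype m]

lemma integrable_haarProb {f : G → ℂ} (hf : Continuous f) : Integrable f (haarProb G) :=
  hf.integrable_of_hasCompactSupport (HasCompactSupport.of_compactSpace _)

lemma mul_haarAvg_of_intertwines {B : G → Matrix m m ℂ} {B' : G → Matrix n n ℂ}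
    (hB : ∀ x y, Continuous fun g => B g x y) (hB' : ∀ x y, Continuous fun g => B' g x y)
    {C : Matrix n m ℂ} (h : ∀ g, C * B g = B' g * C) : C * haarAvg B = haarAvg B' * C := by
  ext x y
  simp only [Matrix.mul_apply, haarAvg, Matrix.of_apply, ← integral_const_mul,
    ← integral_mul_const]
  rw [← integral_finsetSum _ fun k _ => (integrable_haarProb (hB k y)).const_mul _,
    ← integral_finsetSum _ fun k _ => (integrable_haarProb (hB' x k)).mul_const _]
  refine integral_congr_ae (Filter.Eventually.of_forall fun g => ?_)
  simpa only [Matrix.mul_apply] using congrFun (congrFun (h g) x) y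

lemma haarAvg_const (C : Matrix n n ℂ) : haarAvg (fun _ : G => C) = C := by
  ext x y
  simp [haarAvg]

lemma haarAvg_mul_eq_self [DecidableEq m] {B : G → Matrix n n ℂ}
    (hB : ∀ x y, Continuous fun g => B g x y)
    {C : Matrix n m ℂ} (h : ∀ g, B g * C = C) : haarAvg B * C = C := by
  have := mul_haarAvg_of_intertwines (G := G) (B := fun _ => (1 : Matrix m m ℂ)) (B' := B)
    (fun _ _ => continuous_const) hB (C := C) fun g => by rw [h, Matrix.mul_one]
  rw [← this, haarAvg_const, Matrix.mul_one]

lemma mul_haarAvg_self {B : G → Matrix n n ℂ} (hB : ∀ x y, Continuous fun g => B g x y)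
    (hmul : ∀ g h, B (g * h) = B g * B h) (h : G) : B h * haarAvg B = haarAvg B := by
  ext x y
  simp only [Matrix.mul_apply, haarAvg, Matrix.of_apply, ← integral_const_mul]
  rw [← integral_finsetSum _ fun k _ => (integrable_haarProb (hB k y)).const_mul _,
    ← integral_mul_left_eq_self (fun g => B g x y) h]
  simp only [hmul, Matrix.mul_apply]

lemma haarAvg_self_mul {B : G → Matrix n n ℂ} (hB : ∀ x y, Continuous fun g => B g x y)
    (hmul : ∀ g h, B (g * h) = B g * B h) (hinv : ∀ g, (B g)ᴴ = B g⁻¹) (h : G) :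
    haarAvg B * B h = haarAvg B := by
  have := congrArg Matrix.conjTranspose (mul_haarAvg_self hB hmul h⁻¹)
  rwa [Matrix.conjTranspose_mul, hinv, inv_inv, haarAvg_conjTranspose hinv] at this

/-- The operator `∫ dg conj (D^α(g) i j) B(g)`. -/
def matCoeff (B : G → Matrix n n ℂ) (α : Irrep G) (i j : Fin α.dim) : Matrix n n ℂ :=
  haarAvg fun g => star (α.D g i j) • B g

lemma continuous_matCoeff_integrand {B : G → Matrix n n ℂ}
    (hB : ∀ x y, Continuous fun g => B g x y) (α : Irrep G) (i j : Fin α.dim) (x y : n) :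
    Continuous fun g => (star (α.D g i j) • B g) x y :=
  (continuous_star.comp (α.continuous_D i j)).mul (hB x y)

/-- Left invariance of the Haar measure and unitarity of D^α(h). For fixed j the operators indexed
by i transform like the basis of α, and this is the source of all intertwiners below. -/
lemma mul_matCoeff {B : G → Matrix n n ℂ} (hB : ∀ x y, Continuous fun g => B g x y)
    (hmul : ∀ g h, B (g * h) = B g * B h) (h : G) (α : Irrep G) (i j : Fin α.dim) :
    B h * matCoeff B α i j = ∑ k, α.D h k i • matCoeff B α k j := by
  have hc : ∀ i j x y, Continuous fun g => star (α.D g i j) * B g x y :=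
    continuous_matCoeff_integrand hB α
  ext x y
  simp only [Matrix.mul_apply, Matrix.sum_apply, Matrix.smul_apply, matCoeff, haarAvg,
    Matrix.of_apply, smul_eq_mul, ← integral_const_mul]
  rw [← integral_finsetSum _ fun k _ => (integrable_haarProb (hc i j k y)).const_mul _,
    ← integral_finsetSum _ fun k _ => (integrable_haarProb (hc k j x y)).const_mul _,
    ← integral_mul_left_eq_self (fun g => ∑ k, α.D h k i * (star (α.D g k j) * B g x y)) h]
  refine integral_congr_ae (Filter.Eventually.of_forall fun g => ?_)
  have h1 : ∑ k, α.D h k i * star (α.D (h * g) k j) = star (α.D g i j) := by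
    have h2 : α.D g = (α.D h)ᴴ * α.D (h * g) := by
      rw [← Irrep.D_inv, ← Irrep.D_mul, inv_mul_cancel_left]
    conv_rhs => rw [h2, Matrix.mul_apply, star_sum]
    refine Finset.sum_congr rfl fun k _ => ?_
    rw [star_mul', Matrix.conjTranspose_apply, star_star]
  simp only [← mul_assoc, ← Finset.sum_mul, h1]
  rw [hmul, Matrix.mul_apply, Finset.mul_sum]
  exact Finset.sum_congr rfl fun k _ => by ring

lemma intertwines_matCoeff {B : G → Matrix m m ℂ} {B' : G → Matrix n n ℂ}
    (hB : ∀ x y, Continuous fun g => B g x y) (hB' : ∀ x y, Continuous fun g => B' g x y)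
    {C : Matrix n m ℂ} (h : ∀ g, C * B g = B' g * C) (α : Irrep G) (i j : Fin α.dim) :
    C * matCoeff B α i j = matCoeff B' α i j * C :=
  mul_haarAvg_of_intertwines (continuous_matCoeff_integrand hB α i j)
    (continuous_matCoeff_integrand hB' α i j) fun g => by
      rw [Matrix.mul_smul, h, Matrix.smul_mul]

end Averages

/-! ### Nonvanishing of matrix coefficients on a given vector -/

section Completeness

variable {G : Type*} [Group G] [TopologicalSpace G]

/-- The restriction of a unitary representation to an invariant subspace. -/
lemma exists_restriction (π : UnitaryRep G) (W : Submodule ℂ (Fin π.dim → ℂ))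
    (hW : ∀ g, ∀ x ∈ W, π.mat g *ᵥ x ∈ W) :
    ∃ (σ : UnitaryRep G) (J : Matrix (Fin π.dim) (Fin σ.dim) ℂ),
      σ.dim = Module.finrank ℂ W ∧ (∀ x ∈ W, J *ᵥ (Jᴴ *ᵥ x) = x) ∧ (∀ x, J *ᵥ x ∈ W) ∧
      (∀ g, π.mat g * J = J * σ.mat g) ∧ ∀ g, Jᴴ * π.mat g = σ.mat g * Jᴴ := by
  let e := WithLp.linearEquiv 2 ℂ (Fin π.dim → ℂ)
  let W' : Submodule ℂ (EuclideanSpace ℂ (Fin π.dim)) := W.map e.symm.toLinearMap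
  have hfin : Module.finrank ℂ W' = Module.finrank ℂ W := LinearEquiv.finrank_map_eq e.symm W
  let b := stdOrthonormalBasis ℂ W'
  let k := Module.finrank ℂ W'
  -- The columns form an orthonormal basis of the subspace, so J Jᴴ is the orthogonal projection
  -- onto it and Jᴴ J = 1.
  let J : Matrix (Fin π.dim) (Fin k) ℂ := Matrix.of fun i a => (b a : EuclideanSpace ℂ _) i
  have hJmem : ∀ x, J *ᵥ x ∈ W := by
    intro x
    have h1 : J *ᵥ x = ∑ a, x a • e (b a : EuclideanSpace ℂ _) := by
      ext i
      simp [Matrix.mulVec, dotProduct, J, Finset.sum_apply, e, mul_comm]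
    rw [h1]
    refine sum_mem fun a _ => W.smul_mem _ ?_
    obtain ⟨w, hw, hwe⟩ := (b a).2
    rw [← hwe]
    simpa using hw
  have hproj : ∀ x ∈ W, J *ᵥ (Jᴴ *ᵥ x) = x := by
    intro x hx
    have hx' : e.symm x ∈ W' := ⟨x, hx, rfl⟩
    have h1 := congrArg (fun w : W' => e w.1) (b.sum_repr' ⟨e.symm x, hx'⟩)
    simp only [LinearEquiv.apply_symm_apply] at h1
    conv_rhs => rw [← h1]
    ext i
    simp [Matrix.mulVec, dotProduct, J, e, Submodule.coe_inner, PiLp.inner_apply, mul_comm]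
    rfl
  have hJJ : Jᴴ * J = 1 := by
    ext a c
    have h1 := orthonormal_iff_ite.mp b.orthonormal a c
    rw [Submodule.coe_inner, PiLp.inner_apply] at h1
    simp only [Matrix.mul_apply, Matrix.conjTranspose_apply, Matrix.one_apply, ← h1, J]
    simp [mul_comm]
  have hJ1 : ∀ g, J * (Jᴴ * (π.mat g * J)) = π.mat g * J := by
    intro g
    refine Matrix.ext_of_mulVec_single fun a => ?_
    simp only [← Matrix.mulVec_mulVec]
    exact hproj _ (hW g _ (hJmem _))
  -- Adjoint of the previous relation at g⁻¹: by unitarity the orthogonal complement is invariant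
  -- too.
  have hJ2 : ∀ g, Jᴴ * π.mat g * J * Jᴴ = Jᴴ * π.mat g := by
    intro g
    have := congrArg Matrix.conjTranspose (hJ1 g⁻¹)
    simpa [Matrix.conjTranspose_mul, UnitaryRep.mat_inv, Matrix.mul_assoc] using this
  let f : G → Matrix (Fin k) (Fin k) ℂ := fun g => Jᴴ * π.mat g * J
  have hf1 : f 1 = 1 := by simp [f, π.mat_one, hJJ]
  have hfmul : ∀ g h, f (g * h) = f g * f h := by
    intro g h
    simp only [f]
    rw [← Matrix.mul_assoc, ← Matrix.mul_assoc, hJ2, π.mat_mul, ← Matrix.mul_assoc]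
  have hfstar : ∀ g, (f g)ᴴ = f g⁻¹ := by
    intro g
    simp [f, Matrix.conjTranspose_mul, UnitaryRep.mat_inv, Matrix.mul_assoc]
  have hfu : ∀ g, f g ∈ Matrix.unitaryGroup (Fin k) ℂ := by
    intro g
    rw [Matrix.mem_unitaryGroup_iff, Matrix.star_eq_conjTranspose, hfstar, ← hfmul,
      mul_inv_cancel, hf1]
  have hcont : Continuous f := by
    refine continuous_matrix fun a c => ?_
    simp only [f, Matrix.mul_apply]
    exact continuous_finsetSum _ fun i _ => (continuous_finsetSum _ fun l _ =>
      continuous_const.mul (π.continuous_mat l i)).mul continuous_const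
  refine ⟨⟨k, ⟨⟨fun g => ⟨f g, hfu g⟩, Subtype.ext hf1⟩, fun g h => Subtype.ext (hfmul g h)⟩,
    hcont.subtype_mk _⟩, J, hfin, hproj, hJmem, fun g => ?_, fun g => ?_⟩
  · change π.mat g * J = J * (Jᴴ * π.mat g * J)
    rw [Matrix.mul_assoc Jᴴ, hJ1]
  · exact (hJ2 g).symm

/-- Used to write the entries of an irreducible representation as combinations of the entries of its
chosen model. The equivalence need not be unitary; only its inverse is used. -/
lemma exists_mat_eq_mul_mat_mul {π σ : UnitaryRep G} (φ : π.rep.Equiv σ.rep) :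
    ∃ (S' : Matrix (Fin π.dim) (Fin σ.dim) ℂ) (S : Matrix (Fin σ.dim) (Fin π.dim) ℂ),
      ∀ g, π.mat g = S' * σ.mat g * S := by
  let f : (Fin π.dim → ℂ) →ₗ[ℂ] Fin σ.dim → ℂ := φ.toIntertwiningMap.toLinearMap
  let f' : (Fin σ.dim → ℂ) →ₗ[ℂ] Fin π.dim → ℂ := φ.toLinearEquiv.symm.toLinearMap
  refine ⟨LinearMap.toMatrix' f', LinearMap.toMatrix' f, fun g => ?_⟩
  have h1 : f ∘ₗ Matrix.toLin' (π.mat g) = Matrix.toLin' (σ.mat g) ∘ₗ f :=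
    φ.toIntertwiningMap.isIntertwining' g
  have h2 : f' ∘ₗ f = LinearMap.id := LinearMap.ext fun x => φ.toLinearEquiv.symm_apply_apply x
  have h3 := congrArg LinearMap.toMatrix' h1
  rw [LinearMap.toMatrix'_comp, LinearMap.toMatrix'_comp, LinearMap.toMatrix'_toLin',
    LinearMap.toMatrix'_toLin'] at h3
  rw [Matrix.mul_assoc, ← h3, ← Matrix.mul_assoc, ← LinearMap.toMatrix'_comp, h2,
    LinearMap.toMatrix'_id, Matrix.one_mul]

variable [IsTopologicalGroup G] [CompactSpace G] [MeasurableSpace G] [BorelSpace G]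

/-- Take α to be the class of π. The entries of π(g)u are combinations of the D^α(g) i j. If every
coefficient annihilated u, then ∫ ‖π(g)u‖² dg would vanish; but the integrand is the constant ‖u‖².
-/
lemma exists_matCoeff_ne_zero_of_isIrreducible (π : UnitaryRep G) (hπ : π.rep.IsIrreducible)
    {u : Fin π.dim → ℂ} (hu : u ≠ 0) :
    ∃ (α : Irrep G) (i j : Fin α.dim), matCoeff π.mat α i j *ᵥ u ≠ 0 := by
  let α : Irrep G := Quotient.mk (irrepSetoid G) ⟨π, hπ⟩
  obtain ⟨φ⟩ : Nonempty (π.rep.Equiv α.out.rep) :=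
    Setoid.symm (Quotient.mk_out (s := irrepSetoid G) ⟨π, hπ⟩)
  obtain ⟨S', S, hS⟩ : ∃ (S' : Matrix (Fin π.dim) (Fin α.dim) ℂ)
      (S : Matrix (Fin α.dim) (Fin π.dim) ℂ), ∀ g, π.mat g = S' * α.D g * S :=
    exists_mat_eq_mul_mat_mul φ
  by_contra! h
  have hcoef : ∀ (k : Fin π.dim) i j,
      ∫ g, star (α.D g i j) * (π.mat g *ᵥ u) k ∂(haarProb G) = 0 := by
    intro k i j
    have := congrFun (h α i j) k
    simp only [Matrix.mulVec, dotProduct, matCoeff, haarAvg, Matrix.of_apply,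
      ← integral_mul_const] at this
    rw [← integral_finsetSum _ fun l _ => (integrable_haarProb
      (continuous_matCoeff_integrand π.continuous_mat α i j k l)).mul_const _] at this
    refine Eq.trans ?_ this
    refine integral_congr_ae (Filter.Eventually.of_forall fun g => ?_)
    simp [Matrix.mulVec, dotProduct, Finset.mul_sum, mul_assoc]
  have hcu : ∀ k, Continuous fun g => (π.mat g *ᵥ u) k := fun k => by
    simp only [Matrix.mulVec, dotProduct]
    exact continuous_finsetSum _ fun l _ => (π.continuous_mat k l).mul continuous_const
  have hk : ∀ k, ∫ g, star ((π.mat g *ᵥ u) k) * (π.mat g *ᵥ u) k ∂(haarProb G) = 0 := by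
    intro k
    have h1 : ∀ g, star ((π.mat g *ᵥ u) k) * (π.mat g *ᵥ u) k =
        ∑ i, ∑ j, star (S' k i * (S *ᵥ u) j) * (star (α.D g i j) * (π.mat g *ᵥ u) k) := by
      intro g
      have h2 : (π.mat g *ᵥ u) k = ∑ i, ∑ j, S' k i * (S *ᵥ u) j * α.D g i j := by
        rw [hS g, ← Matrix.mulVec_mulVec, ← Matrix.mulVec_mulVec]
        generalize S *ᵥ u = w
        simp only [Matrix.mulVec, dotProduct, Finset.mul_sum]
        refine Finset.sum_congr rfl fun i _ => Finset.sum_congr rfl fun j _ => by ring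
      conv_lhs => enter [1]; rw [h2]
      simp only [star_sum, Finset.sum_mul, star_mul']
      refine Finset.sum_congr rfl fun i _ => Finset.sum_congr rfl fun j _ => by ring
    simp_rw [h1]
    have hint : ∀ i j, Integrable (fun g => star (S' k i * (S *ᵥ u) j) *
        (star (α.D g i j) * (π.mat g *ᵥ u) k)) (haarProb G) := fun i j =>
      (integrable_haarProb ((continuous_star.comp (α.continuous_D i j)).mul (hcu k))).const_mul _
    rw [integral_finsetSum _ fun i _ => integrable_finsetSum _ fun j _ => hint i j]
    refine Finset.sum_eq_zero fun i _ => ?_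
    rw [integral_finsetSum _ fun j _ => hint i j]
    refine Finset.sum_eq_zero fun j _ => ?_
    rw [integral_const_mul, hcoef, mul_zero]
  have hnorm : ∀ g, ∑ k, star ((π.mat g *ᵥ u) k) * (π.mat g *ᵥ u) k = star u ⬝ᵥ u := by
    intro g
    change star (π.mat g *ᵥ u) ⬝ᵥ (π.mat g *ᵥ u) = _
    rw [Matrix.star_mulVec, ← Matrix.dotProduct_mulVec, Matrix.mulVec_mulVec, ← π.mat_inv,
      ← π.mat_mul, inv_mul_cancel, π.mat_one, Matrix.one_mulVec]
  have hzero : ∫ g, ∑ k, star ((π.mat g *ᵥ u) k) * (π.mat g *ᵥ u) k ∂(haarProb G) = 0 := by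
    have hint : ∀ k, Integrable (fun g => star ((π.mat g *ᵥ u) k) * (π.mat g *ᵥ u) k)
        (haarProb G) := fun k =>
      integrable_haarProb ((continuous_star.comp (hcu k)).mul (hcu k))
    rw [integral_finsetSum _ fun k _ => hint k]
    exact Finset.sum_eq_zero fun k _ => hk k
  simp_rw [hnorm] at hzero
  rw [integral_const] at hzero
  simp only [probReal_univ, one_smul] at hzero
  exact hu (dotProduct_star_self_eq_zero.mp hzero)

/-- Induction on the dimension. If π is reducible, u has a nonzero component in a proper invariant
subspace W or in its orthogonal complement. -/
lemma exists_matCoeff_ne_zero (π : UnitaryRep G) {u : Fin π.dim → ℂ} (hu : u ≠ 0) :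
    ∃ (α : Irrep G) (i j : Fin α.dim), matCoeff π.mat α i j *ᵥ u ≠ 0 := by
  obtain ⟨d, hd⟩ : ∃ d, π.dim = d := ⟨_, rfl⟩
  induction d using Nat.strong_induction_on generalizing π with
  | _ d ih =>
  by_cases hirr : π.rep.IsIrreducible
  · exact exists_matCoeff_ne_zero_of_isIrreducible π hirr hu
  have hnt : Nontrivial (Fin π.dim → ℂ) := nontrivial_of_ne _ _ hu
  obtain ⟨W, hW0, hW1⟩ : ∃ W : Subrepresentation π.rep, W ≠ ⊥ ∧ W ≠ ⊤ := by
    by_contra! h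
    refine hirr { exists_pair_ne := ⟨⊥, ⊤, fun he => bot_ne_top (α := Submodule ℂ _)
      (congrArg Subrepresentation.toSubmodule he)⟩, eq_bot_or_eq_top := fun W => ?_ }
    exact or_iff_not_imp_left.mpr (h W)
  -- The map Jᴴ intertwines the coefficients of π and σ, so a coefficient that is nonzero on Jᴴu is
  -- nonzero on u.
  have step : ∀ (σ : UnitaryRep G) (J : Matrix (Fin π.dim) (Fin σ.dim) ℂ), σ.dim < π.dim →
      (∀ g, Jᴴ * π.mat g = σ.mat g * Jᴴ) → Jᴴ *ᵥ u ≠ 0 →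
      ∃ (α : Irrep G) (i j : Fin α.dim), matCoeff π.mat α i j *ᵥ u ≠ 0 := by
    intro σ J hlt hJ hne
    obtain ⟨α, i, j, h⟩ := ih _ (hd ▸ hlt) σ hne rfl
    refine ⟨α, i, j, fun h0 => h ?_⟩
    rw [Matrix.mulVec_mulVec, ← intertwines_matCoeff π.continuous_mat σ.continuous_mat hJ,
      ← Matrix.mulVec_mulVec, h0, Matrix.mulVec_zero]
  have hlt : ∀ U : Submodule ℂ (Fin π.dim → ℂ), U ≠ ⊤ → Module.finrank ℂ U < π.dim := by
    intro U hU
    simpa using Submodule.finrank_lt hU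
  obtain ⟨σ, J, hdim, hJ1, hJ2, hJ3, hJ4⟩ :=
    exists_restriction π W.toSubmodule fun g x hx => W.apply_mem_toSubmodule g hx
  by_cases hu1 : Jᴴ *ᵥ u = 0
  · let U : Submodule ℂ (Fin π.dim → ℂ) := LinearMap.ker (Matrix.mulVecLin Jᴴ)
    have hU : U ≠ ⊤ := by
      intro hU
      refine hW0 (Subrepresentation.toSubmodule_injective ((Submodule.eq_bot_iff _).mpr ?_))
      intro x hx
      have : x ∈ U := hU ▸ Submodule.mem_top
      rw [← hJ1 x hx, show Jᴴ *ᵥ x = 0 from this, Matrix.mulVec_zero]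
    obtain ⟨σ', J', hdim', hJ1', -, -, hJ4'⟩ := exists_restriction π U fun g x hx => by
      change Jᴴ *ᵥ (π.mat g *ᵥ x) = 0
      rw [Matrix.mulVec_mulVec, hJ4, ← Matrix.mulVec_mulVec, show Jᴴ *ᵥ x = 0 from hx,
        Matrix.mulVec_zero]
    refine step σ' J' (hdim' ▸ hlt U hU) hJ4' fun h0 => hu ?_
    rw [← hJ1' u hu1, h0, Matrix.mulVec_zero]
  · exact step σ J (hdim ▸ hlt _ fun h => hW1 (Subrepresentation.toSubmodule_injective h)) hJ4 hu1

lemma exists_matCoeff_mulVec_ne_zero {n : Type*} [Fintype n] [DecidableEq n]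
    {B : G → Matrix n n ℂ} (hB : ∀ x y, Continuous fun g => B g x y) (h1 : B 1 = 1)
    (hmul : ∀ g h, B (g * h) = B g * B h) (hinv : ∀ g, (B g)ᴴ = B g⁻¹) {u : n → ℂ} (hu : u ≠ 0) :
    ∃ (α : Irrep G) (i j : Fin α.dim), matCoeff B α i j *ᵥ u ≠ 0 := by
  let e := Fintype.equivFin n
  let f : G → Matrix (Fin (Fintype.card n)) (Fin (Fintype.card n)) ℂ := fun g =>
    (B g).submatrix e.symm e.symm
  have hf1 : f 1 = 1 := by simp [f, h1]
  have hfmul : ∀ g h, f (g * h) = f g * f h := fun g h => by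
    simp only [f, hmul, Matrix.submatrix_mul_equiv]
  have hfu : ∀ g, f g ∈ Matrix.unitaryGroup (Fin (Fintype.card n)) ℂ := by
    intro g
    rw [Matrix.mem_unitaryGroup_iff, Matrix.star_eq_conjTranspose,
      show (f g)ᴴ = f g⁻¹ by simp only [f, Matrix.conjTranspose_submatrix, hinv], ← hfmul,
      mul_inv_cancel, hf1]
  let π : UnitaryRep G := ⟨Fintype.card n,
    ⟨⟨fun g => ⟨f g, hfu g⟩, Subtype.ext hf1⟩, fun g h => Subtype.ext (hfmul g h)⟩,
    (continuous_matrix fun i j => hB _ _).subtype_mk _⟩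
  have hu' : (u ∘ e.symm : Fin π.dim → ℂ) ≠ 0 := by
    intro h0
    refine hu (funext fun x => ?_)
    simpa using congrFun h0 (e x)
  obtain ⟨α, i, j, h⟩ := exists_matCoeff_ne_zero π hu'
  refine ⟨α, i, j, fun h0 => h ?_⟩
  have : matCoeff π.mat α i j = (matCoeff B α i j).submatrix e.symm e.symm := rfl
  rw [this]
  have h2 := Matrix.submatrix_mulVec_equiv (matCoeff B α i j) (u ∘ e.symm) e.symm e.symm
  rw [Equiv.symm_symm, Function.comp_assoc, Equiv.symm_comp_self, Function.comp_id, h0] at h2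
  exact h2

end Completeness

end GaugedRTN

end

noncomputable section

namespace GaugedRTN

/-! ### Sectors of the gauge theory -/

lemma pi_mulSingle_induction {κ G : Type*} [Fintype κ] [DecidableEq κ] [Group G]
    {p : (κ → G) → Prop} (h1 : p 1) (hmul : ∀ g h, p g → p h → p (g * h))
    (hs : ∀ v h, p (Pi.mulSingle v h)) (g : κ → G) : p g := by
  rw [← Finset.noncommProd_mulSingle (M := fun _ => G) g]
  exact Finset.noncommProd_induction _ _ _ p hmul h1 fun v _ => hs v _

lemma mul_noncommProd_eq_self {κ R : Type*} [DecidableEq κ] [Monoid R] {s : Finset κ} {f : κ → R}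
    (comm) {a : κ} (ha : a ∈ s) {x : R} (h : x * f a = f a) :
    x * s.noncommProd f comm = s.noncommProd f comm := by
  rw [← Finset.mul_noncommProd_erase s ha f comm, ← mul_assoc, h]

namespace GaugeModel

variable {G : Type*} [Group G] [TopologicalSpace G] {V E : Type*} (M : GaugeModel G V E)
  [Fintype V] [DecidableEq V] [Fintype E] [DecidableEq E] (r : Finset (V ⊕ E))

lemma gaugeOn_one : M.gaugeOn r 1 = 1 := by
  ext x y
  simp only [gaugeOn, tensorOp, siteOp_one, Matrix.one_apply, Finset.prod_ite_zero,
    Finset.prod_const_one, Finset.mem_univ, true_implies, funext_iff]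

lemma gaugeOn_inv (g : V → G) : (M.gaugeOn r g)ᴴ = M.gaugeOn r g⁻¹ := by
  simp only [gaugeOn, tensorOp_conjTranspose, siteOp_inv]

lemma gauge_conjTranspose (g : V → G) : (M.gauge g)ᴴ = M.gauge g⁻¹ := by
  simp only [gauge, tensorOp_conjTranspose, siteOp_inv]

lemma gaugeAtOn_one (v : V) : M.gaugeAtOn r v 1 = 1 := by
  rw [gaugeAtOn, Pi.mulSingle_one, gaugeOn_one]

lemma gaugeAtOn_mul (v : V) (g h : G) :
    M.gaugeAtOn r v (g * h) = M.gaugeAtOn r v g * M.gaugeAtOn r v h := by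
  rw [gaugeAtOn, Pi.mulSingle_mul, gaugeOn_mul]; rfl

lemma gaugeAtOn_inv (v : V) (g : G) : (M.gaugeAtOn r v g)ᴴ = M.gaugeAtOn r v g⁻¹ := by
  rw [gaugeAtOn, gaugeOn_inv, ← Pi.mulSingle_inv]; rfl

lemma gaugeAt_mul (v : V) (g h : G) :
    M.gaugeAt v (g * h) = M.gaugeAt v g * M.gaugeAt v h := by
  rw [gaugeAt, Pi.mulSingle_mul, gauge_mul]; rfl

lemma gauge_eq (g : V → G) :
    M.gauge g = extendOp (M.gaugeOn r g) * coextendOp (M.gaugeOn rᶜ g) :=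
  tensorOp_eq_extendOp_mul_coextendOp (r := r) (M.siteOp g)

variable {r}

/-- Neither v nor any edge at v lies in r, so every site of r sees only the group identity. -/
lemma gaugeAtOn_of_mem_interior_compl {v : V} (hv : v ∈ M.interior rᶜ) (g : G) :
    M.gaugeAtOn r v g = 1 := by
  rw [← gaugeOn_one, gaugeAtOn, gaugeOn, gaugeOn]
  congr 1
  ext1 s
  obtain ⟨-, hv1, hv2⟩ := Finset.mem_filter.mp hv
  have hne : ∀ w, w ≠ v → (Pi.mulSingle v g : V → G) w = 1 := fun w hw => by
    simp [hw]
  obtain ⟨w | e, hs⟩ := s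
  · have hw : w ≠ v := by
      rintro rfl
      exact Finset.mem_compl.mp hv1 hs
    change (M.matter w).mat _ = (M.matter w).mat _
    rw [hne w hw]; rfl
  · have he : ∀ w, M.src e = w ∨ M.tgt e = w → w ≠ v := by
      rintro w hw rfl
      exact Finset.mem_compl.mp (hv2 e hw) hs
    change M.edgeOp e _ _ = M.edgeOp e _ _
    rw [hne _ (he _ (Or.inl rfl)), hne _ (he _ (Or.inr rfl))]; rfl

lemma gaugeAt_of_mem_interior {v : V} (hv : v ∈ M.interior r) (g : G) :
    M.gaugeAt v g = extendOp (M.gaugeAtOn r v g) := by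
  have h1 : M.gaugeOn rᶜ (Pi.mulSingle v g) = 1 :=
    M.gaugeAtOn_of_mem_interior_compl (r := rᶜ) (by rwa [compl_compl]) g
  rw [gaugeAt, M.gauge_eq r, h1, coextendOp_one, Matrix.mul_one]; rfl

lemma mem_cut_of_notMem {v : V} (h1 : v ∉ M.interior r) (h2 : v ∉ M.interior rᶜ) :
    v ∈ M.cut r := by
  simp [cut, h1, h2]

lemma cutGauge_mulSingle (v : M.cut r) (g : G) :
    M.cutGauge r (Pi.mulSingle v g) = M.gaugeAtOn r v g := by
  rw [cutGauge, gaugeAtOn]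
  congr 1
  ext w
  by_cases hw : w = v
  · subst hw; simp
  · by_cases hc : w ∈ M.cut r
    · rw [dif_pos hc, Pi.mulSingle_eq_of_ne hw, Pi.mulSingle_eq_of_ne]
      exact fun h => hw (congrArg Subtype.val h)
    · rw [dif_neg hc, Pi.mulSingle_eq_of_ne hw]

lemma cutGauge_one : M.cutGauge r 1 = 1 := by
  rw [cutGauge, ← gaugeOn_one]
  congr 1
  ext w
  split_ifs <;> rfl

lemma cutGauge_mul (g h : M.cut r → G) :
    M.cutGauge r (g * h) = M.cutGauge r g * M.cutGauge r h := by
  simp only [cutGauge]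
  rw [← gaugeOn_mul]
  congr 1
  ext w
  by_cases hw : w ∈ M.cut r <;> simp [hw]

lemma cutGauge_conjTranspose (g : M.cut r → G) : (M.cutGauge r g)ᴴ = M.cutGauge r g⁻¹ := by
  simp only [cutGauge]
  rw [gaugeOn_inv]
  congr 1
  ext w
  by_cases hw : w ∈ M.cut r <;> simp [hw]

variable (r) in
/-- The operators on the factors in `r` which commute with all gauge transformations. -/
def commutant : StarSubalgebra ℂ (Matrix (Conf M.Loc r) (Conf M.Loc r) ℂ) :=
  StarSubalgebra.centralizer ℂ (Set.range (M.gaugeOn r))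

lemma mem_commutant {O : Matrix (Conf M.Loc r) (Conf M.Loc r) ℂ} :
    O ∈ M.commutant r ↔ ∀ g, Commute (M.gaugeOn r g) O := by
  rw [commutant, StarSubalgebra.mem_centralizer_iff]
  constructor
  · exact fun h g => (h _ ⟨g, rfl⟩).1
  · rintro h _ ⟨g, rfl⟩
    refine ⟨h g, ?_⟩
    rw [Matrix.star_eq_conjTranspose, gaugeOn_inv]
    exact h g⁻¹

lemma mem_commutant_iff_gaugeAtOn {O : Matrix (Conf M.Loc r) (Conf M.Loc r) ℂ} :
    O ∈ M.commutant r ↔ ∀ v g, Commute (M.gaugeAtOn r v g) O := by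
  rw [mem_commutant]
  refine ⟨fun h v g => h _, fun h => pi_mulSingle_induction ?_ (fun g g' hg hg' => ?_) h⟩
  · rw [gaugeOn_one]; exact Commute.one_left _
  · rw [gaugeOn_mul]; exact hg.mul_left hg'

variable [IsTopologicalGroup G] [CompactSpace G] [MeasurableSpace G] [BorelSpace G]

lemma gauge_mul_projGI (g : V → G) : M.gauge g * M.projGI = M.projGI := by
  revert g
  refine pi_mulSingle_induction ?_ (fun g h hg hh => ?_) fun v h => ?_
  · rw [show M.gauge 1 = 1 from by
      rw [M.gauge_eq ∅, gaugeOn_one, gaugeOn_one, extendOp_one, coextendOp_one, Matrix.one_mul],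
      Matrix.one_mul]
  · rw [gauge_mul, Matrix.mul_assoc, hh, hg]
  · have h1 : M.gaugeAt v h * M.projAt v = M.projAt v :=
      mul_haarAvg_self (M.continuous_gaugeAt v) (M.gaugeAt_mul v) h
    exact mul_noncommProd_eq_self _ (Finset.mem_univ v) h1

lemma projGI_mul_gauge (g : V → G) : M.projGI * M.gauge g = M.projGI := by
  have := congrArg Matrix.conjTranspose (M.gauge_mul_projGI g⁻¹)
  rwa [Matrix.conjTranspose_mul, projGI_conjTranspose, gauge_conjTranspose, inv_inv] at this

lemma commute_projGI_of_mem_commutant {O : Matrix (Conf M.Loc r) (Conf M.Loc r) ℂ}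
    (hO : O ∈ M.commutant r) : Commute (extendOp O) M.projGI := by
  refine Finset.noncommProd_commute _ _ _ _ fun v _ =>
    commute_haarAvg (M.continuous_gaugeAt v) fun g => ?_
  have h1 := M.mem_commutant.mp hO (Pi.mulSingle v g)
  rw [gaugeAt, M.gauge_eq r]
  refine Commute.mul_right ?_ (commute_extendOp_coextendOp _ _)
  rw [Commute, SemiconjBy, ← extendOp_mul, ← extendOp_mul, h1.eq]

/-- Such a Y absorbs every gauge transformation on both sides, hence commutes with it, and the
product form of the gauge transformation passes this to the partial trace. -/
lemma partialTrace_mem_commutant {Y : Matrix M.Config M.Config ℂ} (h1 : M.projGI * Y = Y)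
    (h2 : Y * M.projGI = Y) : partialTrace r Y ∈ M.commutant r := by
  rw [mem_commutant]
  intro g
  refine partialTrace_commute_of_commute_tensorOp (A := M.siteOp g) (A' := M.siteOp g⁻¹)
    (fun s => ?_) ?_
  · rw [← siteOp_mul, mul_inv_cancel, siteOp_one]
  · change M.gauge g * Y = Y * M.gauge g
    rw [← h1, ← Matrix.mul_assoc, gauge_mul_projGI, h1]
    conv_rhs => rw [← h2, Matrix.mul_assoc, projGI_mul_gauge, h2]

/-! ### The partially gauged space -/

lemma commute_gaugeAtOn_haarAvg (v w : V) (g : G) :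
    Commute (M.gaugeAtOn r v g) (haarAvg (M.gaugeAtOn r w)) := by
  by_cases hvw : v = w
  · subst hvw
    rw [Commute, SemiconjBy, mul_haarAvg_self (M.continuous_gaugeAtOn r v) (M.gaugeAtOn_mul r v),
      haarAvg_self_mul (M.continuous_gaugeAtOn r v) (M.gaugeAtOn_mul r v) (M.gaugeAtOn_inv r v)]
  · exact commute_haarAvg (M.continuous_gaugeAtOn r w) fun h => M.commute_gaugeAtOn r hvw g h

lemma partialProj_mem_commutant : M.partialProj r ∈ M.commutant r :=
  M.mem_commutant_iff_gaugeAtOn.mpr fun v g =>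
    Finset.noncommProd_commute _ _ _ _ fun w _ => M.commute_gaugeAtOn_haarAvg v w g

lemma gaugeAtOn_mul_partialProj {v : V} (hv : v ∈ M.interior r) (g : G) :
    M.gaugeAtOn r v g * M.partialProj r = M.partialProj r := by
  exact mul_noncommProd_eq_self _ hv
    (mul_haarAvg_self (M.continuous_gaugeAtOn r v) (M.gaugeAtOn_mul r v) g)

lemma partialProj_mul_eq_self {m : Type*} [Fintype m] [DecidableEq m]
    {Y : Matrix (Conf M.Loc r) m ℂ}
    (h : ∀ v ∈ M.interior r, ∀ g, M.gaugeAtOn r v g * Y = Y) : M.partialProj r * Y = Y :=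
  Finset.noncommProd_induction _ _ _ (fun O => O * Y = Y)
    (fun O O' hO hO' => by rw [Matrix.mul_assoc, hO', hO]) (Matrix.one_mul _) fun v hv =>
      haarAvg_mul_eq_self (M.continuous_gaugeAtOn r v) (h v hv)

lemma partialProj_mul_self : M.partialProj r * M.partialProj r = M.partialProj r :=
  M.partialProj_mul_eq_self fun _ hv g => M.gaugeAtOn_mul_partialProj hv g

lemma commute_partialProj {O : Matrix (Conf M.Loc r) (Conf M.Loc r) ℂ}
    (hO : O ∈ M.commutant r) : Commute O (M.partialProj r) :=
  Finset.noncommProd_commute _ _ _ _ fun v _ => commute_haarAvg (M.continuous_gaugeAtOn r v)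
    fun g => (M.mem_commutant_iff_gaugeAtOn.mp hO v g).symm

/-! ### Intertwiners into the partially gauged space -/

variable (r) in
/-- The matrix `T` intertwines the irrep `α` of `Gⁿ` with the partially gauged space. -/
def IsIntertwiner (α : M.CutIrrep r)
    (T : Matrix (Conf M.Loc r) (∀ v, Fin (α v).dim) ℂ) : Prop :=
  M.partialProj r * T = T ∧ ∀ g, T * M.cutRep r α g = M.cutGauge r g * T

variable {M} {α : M.CutIrrep r}

lemma IsIntertwiner.mul_left {T : Matrix (Conf M.Loc r) (∀ v, Fin (α v).dim) ℂ}
    (hT : M.IsIntertwiner r α T) {O : Matrix (Conf M.Loc r) (Conf M.Loc r) ℂ}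
    (hO : O ∈ M.commutant r) : M.IsIntertwiner r α (O * T) := by
  constructor
  · rw [← Matrix.mul_assoc, ← (M.commute_partialProj hO).eq, Matrix.mul_assoc, hT.1]
  · intro g
    have h : Commute (M.cutGauge r g) O := M.mem_commutant.mp hO _
    rw [Matrix.mul_assoc, hT.2, ← Matrix.mul_assoc, ← h.eq, Matrix.mul_assoc]

lemma IsIntertwiner.conjTranspose_mul {T : Matrix (Conf M.Loc r) (∀ v, Fin (α v).dim) ℂ}
    (hT : M.IsIntertwiner r α T) (g : M.cut r → G) :
    M.cutRep r α g * Tᴴ = Tᴴ * M.cutGauge r g := by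
  have h := congrArg Matrix.conjTranspose (hT.2 g⁻¹)
  rw [Matrix.conjTranspose_mul, Matrix.conjTranspose_mul, cutGauge_conjTranspose, inv_inv] at h
  rw [← h]
  exact congrArg (· * Tᴴ) (by
    have := outerRep_conjTranspose α g⁻¹
    rw [inv_inv] at this
    exact this.symm)

/-- Check one vertex at a time: vertices strictly in r act trivially on the ranges of T and T',
vertices strictly outside act trivially on H_r, and at the cut the intertwining relation moves the
action across. -/
lemma IsIntertwiner.mul_conjTranspose_mem {T T' : Matrix (Conf M.Loc r) (∀ v, Fin (α v).dim) ℂ}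
    (hT : M.IsIntertwiner r α T) (hT' : M.IsIntertwiner r α T') :
    T * T'ᴴ ∈ M.commutant r := by
  rw [mem_commutant_iff_gaugeAtOn]
  intro v g
  by_cases h1 : v ∈ M.interior r
  · have e1 : ∀ {S : Matrix (Conf M.Loc r) (∀ v, Fin (α v).dim) ℂ}, M.IsIntertwiner r α S →
        ∀ g, M.gaugeAtOn r v g * S = S := by
      intro S hS g
      rw [← hS.1, ← Matrix.mul_assoc, M.gaugeAtOn_mul_partialProj h1]
    have e2 := congrArg Matrix.conjTranspose (e1 hT' g⁻¹)
    rw [Matrix.conjTranspose_mul, gaugeAtOn_inv, inv_inv] at e2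
    rw [Commute, SemiconjBy, ← Matrix.mul_assoc, e1 hT, Matrix.mul_assoc, e2]
  by_cases h2 : v ∈ M.interior rᶜ
  · rw [M.gaugeAtOn_of_mem_interior_compl h2]
    exact Commute.one_left _
  have hv := M.mem_cut_of_notMem h1 h2
  rw [← M.cutGauge_mulSingle ⟨v, hv⟩, Commute, SemiconjBy, ← Matrix.mul_assoc, ← hT.2,
    Matrix.mul_assoc, hT'.conjTranspose_mul, Matrix.mul_assoc]

lemma IsIntertwiner.conjTranspose_mul_self {T : Matrix (Conf M.Loc r) (∀ v, Fin (α v).dim) ℂ}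
    (hT : M.IsIntertwiner r α T) : ∃ c : ℂ, Tᴴ * T = c • 1 := by
  refine outerRep_eq_smul_one_of_commutes (α := α) fun g => ?_
  change M.cutRep r α g * _ = _ * M.cutRep r α g
  rw [← Matrix.mul_assoc, hT.conjTranspose_mul, Matrix.mul_assoc, Matrix.mul_assoc, hT.2]

lemma IsIntertwiner.conjTranspose_mul_eq_zero {β : M.CutIrrep r} (hαβ : α ≠ β)
    {T : Matrix (Conf M.Loc r) (∀ v, Fin (α v).dim) ℂ} (hT : M.IsIntertwiner r α T)
    {T' : Matrix (Conf M.Loc r) (∀ v, Fin (β v).dim) ℂ} (hT' : M.IsIntertwiner r β T') :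
    T'ᴴ * T = 0 := by
  refine outerRep_eq_zero_of_intertwines hαβ fun g => ?_
  change M.cutRep r β g * _ = _ * M.cutRep r α g
  rw [← Matrix.mul_assoc, hT'.conjTranspose_mul, Matrix.mul_assoc, Matrix.mul_assoc, hT.2]

end GaugeModel

end GaugedRTN

end

noncomputable section

namespace GaugedRTN

/-! ### Orthogonal projections as matrices -/

section ProjMatrix

variable {n : Type*} [Fintype n] [DecidableEq n] (W : Submodule ℂ (EuclideanSpace ℂ n))

lemma toLp_projMatrix_mulVec (x : n → ℂ) :
    WithLp.toLp 2 (projMatrix W *ᵥ x) = W.starProjection (WithLp.toLp 2 x) := by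
  rw [← Matrix.toEuclideanCLM_toLp, projMatrix, StarAlgEquiv.apply_symm_apply]

lemma isStarProjection_projMatrix : IsStarProjection (projMatrix W) := by
  have h : IsStarProjection W.starProjection := isStarProjection_starProjection
  constructor
  · rw [IsIdempotentElem, projMatrix, ← map_mul, h.1.eq]
  · have := (Matrix.toEuclideanCLM (n := n) (𝕜 := ℂ)).symm.map_star' W.starProjection
    rw [h.2.star_eq] at this
    exact this.symm

variable {W}

lemma projMatrix_mul_of_forall_mem {m : Type*} [Fintype m] [DecidableEq m] {T : Matrix n m ℂ}
    (h : ∀ x, WithLp.toLp 2 (T *ᵥ x) ∈ W) : projMatrix W * T = T := by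
  refine Matrix.ext_of_mulVec_single fun i => ?_
  rw [← Matrix.mulVec_mulVec]
  refine WithLp.toLp_injective 2 ?_
  rw [toLp_projMatrix_mulVec, Submodule.starProjection_eq_self_iff]
  exact h _

lemma mul_projMatrix_eq_zero {m : Type*} {K : Matrix m n ℂ}
    (h : ∀ x ∈ W, K *ᵥ x.ofLp = 0) : K * projMatrix W = 0 := by
  refine Matrix.ext_of_mulVec_single fun i => ?_
  rw [← Matrix.mulVec_mulVec, Matrix.zero_mulVec]
  have := toLp_projMatrix_mulVec W (Pi.single i 1)
  exact h (WithLp.toLp 2 (projMatrix W *ᵥ Pi.single i 1))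
    (this ▸ Submodule.starProjection_apply_mem _ _)

end ProjMatrix

/-! ### Commuting products that do not annihilate a vector -/

section CommutingProducts

variable {κ Y n : Type*} [Fintype n] [DecidableEq n]

lemma exists_noncommProd_mulVec_ne_zero [DecidableEq κ] {f : κ → Y → Matrix n n ℂ}
    (hcomm : ∀ v w, v ≠ w → ∀ y y', Commute (f v y) (f w y'))
    (hne : ∀ v, ∀ u : n → ℂ, u ≠ 0 → ∃ y, f v y *ᵥ u ≠ 0) {u : n → ℂ} (hu : u ≠ 0)
    (s : Finset κ) :
    ∃ c : κ → Y, ∀ comm, s.noncommProd (fun v => f v (c v)) comm *ᵥ u ≠ 0 := by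
  induction s using Finset.induction_on with
  | empty =>
    choose y _ using fun v => hne v u hu
    exact ⟨y, fun comm => by simpa using hu⟩
  | insert a s ha ih =>
    obtain ⟨c, hc⟩ := ih
    obtain ⟨y, hy⟩ := hne a _ (hc fun _ _ _ _ h => hcomm _ _ h _ _)
    refine ⟨Function.update c a y, fun comm => ?_⟩
    rw [Finset.noncommProd_insert_of_notMem s a _ _ ha, ← Matrix.mulVec_mulVec,
      Function.update_self]
    rw [Finset.noncommProd_congr rfl (g := fun v => f v (c v))]
    · exact hy
    · intro v hv
      rw [Function.update_of_ne]
      rintro rfl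
      exact ha hv

end CommutingProducts

lemma outerRep_one {κ G : Type*} [Fintype κ] [DecidableEq κ] [Group G] [TopologicalSpace G]
    (α : κ → Irrep G) : outerRep α 1 = 1 := by
  ext x y
  simp only [outerRep, tensorOp, Pi.one_apply, Irrep.D_one, Matrix.one_apply, Finset.prod_ite_zero,
    Finset.prod_const_one, Finset.mem_univ, true_implies, funext_iff]

namespace GaugeModel

variable {G : Type*} [Group G] [TopologicalSpace G] {V E : Type*} {M : GaugeModel G V E}
  [Fintype V] [DecidableEq V] [Fintype E] [DecidableEq E] {r : Finset (V ⊕ E)}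
  [IsTopologicalGroup G] [CompactSpace G] [MeasurableSpace G] [BorelSpace G]

/-! ### Completeness of the sectors -/

lemma commute_matCoeff_gaugeAtOn {v w : V} (hvw : v ≠ w) (α β : Irrep G) (i j : Fin α.dim)
    (k l : Fin β.dim) :
    Commute (matCoeff (M.gaugeAtOn r v) α i j) (matCoeff (M.gaugeAtOn r w) β k l) :=
  intertwines_matCoeff (M.continuous_gaugeAtOn r w) (M.continuous_gaugeAtOn r w) (fun g =>
    (intertwines_matCoeff (M.continuous_gaugeAtOn r v) (M.continuous_gaugeAtOn r v)
      (fun h => (M.commute_gaugeAtOn r hvw h g).symm.eq) α i j).symm) β k l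

variable (M r) in
/-- The product of matrix coefficients of the gauge transformations at the cut vertices. -/
def cutCoeff (α : M.CutIrrep r) (J I : ∀ v, Fin (α v).dim) :
    Matrix (Conf M.Loc r) (Conf M.Loc r) ℂ :=
  Finset.univ.noncommProd (fun v : M.cut r => matCoeff (M.gaugeAtOn r v) (α v) (I v) (J v))
    fun _ _ _ _ h => commute_matCoeff_gaugeAtOn (fun h' => h (Subtype.ext h')) _ _ _ _ _ _

lemma gaugeAtOn_mul_cutCoeff (α : M.CutIrrep r) (J I : ∀ v, Fin (α v).dim) (v : M.cut r) (g : G) :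
    M.gaugeAtOn r v g * M.cutCoeff r α J I =
      ∑ k, (α v).D g k (I v) • M.cutCoeff r α J (Function.update I v k) := by
  have h : ∀ I : ∀ v, Fin (α v).dim, M.cutCoeff r α J I =
      matCoeff (M.gaugeAtOn r v) (α v) (I v) (J v) * (Finset.univ.erase v).noncommProd
        (fun v : M.cut r => matCoeff (M.gaugeAtOn r v) (α v) (I v) (J v))
        (fun _ _ _ _ h => commute_matCoeff_gaugeAtOn (fun h' => h (Subtype.ext h')) _ _ _ _ _ _) :=
    fun I => (Finset.mul_noncommProd_erase Finset.univ (Finset.mem_univ v) _ _).symm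
  have h2 : ∀ k, (Finset.univ.erase v).noncommProd
        (fun w : M.cut r => matCoeff (M.gaugeAtOn r w) (α w) (Function.update I v k w) (J w))
        (fun _ _ _ _ h => commute_matCoeff_gaugeAtOn (fun h' => h (Subtype.ext h')) _ _ _ _ _ _) =
      (Finset.univ.erase v).noncommProd
        (fun w : M.cut r => matCoeff (M.gaugeAtOn r w) (α w) (I w) (J w))
        (fun _ _ _ _ h => commute_matCoeff_gaugeAtOn (fun h' => h (Subtype.ext h')) _ _ _ _ _ _) :=
    fun k => Finset.noncommProd_congr rfl (fun w hw => by
      rw [Function.update_of_ne (Finset.ne_of_mem_erase hw)]) _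
  simp only [h I, h (Function.update I v _), h2, Function.update_self]
  rw [← Matrix.mul_assoc, mul_matCoeff (M.continuous_gaugeAtOn r v) (M.gaugeAtOn_mul r v),
    Finset.sum_mul]
  simp only [Matrix.smul_mul]

lemma commute_cutCoeff {O : Matrix (Conf M.Loc r) (Conf M.Loc r) ℂ} (hO : O ∈ M.commutant r)
    (α : M.CutIrrep r) (J I : ∀ v, Fin (α v).dim) : Commute O (M.cutCoeff r α J I) :=
  Finset.noncommProd_commute _ _ _ _ fun v _ =>
    intertwines_matCoeff (M.continuous_gaugeAtOn r v) (M.continuous_gaugeAtOn r v)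
      (fun g => (M.mem_commutant_iff_gaugeAtOn.mp hO v g).symm.eq) _ _ _

/-- With J and u fixed, the columns indexed by I transform like the basis of α, one cut vertex at a
time. -/
lemma isIntertwiner_cutCoeff (α : M.CutIrrep r) (J : ∀ v, Fin (α v).dim) {u : Conf M.Loc r → ℂ}
    (hu : M.partialProj r *ᵥ u = u) :
    M.IsIntertwiner r α (Matrix.of fun x I => (M.cutCoeff r α J I *ᵥ u) x) := by
  constructor
  · ext x I
    change (M.partialProj r *ᵥ (M.cutCoeff r α J I *ᵥ u)) x = (M.cutCoeff r α J I *ᵥ u) x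
    rw [Matrix.mulVec_mulVec, (commute_cutCoeff M.partialProj_mem_commutant α J I).eq,
      ← Matrix.mulVec_mulVec, hu]
  · refine pi_mulSingle_induction ?_ (fun g h hg hh => ?_) fun v g => ?_
    · rw [cutGauge_one, show M.cutRep r α 1 = 1 from outerRep_one α, Matrix.mul_one,
        Matrix.one_mul]
    · rw [cutGauge_mul, show M.cutRep r α (g * h) = M.cutRep r α g * M.cutRep r α h from
        outerRep_mul α g h, ← Matrix.mul_assoc, hg, Matrix.mul_assoc, hh, Matrix.mul_assoc]
    · rw [cutGauge_mulSingle]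
      ext x I
      have e1 := mul_outerRep_mulSingle_apply α v g
        (Matrix.of fun x I => (M.cutCoeff r α J I *ᵥ u) x) I x
      refine e1.trans ?_
      change _ = (M.gaugeAtOn r v g *ᵥ (M.cutCoeff r α J I *ᵥ u)) x
      rw [Matrix.mulVec_mulVec, gaugeAtOn_mul_cutCoeff, Matrix.sum_mulVec, Finset.sum_apply]
      refine Finset.sum_congr rfl fun k _ => ?_
      rw [Matrix.smul_mulVec, Pi.smul_apply, smul_eq_mul, mul_comm]
      rfl

/-- Choose a nonvanishing coefficient at each cut vertex in turn. The last clause holds because the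
columns arise from u by operators commuting with the commutant; it keeps T in any subspace singled
out by a projection of the commutant that fixes u. -/
lemma exists_isIntertwiner {u : Conf M.Loc r → ℂ} (hu : M.partialProj r *ᵥ u = u) (hu0 : u ≠ 0) :
    ∃ (α : M.CutIrrep r) (T : Matrix (Conf M.Loc r) (∀ v, Fin (α v).dim) ℂ),
      M.IsIntertwiner r α T ∧ T ≠ 0 ∧ ∀ O ∈ M.commutant r, O *ᵥ u = u → O * T = T := by
  obtain ⟨c, hc⟩ := exists_noncommProd_mulVec_ne_zero (κ := M.cut r)
    (Y := Σ α : Irrep G, Fin α.dim × Fin α.dim)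
    (f := fun v y => matCoeff (M.gaugeAtOn r v) y.1 y.2.1 y.2.2)
    (fun v w h y y' => commute_matCoeff_gaugeAtOn (fun h' => h (Subtype.ext h')) _ _ _ _ _ _)
    (fun v u hu => by
      obtain ⟨α, i, j, h⟩ := exists_matCoeff_mulVec_ne_zero (M.continuous_gaugeAtOn r v)
        (M.gaugeAtOn_one r v) (M.gaugeAtOn_mul r v) (M.gaugeAtOn_inv r v) hu
      exact ⟨⟨α, i, j⟩, h⟩) hu0 Finset.univ
  let α : M.CutIrrep r := fun v => (c v).1
  refine ⟨α, _, isIntertwiner_cutCoeff α (fun v => (c v).2.2) hu, fun h0 => hc (fun _ _ _ _ h =>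
    commute_matCoeff_gaugeAtOn (fun h' => h (Subtype.ext h')) _ _ _ _ _ _) ?_,
    fun O hO hOu => ?_⟩
  · ext x
    exact congrFun (congrFun h0 x) (fun v => (c v).2.1)
  · ext x I
    change (O *ᵥ (M.cutCoeff r α _ I *ᵥ u)) x = (M.cutCoeff r α _ I *ᵥ u) x
    rw [Matrix.mulVec_mulVec, (commute_cutCoeff hO α _ I).eq, ← Matrix.mulVec_mulVec, hOu]

/-! ### The sector projections -/

variable (M r) in
/-- The projection onto the `α`-isotypic subspace of the partially gauged space. -/
def isoProj (α : M.CutIrrep r) : Matrix (Conf M.Loc r) (Conf M.Loc r) ℂ :=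
  projMatrix (M.sectorSpace r α)

variable {α β : M.CutIrrep r}

lemma isoProj_isStarProjection : IsStarProjection (M.isoProj r α) :=
  isStarProjection_projMatrix _

lemma isoProj_conjTranspose : (M.isoProj r α)ᴴ = M.isoProj r α := isoProj_isStarProjection.2

lemma IsIntertwiner.isoProj_mul {T : Matrix (Conf M.Loc r) (∀ v, Fin (α v).dim) ℂ}
    (hT : M.IsIntertwiner r α T) : M.isoProj r α * T = T := by
  refine projMatrix_mul_of_forall_mem fun x => ?_
  refine Submodule.mem_iSup_of_mem (Matrix.toEuclideanLin T)
    (Submodule.mem_iSup_of_mem ⟨?_, fun g => ?_⟩ ⟨WithLp.toLp 2 x, rfl⟩)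
  · rintro _ ⟨y, rfl⟩
    refine ⟨Matrix.toEuclideanLin T y, ?_⟩
    rw [← LinearMap.comp_apply, ← Matrix.toLpLin_mul_same, hT.1]
  · rw [← Matrix.toLpLin_mul_same, ← Matrix.toLpLin_mul_same, hT.2]

/-- The isotypic subspace is spanned by ranges of intertwiners, so identities on it may be tested on
intertwiners. -/
lemma mul_isoProj_eq_zero {m : Type*} {K : Matrix m (Conf M.Loc r) ℂ}
    (h : ∀ T, M.IsIntertwiner r α T → K * T = 0) : K * M.isoProj r α = 0 := by
  refine mul_projMatrix_eq_zero fun x hx => ?_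
  have hle : M.sectorSpace r α ≤ LinearMap.ker
      (Matrix.mulVecLin K ∘ₗ (WithLp.linearEquiv 2 ℂ (Conf M.Loc r → ℂ)).toLinearMap) := by
    refine iSup₂_le ?_
    rintro S ⟨hS1, hS2⟩ _ ⟨y, rfl⟩
    obtain ⟨T, rfl⟩ := Matrix.toEuclideanLin.surjective S
    have hT : M.IsIntertwiner r α T := by
      constructor
      · apply Matrix.toEuclideanLin.injective
        rw [Matrix.toLpLin_mul_same]
        ext1 y
        obtain ⟨w, hw⟩ := hS1 ⟨y, rfl⟩
        rw [LinearMap.comp_apply, ← hw, ← LinearMap.comp_apply, ← Matrix.toLpLin_mul_same,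
          M.partialProj_mul_self]
      · intro g
        apply Matrix.toEuclideanLin.injective
        rw [Matrix.toLpLin_mul_same, Matrix.toLpLin_mul_same]
        exact hS2 g
    change K *ᵥ (T *ᵥ y.ofLp) = 0
    rw [Matrix.mulVec_mulVec, h T hT, Matrix.zero_mulVec]
  exact hle hx

/-- Invariance of the range under both O and Oᴴ. -/
lemma commute_of_isoProj_mul {O : Matrix (Conf M.Loc r) (Conf M.Loc r) ℂ}
    (h1 : M.isoProj r α * (O * M.isoProj r α) = O * M.isoProj r α)
    (h2 : M.isoProj r α * (Oᴴ * M.isoProj r α) = Oᴴ * M.isoProj r α) :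
    Commute (M.isoProj r α) O := by
  have h3 := congrArg Matrix.conjTranspose h2
  simp only [Matrix.conjTranspose_mul, Matrix.conjTranspose_conjTranspose,
    isoProj_conjTranspose] at h3
  rw [Commute, SemiconjBy, ← h1, ← Matrix.mul_assoc, h3]

lemma isoProj_mul_mul_isoProj {O : Matrix (Conf M.Loc r) (Conf M.Loc r) ℂ}
    (h : ∀ T, M.IsIntertwiner r α T → M.isoProj r α * (O * T) = O * T) :
    M.isoProj r α * (O * M.isoProj r α) = O * M.isoProj r α := by
  have := mul_isoProj_eq_zero (α := α) (K := M.isoProj r α * O - O) fun T hT => by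
    rw [Matrix.sub_mul, Matrix.mul_assoc, h T hT, sub_self]
  rwa [sub_mul, Matrix.mul_assoc, sub_eq_zero] at this

lemma commute_isoProj {O : Matrix (Conf M.Loc r) (Conf M.Loc r) ℂ} (hO : O ∈ M.commutant r) :
    Commute (M.isoProj r α) O :=
  commute_of_isoProj_mul
    (isoProj_mul_mul_isoProj fun _ hT => (hT.mul_left hO).isoProj_mul)
    (isoProj_mul_mul_isoProj fun _ hT => (hT.mul_left (star_mem hO)).isoProj_mul)

lemma IsIntertwiner.isoProj_mul_gaugeAtOn {T : Matrix (Conf M.Loc r) (∀ v, Fin (α v).dim) ℂ}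
    (hT : M.IsIntertwiner r α T) (v : V) (g : G) :
    M.isoProj r α * (M.gaugeAtOn r v g * T) = M.gaugeAtOn r v g * T := by
  by_cases h1 : v ∈ M.interior r
  · rw [← hT.1, ← Matrix.mul_assoc (M.gaugeAtOn r v g), M.gaugeAtOn_mul_partialProj h1, hT.1,
      hT.isoProj_mul]
  by_cases h2 : v ∈ M.interior rᶜ
  · rw [M.gaugeAtOn_of_mem_interior_compl h2, Matrix.one_mul, hT.isoProj_mul]
  have hv := M.mem_cut_of_notMem h1 h2
  rw [← M.cutGauge_mulSingle ⟨v, hv⟩, ← hT.2, ← Matrix.mul_assoc, hT.isoProj_mul]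

lemma isoProj_mem_commutant : M.isoProj r α ∈ M.commutant r :=
  M.mem_commutant_iff_gaugeAtOn.mpr fun v g => (commute_of_isoProj_mul
    (isoProj_mul_mul_isoProj fun _ hT => hT.isoProj_mul_gaugeAtOn v g)
    (isoProj_mul_mul_isoProj fun _ hT => by
      rw [gaugeAtOn_inv]; exact hT.isoProj_mul_gaugeAtOn v g⁻¹)).symm

lemma isoProj_orthogonal (h : α ≠ β) : M.isoProj r α * M.isoProj r β = 0 := by
  refine mul_isoProj_eq_zero fun T' hT' => ?_
  have h1 : T'ᴴ * M.isoProj r α = 0 := mul_isoProj_eq_zero fun T hT =>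
    hT.conjTranspose_mul_eq_zero h hT'
  have h2 := congrArg Matrix.conjTranspose h1
  rwa [Matrix.conjTranspose_mul, Matrix.conjTranspose_conjTranspose, isoProj_conjTranspose,
    Matrix.conjTranspose_zero] at h2

variable (M r) in
-- Nonzero mutually orthogonal projections are linearly independent in a finite-dimensional matrix
-- space.
lemma finite_isoProj_ne_zero : {α : M.CutIrrep r | M.isoProj r α ≠ 0}.Finite := by
  have hli : LinearIndependent ℂ
      (fun α : {α : M.CutIrrep r | M.isoProj r α ≠ 0} => M.isoProj r α.1) := by
    rw [linearIndependent_iff']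
    intro s c hc β hβ
    have h1 := congrArg (· * M.isoProj r β.1) hc
    simp only [Finset.sum_mul, Matrix.smul_mul, Matrix.zero_mul] at h1
    rw [Finset.sum_eq_single β (fun γ _ hγ => by
      rw [isoProj_orthogonal fun h => hγ (Subtype.ext h), smul_zero]) (fun h => absurd hβ h),
      isoProj_isStarProjection.1.eq] at h1
    exact (smul_eq_zero.mp h1).resolve_right β.2
  have : Finite {α : M.CutIrrep r | M.isoProj r α ≠ 0} := hli.finite
  exact Set.toFinite _

/-- Otherwise some nonzero u is fixed by both `partialProj` and 1 - P. The nonzero intertwiner T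
built from u then satisfies (1 - P)T = T, whereas PT = T for every intertwiner. -/
lemma sum_isoProj_mul_partialProj :
    (∑ α ∈ (M.finite_isoProj_ne_zero r).toFinset, M.isoProj r α) * M.partialProj r =
      M.partialProj r := by
  set P := ∑ α ∈ (M.finite_isoProj_ne_zero r).toFinset, M.isoProj r α with hP
  have hPmem : P ∈ M.commutant r := sum_mem fun _ _ => isoProj_mem_commutant
  have hPP : ∀ α, P * M.isoProj r α = M.isoProj r α := by
    intro α
    rw [hP, Finset.sum_mul]
    by_cases hα : M.isoProj r α = 0
    · simp [hα]
    rw [Finset.sum_eq_single α (fun γ _ hγ => isoProj_orthogonal hγ)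
      (fun h => absurd (by simpa using hα) h), isoProj_isStarProjection.1.eq]
  by_contra hne
  obtain ⟨x, hx⟩ : ∃ x, (M.partialProj r - P * M.partialProj r) *ᵥ x ≠ 0 := by
    by_contra! h
    refine hne (sub_eq_zero.mp ?_).symm
    exact Matrix.ext_of_mulVec_single fun i => by rw [h, Matrix.zero_mulVec]
  have hcomm := (M.commute_partialProj hPmem).eq
  have hPP2 : P * P = P := by
    conv_lhs => enter [2]; rw [hP]
    rw [Finset.mul_sum]
    exact (Finset.sum_congr rfl fun α _ => hPP α).trans hP.symm
  have hfix1 : M.partialProj r * (M.partialProj r - P * M.partialProj r) =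
      M.partialProj r - P * M.partialProj r := by
    rw [mul_sub, ← Matrix.mul_assoc, ← hcomm, Matrix.mul_assoc, M.partialProj_mul_self]
  have hfix2 : (1 - P) * (M.partialProj r - P * M.partialProj r) =
      M.partialProj r - P * M.partialProj r := by
    rw [sub_mul, one_mul, mul_sub, ← Matrix.mul_assoc, hPP2, sub_self, sub_zero]
  obtain ⟨α, T, hT, hT0, hfix⟩ := exists_isIntertwiner
    (by rw [Matrix.mulVec_mulVec, hfix1]) hx
  have h1 := hfix (1 - P) (sub_mem (one_mem _) hPmem) (by rw [Matrix.mulVec_mulVec, hfix2])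
  refine hT0 ?_
  rw [← h1, Matrix.sub_mul, Matrix.one_mul]
  nth_rw 2 [← hT.isoProj_mul]
  rw [← Matrix.mul_assoc, hPP, hT.isoProj_mul, sub_self]

lemma partialProj_mul_partialTrace_projGI :
    M.partialProj r * partialTrace r M.projGI = partialTrace r M.projGI := by
  refine M.partialProj_mul_eq_self fun v hv g => ?_
  rw [← partialTrace_extendOp_mul, ← M.gaugeAt_of_mem_interior hv]
  exact congrArg _ (M.gauge_mul_projGI _)

lemma cutDim_pos : 0 < M.cutDim r α := Finset.prod_pos fun v _ => (α v).dim_pos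

/-- Some intertwiner T has range inside that of q. By Schur's lemma TᴴT = c, so TTᴴ/c is a
projection of the commutant under q, hence equal to q, and its trace is that of the identity on α.
-/
lemma trace_eq_cutDim {q : Matrix (Conf M.Loc r) (Conf M.Loc r) ℂ} (hq : q ∈ M.commutant r)
    (hqp : IsStarProjection q) (hq0 : q ≠ 0)
    (hmin : ∀ q' ∈ M.commutant r, IsStarProjection q' → q * q' = q' → q' = 0 ∨ q' = q)
    (hPq : M.isoProj r α * q = q) : q.trace = M.cutDim r α := by
  obtain ⟨S, hS, hS0⟩ : ∃ S, M.IsIntertwiner r α S ∧ q * S ≠ 0 := by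
    by_contra! h
    have h0 := mul_isoProj_eq_zero h
    rw [← (commute_isoProj hq).eq, hPq] at h0
    exact hq0 h0
  have hT := hS.mul_left hq
  have hqT : q * (q * S) = q * S := by rw [← Matrix.mul_assoc, hqp.1.eq]
  generalize q * S = T at hT hqT hS0
  obtain ⟨c, hc⟩ := hT.conjTranspose_mul_self
  have hne : Nonempty (∀ v, Fin (α v).dim) := ⟨fun v => ⟨0, (α v).dim_pos⟩⟩
  have hc0 : c ≠ 0 := by
    rintro rfl
    rw [zero_smul] at hc
    exact hS0 (Matrix.conjTranspose_mul_self_eq_zero.mp hc)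
  have hcs : star c = c := by
    have h1 := congrArg Matrix.conjTranspose hc
    rw [Matrix.conjTranspose_mul, Matrix.conjTranspose_conjTranspose, hc,
      Matrix.conjTranspose_smul, Matrix.conjTranspose_one] at h1
    have h2 := congrFun (congrFun h1 hne.some) hne.some
    simpa using h2.symm
  have hTT : T * Tᴴ * (T * Tᴴ) = c • (T * Tᴴ) := by
    rw [Matrix.mul_assoc, ← Matrix.mul_assoc Tᴴ, hc, Matrix.smul_mul, Matrix.one_mul,
      Matrix.mul_smul]
  have hproj : IsStarProjection (c⁻¹ • (T * Tᴴ)) := by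
    constructor
    · rw [IsIdempotentElem, smul_mul_smul_comm, hTT, smul_smul, mul_assoc, inv_mul_cancel₀ hc0,
        mul_one]
    · rw [IsSelfAdjoint, star_smul, star_inv₀, hcs, Matrix.star_eq_conjTranspose,
        Matrix.conjTranspose_mul, Matrix.conjTranspose_conjTranspose]
  have htr : (c⁻¹ • (T * Tᴴ)).trace = M.cutDim r α := by
    rw [Matrix.trace_smul, Matrix.trace_mul_comm, hc, Matrix.trace_smul, Matrix.trace_one,
      smul_smul, inv_mul_cancel₀ hc0, one_smul, Fintype.card_pi]
    simp [cutDim]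
  rcases hmin _ ((M.commutant r).smul_mem (hT.mul_conjTranspose_mem hT) _) hproj
    (by rw [Matrix.mul_smul, ← Matrix.mul_assoc, hqT]) with h | h
  · rw [h, Matrix.trace_zero] at htr
    exact absurd htr.symm (Nat.cast_ne_zero.mpr cutDim_pos.ne')
  · rw [← h, htr]

variable (M r) in
/-- The superselection sectors of the gauge-invariant algebra on `r`. -/
def sectorData : SectorData M.projGI r (M.CutIrrep r) where
  isProj := ⟨M.projGI_mul_self, M.projGI_conjTranspose⟩
  C := M.commutant r
  commute_proj _ hO := M.commute_projGI_of_mem_commutant hO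
  partialTrace_mem _ h1 h2 := M.partialTrace_mem_commutant h1 h2
  sectors := (M.finite_isoProj_ne_zero r).toFinset
  P := M.isoProj r
  P_mem _ := isoProj_mem_commutant
  P_isProj _ := isoProj_isStarProjection
  P_comm _ _ hO := commute_isoProj hO
  P_orth _ _ h := isoProj_orthogonal h
  P_sum := by
    conv_lhs => rw [← partialProj_mul_partialTrace_projGI, ← Matrix.mul_assoc,
      sum_isoProj_mul_partialProj, partialProj_mul_partialTrace_projGI]
  d := M.cutDim r
  d_pos _ := cutDim_pos
  trace_minimal _ _ hq hqp hq0 hmin hPq := trace_eq_cutDim hq hqp hq0 hmin hPq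

end GaugeModel

end GaugedRTN

end

/-! ### Sector projections on the full space and the main theorem -/

namespace GaugedRTN

noncomputable section

namespace GaugeModel

variable {G : Type*} [Group G] [TopologicalSpace G] {V E : Type*} (M : GaugeModel G V E)
  [Fintype V] [DecidableEq V] [Fintype E] [DecidableEq E] (r : Finset (V ⊕ E))
  [IsTopologicalGroup G] [CompactSpace G] [MeasurableSpace G] [BorelSpace G]

lemma mem_gaugeInvariantAlgebra (a : Matrix M.Config M.Config ℂ) :
    a ∈ M.gaugeInvariantAlgebra r ↔ ∃ O : Matrix (Conf M.Loc r) (Conf M.Loc r) ℂ,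
      Commute (extendOp O) M.projGI ∧ a = extendOp O * M.projGI :=
  Iff.rfl

lemma isoProj_ne_zero_of_sectorProj {α : M.CutIrrep r} (h : M.sectorProj r α ≠ 0) :
    α ∈ (M.sectorData r).sectors := by
  refine (M.finite_isoProj_ne_zero r).mem_toFinset.mpr fun h0 => h ?_
  change extendOp (M.isoProj r α) * M.projGI = 0
  rw [h0, extendOp_zero, Matrix.zero_mul]

/-- There may be infinitely many irreps, but only the finitely many with `isoProj` nonzero
contribute. -/
lemma finsum_smul_sectorProj (c : M.CutIrrep r → ℂ) :
    ∑ᶠ α, c α • M.sectorProj r α = extendOp ((M.sectorData r).central c) * M.projGI := by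
  rw [finsum_eq_sum_of_support_subset (s := (M.sectorData r).sectors)]
  · rw [SectorData.central, ← extendHom_apply, map_sum, Finset.sum_mul]
    refine Finset.sum_congr rfl fun α _ => ?_
    rw [map_smul, Matrix.smul_mul]
    rfl
  · intro α hα
    exact M.isoProj_ne_zero_of_sectorProj r fun h =>
      hα ((congrArg (c α • ·) h).trans (smul_zero _))

lemma finsum_sectorProj : ∑ᶠ α, M.sectorProj r α = M.projGI := by
  have h := M.finsum_smul_sectorProj r fun _ => 1
  simp only [one_smul] at h
  have hz := (M.sectorData r).extendOp_z_mul_proj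
  have hc : (M.sectorData r).central (fun _ => 1) * (M.sectorData r).z = (M.sectorData r).z := by
    simp only [SectorData.central, one_smul, (M.sectorData r).sum_P_mul_z]
  rw [h]
  calc extendOp ((M.sectorData r).central fun _ => 1) * M.projGI
      = extendOp ((M.sectorData r).central fun _ => 1) *
          (extendOp (M.sectorData r).z * M.projGI) := by rw [hz]
    _ = M.projGI := by rw [← Matrix.mul_assoc, ← extendOp_mul, hc, hz]

lemma finite_sectorProj_ne_zero : {α | M.sectorProj r α ≠ 0}.Finite :=
  (Finset.finite_toSet _).subset fun _ hα => M.isoProj_ne_zero_of_sectorProj r hα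

lemma log_cutDim (α : M.CutIrrep r) :
    Real.log (M.cutDim r α) = ∑ v, Real.log (α v).dim := by
  rw [cutDim, Nat.cast_prod, Real.log_prod fun v _ =>
    Nat.cast_ne_zero.mpr (α v).dim_pos.ne']

end GaugeModel

end

end GaugedRTN

theorem mainTheorem1 {G : Type*} [Group G] [TopologicalSpace G] [IsTopologicalGroup G]
    [CompactSpace G] [T2Space G] [MeasurableSpace G] [BorelSpace G]
    {V E : Type*} [Fintype V] [DecidableEq V] [Fintype E] [DecidableEq E]
    (M : GaugeModel G V E) (r : Finset (V ⊕ E))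
    (ρ : Matrix M.Config M.Config ℂ) (hρ : ρ.PosSemidef) (hρ_tr : ρ.trace = 1)
    (hρ_GI : M.projGI * ρ * M.projGI = ρ) :
    ∃ (τ : M.gaugeInvariantAlgebra r →ₗ[ℂ] ℂ) (σ Δ : M.gaugeInvariantAlgebra r),
      -- the normalized trace exists and is unique
      (IsNormalizedTrace (M.gaugeInvariantAlgebra r) τ ∧
        ∀ τ', IsNormalizedTrace (M.gaugeInvariantAlgebra r) τ' → τ' = τ) ∧
      -- the reduced state exists, is unique and is a density operator
      (IsReducedState τ ρ σ ∧ ∀ σ', IsReducedState τ ρ σ' → σ' = σ) ∧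
      (σ : Matrix M.Config M.Config ℂ).PosSemidef ∧ τ σ = 1 ∧
      -- the sector projections are central and decompose the gauge-invariant Hilbert space
      (∀ α, IsStarProjection (M.sectorProj r α)) ∧
      (∀ α β, α ≠ β → M.sectorProj r α * M.sectorProj r β = 0) ∧
      {α | M.sectorProj r α ≠ 0}.Finite ∧ ∑ᶠ α, M.sectorProj r α = M.projGI ∧
      (∀ α, ∃ p : M.gaugeInvariantAlgebra r, (p : Matrix M.Config M.Config ℂ) = M.sectorProj r α ∧
        p ∈ Set.center (M.gaugeInvariantAlgebra r)) ∧
      -- the extra area operator is central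
      (Δ : Matrix M.Config M.Config ℂ) = M.extraArea r ∧
      Δ ∈ Set.center (M.gaugeInvariantAlgebra r) ∧
      -- the relation between the entropies
      (vnEntropy (partialTrace r ρ) : ℂ) = (algEntropy τ σ : ℂ) + τ (σ * Δ) ∧
      -- the FLM formula for any tensor network fed with `ρ`, exactly or up to an error `ε`
      ∀ (N L B : Type*) [Fintype N] [DecidableEq N] [Fintype L] [DecidableEq L] [Fintype B]
        [DecidableEq B] (T : TensorNetwork M.Loc N L B) (R : Finset B) (a : Finset N),
        T.IsEntanglementWedge R a → T.bulkRegion a = r → T.bdryOp ρ ≠ 0 →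
        ∃ Ar : M.gaugeInvariantAlgebra r,
          (Ar : Matrix M.Config M.Config ℂ) =
            ((T.area a * Real.log T.bond : ℝ) : ℂ) • M.projGI +
              ∑ᶠ α : M.CutIrrep r, ((∑ v, Real.log (α v).dim : ℝ) : ℂ) • M.sectorProj r α ∧
          (Ar : Matrix M.Config M.Config ℂ) =
            ((T.area a * Real.log T.bond : ℝ) : ℂ) • M.projGI + M.extraArea r ∧
          Ar ∈ Set.center (M.gaugeInvariantAlgebra r) ∧
          ((T.area a * Real.log T.bond + vnEntropy (partialTrace r ρ) : ℝ) : ℂ) =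
            τ (σ * Ar) + (algEntropy τ σ : ℂ) ∧
          (T.bdryEntropy ρ R = T.area a * Real.log T.bond + vnEntropy (partialTrace r ρ) →
            (T.bdryEntropy ρ R : ℂ) = τ (σ * Ar) + (algEntropy τ σ : ℂ)) ∧
          ∀ ε : ℝ, |T.bdryEntropy ρ R -
              (T.area a * Real.log T.bond + vnEntropy (partialTrace r ρ))| ≤ ε →
            ‖(T.bdryEntropy ρ R : ℂ) - (τ (σ * Ar) + (algEntropy τ σ : ℂ))‖ ≤ ε := by
  have h1 : M.projGI * ρ = ρ := by
    conv_lhs => rw [← hρ_GI, ← Matrix.mul_assoc, ← Matrix.mul_assoc, M.projGI_mul_self]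
    exact hρ_GI
  have h2 : ρ * M.projGI = ρ := by
    conv_lhs => rw [← hρ_GI, Matrix.mul_assoc, M.projGI_mul_self]
    exact hρ_GI
  have hA := M.mem_gaugeInvariantAlgebra r
  let S := M.sectorData r
  obtain ⟨τ, hτ⟩ := S.exists_trace hA
  have hP : ∀ α, (S.compress hA ⟨S.P α, S.P_mem α⟩ : Matrix M.Config M.Config ℂ) =
      M.sectorProj r α := fun α => rfl
  let L : S.C := ⟨S.central fun α => (Real.log (S.d α) : ℂ), S.central_mem _⟩
  have hL : (S.compress hA L : Matrix M.Config M.Config ℂ) = M.extraArea r :=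
    (M.finsum_smul_sectorProj r _).symm
  have hLc : ∀ O ∈ S.C, Commute L.1 O := fun O hO => S.commute_central _ hO
  have hS := S.entropy_eq hA hτ hρ h1 h2
  have hτσ := S.trace_state hA hτ h1 h2 hρ_tr
  refine ⟨τ, S.state hA h1 h2, S.compress hA L,
    ⟨S.isNormalizedTrace hA hτ, fun τ' h' => (S.isNormalizedTrace hA hτ).unique h'⟩,
    ⟨S.isReducedState_state hA hτ h1 h2, fun σ' h' =>
      S.isReducedState_unique hA hτ (S.isReducedState_state hA hτ h1 h2) h'⟩,
    S.state_posSemidef hA hρ h1 h2, hτσ, fun α => ?_, fun α β hαβ => ?_,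
    M.finite_sectorProj_ne_zero r, M.finsum_sectorProj r,
    fun α => ⟨_, hP α, S.compress_mem_center hA (S.P_comm α)⟩, hL, S.compress_mem_center hA hLc, hS,
    ?_⟩
  · have h := S.compress_isStarProjection hA (O := ⟨S.P α, S.P_mem α⟩) (S.P_isProj α)
    exact ⟨congrArg Subtype.val h.1, congrArg Subtype.val h.2⟩
  · have h := S.compress_mul hA ⟨S.P α, S.P_mem α⟩ ⟨S.P β, S.P_mem β⟩
    have h0 : (⟨S.P α, S.P_mem α⟩ * ⟨S.P β, S.P_mem β⟩ : S.C) = 0 :=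
      Subtype.ext (S.P_orth α β hαβ)
    rw [h0, map_zero] at h
    exact (congrArg Subtype.val h).symm
  intro N L' B _ _ _ _ _ _ T R a _ _ _
  set c : ℝ := T.area a * Real.log T.bond
  have hone : (S.compress hA 1 : Matrix M.Config M.Config ℂ) = M.projGI := by
    change extendOp 1 * M.projGI = _
    rw [extendOp_one, Matrix.one_mul]
  have hAr : ((c : ℂ) • S.compress hA 1 + S.compress hA L : M.gaugeInvariantAlgebra r) =
      S.compress hA ((c : ℂ) • 1 + L) := by rw [map_add, map_smul]
  have hcoe : (((c : ℂ) • S.compress hA 1 + S.compress hA L : M.gaugeInvariantAlgebra r) :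
      Matrix M.Config M.Config ℂ) = (c : ℂ) • M.projGI + M.extraArea r :=
    congrArg₂ (fun x y => (c : ℂ) • x + y) hone hL
  -- The area term is a multiple of the unit of the algebra, and the state has trace one, so it
  -- contributes exactly `c`.
  have hστ : τ (S.state hA h1 h2 * ((c : ℂ) • S.compress hA 1 + S.compress hA L)) =
      c + τ (S.state hA h1 h2 * S.compress hA L) := by
    have hu : S.state hA h1 h2 * S.compress hA 1 = S.state hA h1 h2 := by
      rw [SectorData.state, ← SectorData.compress_mul, mul_one]
    rw [mul_add, mul_smul_comm, hu, map_add, map_smul, hτσ, smul_eq_mul, mul_one]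
  have hFLM : ((c + vnEntropy (partialTrace r ρ) : ℝ) : ℂ) =
      τ (S.state hA h1 h2 * ((c : ℂ) • S.compress hA 1 + S.compress hA L)) +
        (algEntropy τ (S.state hA h1 h2) : ℂ) := by
    rw [hστ, Complex.ofReal_add, hS]
    ring
  refine ⟨(c : ℂ) • S.compress hA 1 + S.compress hA L, ?_, hcoe, ?_, hFLM, fun h => ?_,
    fun ε h => ?_⟩
  · rw [hcoe, GaugeModel.extraArea]
    simp only [GaugeModel.log_cutDim]
  · rw [hAr]
    refine S.compress_mem_center hA fun O hO => ?_
    exact ((Commute.one_left O).smul_left (c : ℂ)).add_left (hLc O hO)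
  · rw [h, hFLM]
  · rw [← hFLM, ← Complex.ofReal_sub, Complex.norm_real]
    exact h
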